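/- **Setting.** Let $\mathcal C=\mathbb Q[\hbar]$ and $\mathfrak H=\mathcal C\langle a,b\rangle$. For $k\ge 1$ put $g_k=ba^k$ and $e_k=b(a+\hbar)a^{k-1}$, so $e_1-g_1=\hbar b$. Let $A=\{\hbar b\}\cup\{g_k\mid k\ge1\}$ (an algebraically independent set) and let $\mathcal C\langle A\rangle\subset\mathfrak H$ be the $\mathcal C$-subalgebra it generates. *Products.* The harmonic product $\ast_\hbar$ on $\mathcal C\langle A\rangle$ is the $\mathcal C$-bilinear product with unit $1$ and $(wu)\ast_\hbar(w'v)=(w\ast_\hbar w'v)u+(wu\ast_\hbar w')v+(w\ast_\hbar w')(u\circ_\hbar v)$ for $u,v\in A$, where $\hbar b\circ_\hbar \hbar b=\hbar\cdot\hbar b$, $\hbar b\circ_\hbar g_k=g_k\circ_\hbar\hbar b=\hbar g_k$, $g_k\circ_\hbar g_l=g_{k+l}$. The shuffle product $\mathrm{sh}_\hbar$ on $\mathfrak H$ is the $\mathcal C$-bilinear product with unit $1$ and $wa\,\mathrm{sh}_\hbar\,w'a=(wa\,\mathrm{sh}_\hbar\,w'+w\,\mathrm{sh}_\hbar\,w'a+\hbar\,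 w\,\mathrm{sh}_\hbar\,w')a$, $wb\,\mathrm{sh}_\hbar\,w'=w\,\mathrm{sh}_\hbar\,w'b=(w\,\mathrm{sh}_\hbar\,w')b$; it preserves $\mathcal C\langle A\rangle$. *Symmetrization.* Let $\psi^\ast,\psi^{\mathrm{sh}}$ be the $\mathcal C$-algebra anti-involutions of $\mathcal C\langle A\rangle$ with $\psi^\bullet(\hbar b)=\hbar b$, $\psi^\ast(ba^k)=b(-a)^k$, $\psi^{\mathrm{sh}}(ba^k)=b(-a-\hbar)^k$. For $\bullet\in\{\ast,\mathrm{sh}\}$ let $w_\hbar^{\mathcal S,\bullet}$ be the $\mathcal C$-linear endomorphism of $\mathcal C\langle A\rangle$ with $w_\hbar^{\mathcal S,\bullet}(u_1\cdots u_r)=\sum_{i=0}^r u_1\cdots u_i\bullet_\hbar\psi^\bullet(u_{i+1}\cdots u_r)$ for $r\ge 0$, $u_j\in A$. *Values.* Let $q\in\mathbb C$ with $0<|q|<1$, let $\hbar$ act on $\mathbb C$ as $1-q$, and let $[m]=\frac{1-q^m}{1-q}$. Put $F_q(m;\hbar b)=1-q$, $F_q(m;g_k)=q^{km}/[m]^k$,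 and let $Z_{q,M}:\mathcal C\langle A\rangle\to\mathbb C$ be the $\mathcal C$-linear map with $Z_{q,M}(u_1\cdots u_r)=\sum_{0<m_1<\cdots<m_r<M}\prod_i F_q(m_i;u_i)$ and $Z_{q,M}(1)=1$. On $\widehat{\mathfrak H^0}=\mathcal C+\sum_{k\ge1}\mathcal C\langle A\rangle g_k$ put $Z_q(w)=\lim_{M\to\infty}Z_{q,M}(w)$ (the limit exists). *Ideals.* Let $\mathfrak n_0$ be the $\mathcal C$-span of the elements $(\hbar b)^{\alpha_1}g_{\beta_1+1}\cdots(\hbar b)^{\alpha_r}g_{\beta_r+1}$ ($\alpha_i,\beta_i\ge0$, $r\ge1$) with $\alpha_s,\beta_t\ge1$ for some $1\le s\le t\le r$; let $\mathfrak n=\mathfrak n_0+\hbar\widehat{\mathfrak H^0}$ and $\mathfrak H^0=\mathcal C+\sum_{k\ge2}\mathcal C\langle A\rangle g_k+\mathfrak n$. Put $\mathcal Z_q=Z_q(\mathfrak H^0)$, $\mathcal N_q=Z_q(\mathfrak n)$, and let $\mathcal P_q$ be the ideal of $\mathcal Z_q$ generated by $\{Z_q(g_{2k})\mid k\ge1\}$,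 i.e. the set of finite sums of products of an element of $\mathcal Z_q$ and a generator. *Indices.* An index is a finite, possibly empty, tuple $\mathbf k=(k_1,\dots,k_r)$ of positive integers; $g_{\mathbf k}=g_{k_1}\cdots g_{k_r}$. Put $E_{1^m}=\frac1{(m+1)!}\sum_{j=0}^m g_1^{\mathrm{sh}_\hbar j}\,\mathrm{sh}_\hbar\,e_1^{\mathrm{sh}_\hbar(m-j)}$, and for $\mathbf k=(1^{s_0},t_1+2,1^{s_1},\dots,t_r+2,1^{s_r})$, where $1^{s}$ denotes $s$ consecutive entries equal to $1$ and $r,s_i,t_i\ge0$, put $E_{\mathbf k}=E_{1^{s_0}}e_{t_1+2}E_{1^{s_1}}\cdots e_{t_r+2}E_{1^{s_r}}$. Finally $$Z_q^{\mathcal S,\ast}(g_{\mathbf k})=\lim_{M\to\infty}Z_{q,M}\bigl(w_\hbar^{\mathcal S,\ast}(g_{\mathbf k})\bigr),\qquad Z_q^{\mathcal S,\mathrm{sh}}(E_{\mathbf k})=\lim_{M\to\infty}Z_{q,M}\bigl(w_\hbar^{\mathcal S,\mathrm{sh}}(E_{\mathbf k})\bigr).$$ **Statement.** For every $q\in\mathbb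 C$ with $0<|q|<1$, $\mathcal Z_q$ is a unital subring of $\mathbb C$ and $\mathcal N_q+\mathcal P_q$ is an ideal of $\mathcal Z_q$. For every index $\mathbf k$ both limits above exist and belong to $\mathcal Z_q$, and $$Z_q^{\mathcal S,\ast}(g_{\mathbf k})-Z_q^{\mathcal S,\mathrm{sh}}(E_{\mathbf k})\in\mathcal N_q+\mathcal P_q .$$ Hence $\zeta_q^{\mathcal S}(\mathbf k)$, the common class of $Z_q^{\mathcal S,\ast}(g_{\mathbf k})$ and $Z_q^{\mathcal S,\mathrm{sh}}(E_{\mathbf k})$ in $\mathcal Z_q/(\mathcal N_q+\mathcal P_q)$, is well defined. -/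

import Mathlib

open Filter Topology

noncomputable section

namespace QSMZV

/-! ### Non-commutative polynomial rings over `𝒞 = ℚ[ħ]` -/

/-- The coefficient ring `𝒞 = ℚ[ħ]`. -/
abbrev Coef : Type := Polynomial ℚ

/-- The formal variable `ħ`. -/
abbrev hbar : Coef := Polynomial.X

/-- The monomial `x₁ x₂ ⋯ xᵣ` in the non-commutative polynomial ring over `𝒞`. -/
def word {X : Type} (u : List X) : FreeAlgebra Coef X := (u.map (FreeAlgebra.ι Coef)).prod

/-- The monomials form a `𝒞`-basis of the non-commutative polynomial ring. -/
abbrev monBasis (X : Type) : Module.Basis (FreeMonoid X) Coef (FreeAlgebra Coef X) :=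
  FreeAlgebra.basisFreeMonoid Coef X

theorem monBasis_apply {X : Type} (u : FreeMonoid X) : monBasis X u = word u.toList := by
  have h : ∀ u : FreeMonoid X, FreeAlgebra.equivMonoidAlgebraFreeMonoid (R := Coef)
      (word u.toList) = MonoidAlgebra.of Coef (FreeMonoid X) u := by
    intro u
    induction u using FreeMonoid.inductionOn' with
    | one => simp [word, map_one]
    | of_mul x u ih =>
      have : word (FreeMonoid.of x * u).toList
          = FreeAlgebra.ι Coef x * word u.toList := by
        simp [word]
      rw [this, map_mul, ih, map_mul]
      simp [FreeAlgebra.equivMonoidAlgebraFreeMonoid]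
  apply (FreeAlgebra.equivMonoidAlgebraFreeMonoid (R := Coef) (X := X)).injective
  rw [h]
  simp [monBasis, FreeAlgebra.basisFreeMonoid]

/-- The two variables `a`, `b`. -/
inductive AB : Type
  | a
  | b

/-- `ℌ = 𝒞⟨a, b⟩`. -/
abbrev H : Type := FreeAlgebra Coef AB

/-- The set `A = {ħb} ∪ {b aᵏ | k ≥ 1}`: the letter `hb` stands for `ħb = e₁ - g₁`, the letter
`g k` for `gₖ = b aᵏ`. -/
inductive Letter : Type
  | hb
  | g (k : ℕ+)

/-- `𝒞⟨A⟩`, the non-commutative polynomial ring over `𝒞` in the letters of `A`. It is identified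
with a `𝒞`-subalgebra of `ℌ` by `embed` below, which is injective. -/
abbrev CA : Type := FreeAlgebra Coef Letter

/-- The variable `a` of `ℌ`. -/
def aH : H := FreeAlgebra.ι Coef AB.a

/-- The variable `b` of `ℌ`. -/
def bH : H := FreeAlgebra.ι Coef AB.b

/-- The element `ħb = e₁ - g₁` of `𝒞⟨A⟩`. -/
def hb : CA := FreeAlgebra.ι Coef Letter.hb

/-- The element `gₖ` of `𝒞⟨A⟩`, `k ≥ 1`. -/
def g (k : ℕ+) : CA := FreeAlgebra.ι Coef (Letter.g k)

/-- The inclusion `𝒞⟨A⟩ → ℌ`, `ħb ↦ ħb`, `gₖ ↦ b aᵏ`. -/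
def embed : CA →ₐ[Coef] H :=
  FreeAlgebra.lift Coef fun x => match x with
    | Letter.hb => hbar • bH
    | Letter.g k => bH * aH ^ (k : ℕ)

theorem word_append {X : Type} (u v : List X) : word (u ++ v) = word u * word v := by
  simp [word]

/-- Two linear maps that agree on words are equal. -/
theorem word_ext {X : Type} {M : Type} [AddCommMonoid M] [Module Coef M]
    {f f' : FreeAlgebra Coef X →ₗ[Coef] M} (h : ∀ u : List X, f (word u) = f' (word u)) :
    f = f' :=
  (monBasis X).ext fun u => by rw [monBasis_apply]; exact h _

/-- The word in `a`, `b` underlying a letter of `A`. -/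
def flatLetter : Letter → List AB
  | Letter.hb => [AB.b]
  | Letter.g k => AB.b :: List.replicate k AB.a

/-- The power of `ħ` carried by a letter of `A`. -/
def hbarDeg : Letter → ℕ
  | Letter.hb => 1
  | Letter.g _ => 0

theorem embed_word (u : List Letter) :
    embed (word u) = hbar ^ (u.map hbarDeg).sum • word (u.flatMap flatLetter) := by
  induction u with
  | nil => simp [word]
  | cons x u ih =>
    have h1 : word (x :: u) = FreeAlgebra.ι Coef x * word u := by simp [word]
    have h2 : embed (FreeAlgebra.ι Coef x) = hbar ^ hbarDeg x • word (flatLetter x) := by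
      cases x <;> simp [embed, hbarDeg, flatLetter, word, aH, bH]
    rw [h1, map_mul, ih, h2, List.flatMap_cons, word_append, List.map_cons, List.sum_cons,
      pow_add, smul_mul_smul_comm]

theorem flat_injective : Function.Injective fun u : List Letter => u.flatMap flatLetter := by
  let step : AB → ℕ × List Letter → ℕ × List Letter := fun x s => match x with
    | AB.a => (s.1 + 1, s.2)
    | AB.b => (0, (if h : 0 < s.1 then Letter.g ⟨s.1, h⟩ else Letter.hb) :: s.2)
  have hrep : ∀ (k c : ℕ) (L : List Letter),
      List.foldr step (c, L) (List.replicate k AB.a) = (c + k, L) := by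
    intro k c L
    induction k with
    | zero => simp
    | succ k ih => rw [List.replicate_succ, List.foldr_cons, ih]; simp [step, add_assoc]
  have hdec : ∀ u : List Letter, List.foldr step (0, []) (u.flatMap flatLetter) = (0, u) := by
    intro u
    induction u with
    | nil => rfl
    | cons x u ih =>
      rw [List.flatMap_cons, List.foldr_append, ih]
      cases x with
      | hb => simp [flatLetter, step]
      | g k => rw [flatLetter, List.foldr_cons, hrep]; simp [step]; rfl
  intro u v h
  have := congrArg (List.foldr step (0, [])) h
  simp only [hdec] at this
  exact (Prod.mk.inj this).2

/-- The set `A` is algebraically independent. -/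
theorem embed_injective : Function.Injective embed := by
  classical
  have key : ∀ (u : FreeMonoid Letter) (x : CA),
      (monBasis AB).repr (embed x) (FreeMonoid.ofList (u.toList.flatMap flatLetter))
        = hbar ^ (u.toList.map hbarDeg).sum * (monBasis Letter).repr x u := by
    intro u x
    have h : (Finsupp.lapply (FreeMonoid.ofList (u.toList.flatMap flatLetter))).comp
        ((monBasis AB).repr.toLinearMap.comp embed.toLinearMap)
        = hbar ^ (u.toList.map hbarDeg).sum •
          (Finsupp.lapply u).comp (monBasis Letter).repr.toLinearMap := by
      apply word_ext
      intro v
      have h1 : word v = monBasis Letter (FreeMonoid.ofList v) := (monBasis_apply _).symm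
      have h2 : word (v.flatMap flatLetter)
          = monBasis AB (FreeMonoid.ofList (v.flatMap flatLetter)) := (monBasis_apply _).symm
      simp only [LinearMap.comp_apply, AlgHom.toLinearMap_apply, embed_word, map_smul,
        LinearMap.smul_apply, LinearEquiv.coe_coe]
      rw [h1, h2]
      simp only [Module.Basis.repr_self, Finsupp.lapply_apply, smul_eq_mul, Finsupp.single_apply]
      by_cases h : FreeMonoid.ofList v = u
      · subst h; simp
      · have : ¬ (FreeMonoid.ofList (v.flatMap flatLetter)
            = FreeMonoid.ofList (u.toList.flatMap flatLetter)) := fun h' =>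
          h (FreeMonoid.toList.injective (flat_injective (FreeMonoid.ofList.injective h')))
        simp [h, this]
    exact congrArg (fun f => f x) h
  rw [injective_iff_map_eq_zero]
  intro x hx
  apply (monBasis Letter).repr.injective
  ext1 u
  have := key u x
  rw [hx] at this
  simp only [map_zero, Finsupp.coe_zero, Pi.zero_apply] at this ⊢
  rcases mul_eq_zero.1 this.symm with h | h
  · exact absurd h (pow_ne_zero _ Polynomial.X_ne_zero)
  · exact h

/-! ### The shuffle product -/

/-- The shuffle product of two words in `a`, `b`, both written from right to left. -/
def shRev : List AB → List AB → H
  | [], v => word v.reverse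
  | AB.b :: u, v => shRev u v * bH
  | AB.a :: u, [] => word (AB.a :: u).reverse
  | AB.a :: u, AB.b :: v => shRev (AB.a :: u) v * bH
  | AB.a :: u, AB.a :: v =>
      (shRev (AB.a :: u) v + shRev u (AB.a :: v) + hbar • shRev u v) * aH
  termination_by u v => u.length + v.length

/-- The shuffle product on `ℌ`, as a `𝒞`-bilinear map. It is determined by the rules
`shH_one_left`, `shH_one_right`, `shH_b_left`, `shH_b_right` and `shH_a_a`. -/
def shH : H →ₗ[Coef] H →ₗ[Coef] H :=
  (monBasis AB).constr Coef fun u =>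
    (monBasis AB).constr Coef fun v => shRev u.toList.reverse v.toList.reverse

theorem shH_word (u v : List AB) : shH (word u) (word v) = shRev u.reverse v.reverse := by
  have h : ∀ w : List AB, word w = monBasis AB (FreeMonoid.ofList w) := fun w =>
    (monBasis_apply (FreeMonoid.ofList w)).symm
  rw [h u, h v, shH, Module.Basis.constr_basis, Module.Basis.constr_basis]
  rfl

theorem shRev_nil_right (u : List AB) : shRev u [] = word u.reverse := by
  induction u with
  | nil => simp [shRev]
  | cons x u ih =>
    cases x
    · rw [shRev]
    · rw [shRev, ih, List.reverse_cons, word_append]; simp [word, bH]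

theorem shRev_b_right (u v : List AB) : shRev u (AB.b :: v) = shRev u v * bH := by
  induction u with
  | nil => simp [shRev, word, bH]
  | cons x u ih =>
    cases x
    · rw [shRev]
    · rw [shRev, ih, shRev]

theorem shH_one_left (w : H) : shH 1 w = w := by
  have : shH 1 = LinearMap.id := word_ext fun u => by
    rw [show (1 : H) = word [] from rfl, shH_word]; simp [shRev]
  rw [this]; rfl

theorem shH_one_right (w : H) : shH w 1 = w := by
  have : shH.flip 1 = LinearMap.id := word_ext fun u => by
    rw [show (1 : H) = word [] from rfl, LinearMap.flip_apply, shH_word]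
    simp [shRev_nil_right]
  exact congrArg (fun f => f w) this

theorem word_mul_a (u : List AB) : word u * aH = word (u ++ [AB.a]) := by
  rw [word_append]; simp [word, aH]

theorem word_mul_b (u : List AB) : word u * bH = word (u ++ [AB.b]) := by
  rw [word_append]; simp [word, bH]

/-- Two bilinear maps that agree on pairs of words are equal. -/
theorem word_ext2 {X : Type} {M : Type} [AddCommMonoid M] [Module Coef M]
    {f f' : FreeAlgebra Coef X →ₗ[Coef] FreeAlgebra Coef X →ₗ[Coef] M}
    (h : ∀ u v : List X, f (word u) (word v) = f' (word u) (word v)) (x y : FreeAlgebra Coef X) :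
    f x y = f' x y := by
  have : f = f' := word_ext fun u => word_ext fun v => h u v
  rw [this]

theorem shH_b_left (w w' : H) : shH (w * bH) w' = shH w w' * bH :=
  word_ext2 (f := shH.comp (LinearMap.mulRight Coef bH))
    (f' := shH.compr₂ (LinearMap.mulRight Coef bH)) (fun u v => by
      simp [word_mul_b, shH_word, shRev]) w w'

theorem shH_b_right (w w' : H) : shH w (w' * bH) = shH w w' * bH :=
  word_ext2 (f := shH.compl₂ (LinearMap.mulRight Coef bH))
    (f' := shH.compr₂ (LinearMap.mulRight Coef bH)) (fun u v => by
      simp [word_mul_b, shH_word, shRev_b_right]) w w'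

theorem shH_a_a (w w' : H) : shH (w * aH) (w' * aH)
    = (shH (w * aH) w' + shH w (w' * aH) + hbar • shH w w') * aH :=
  word_ext2
    (f := (shH.comp (LinearMap.mulRight Coef aH)).compl₂ (LinearMap.mulRight Coef aH))
    (f' := (shH.comp (LinearMap.mulRight Coef aH) + shH.compl₂ (LinearMap.mulRight Coef aH)
      + hbar • shH).compr₂ (LinearMap.mulRight Coef aH)) (fun u v => by
      simp [word_mul_a, shH_word, shRev]) w w'

theorem embed_g (k : ℕ+) : embed (g k) = bH * aH ^ (k : ℕ) := by simp [embed, g]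

theorem embed_hb : embed hb = hbar • bH := by simp [embed, hb]

/-- The span of the non-empty words in the letters of `A`. -/
def augH : Submodule Coef H :=
  Submodule.span Coef {x | ∃ (u : List Letter) (y : Letter),
    x = embed (word u * FreeAlgebra.ι Coef y)}

theorem augH_le : augH ≤ LinearMap.range embed.toLinearMap := by
  rw [augH, Submodule.span_le]
  rintro _ ⟨u, y, rfl⟩
  exact ⟨_, rfl⟩

theorem mul_letter_mem {x : H} (hx : x ∈ LinearMap.range embed.toLinearMap) (y : Letter) :
    x * embed (FreeAlgebra.ι Coef y) ∈ augH := by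
  obtain ⟨w, rfl⟩ := hx
  have h : ∀ w ∈ Submodule.span Coef (Set.range (monBasis Letter)),
      embed w * embed (FreeAlgebra.ι Coef y) ∈ augH := by
    intro w hw
    induction hw using Submodule.span_induction with
    | mem w hw =>
      obtain ⟨u, rfl⟩ := hw
      rw [← map_mul, monBasis_apply]
      exact Submodule.subset_span ⟨_, _, rfl⟩
    | zero => simp
    | add x y _ _ hx hy => rw [map_add, add_mul]; exact add_mem hx hy
    | smul c x _ hx => rw [map_smul, smul_mul_assoc]; exact Submodule.smul_mem _ _ hx
  exact h w (by rw [Module.Basis.span_eq]; trivial)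

theorem mul_a_mem {x : H} (hx : x ∈ augH) : x * aH ∈ augH := by
  rw [augH] at hx
  induction hx using Submodule.span_induction with
  | mem x hx =>
    obtain ⟨u, y, rfl⟩ := hx
    cases y with
    | hb =>
      have : embed (word u * FreeAlgebra.ι Coef Letter.hb) * aH
          = hbar • (embed (word u) * embed (FreeAlgebra.ι Coef (Letter.g 1))) := by
        have h1 := embed_g 1
        have h2 := embed_hb
        rw [g] at h1
        rw [hb] at h2
        rw [map_mul, h1, h2]
        simp [mul_assoc]
      rw [this]
      exact Submodule.smul_mem _ _ (mul_letter_mem ⟨_, rfl⟩ _)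
    | g k =>
      have : embed (word u * FreeAlgebra.ι Coef (Letter.g k)) * aH
          = embed (word u) * embed (FreeAlgebra.ι Coef (Letter.g (k + 1))) := by
        have h1 := embed_g k
        have h2 := embed_g (k + 1)
        rw [g] at h1 h2
        rw [map_mul, h1, h2]
        simp [mul_assoc, pow_succ]
      rw [this]
      exact mul_letter_mem ⟨_, rfl⟩ _
  | zero => simp
  | add x y _ _ hx hy => rw [add_mul]; exact add_mem hx hy
  | smul c x _ hx => rw [smul_mul_assoc]; exact Submodule.smul_mem _ _ hx

/-- The length in `a`, `b` of a letter of `A`. -/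
def len : Letter → ℕ
  | Letter.hb => 1
  | Letter.g k => k + 1

theorem shH_word_mem (n : ℕ) : ∀ u v : List Letter, (u.map len).sum + (v.map len).sum = n →
    (u ≠ [] ∨ v ≠ []) → shH (embed (word u)) (embed (word v)) ∈ augH := by
  induction n using Nat.strong_induction_on with
  | _ n ih =>
  have ihS : ∀ u v : List Letter, (u.map len).sum + (v.map len).sum < n →
      shH (embed (word u)) (embed (word v)) ∈ LinearMap.range embed.toLinearMap := by
    intro u v h
    by_cases h0 : u ≠ [] ∨ v ≠ []
    · exact augH_le (ih _ h u v rfl h0)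
    · push Not at h0
      rw [h0.1, h0.2]
      refine ⟨1, ?_⟩
      simp [word, shH_one_left]
  intro u v hn huv
  have hsnoc : ∀ (u : List Letter) (y : Letter),
      embed (word (u ++ [y])) = embed (word u) * embed (FreeAlgebra.ι Coef y) := by
    intro u y
    rw [word_append, map_mul]; simp [word]
  rcases u.eq_nil_or_concat' with rfl | ⟨u, y, rfl⟩
  · rcases v.eq_nil_or_concat' with rfl | ⟨v, z, rfl⟩
    · simp at huv
    · rw [show embed (word []) = 1 by simp [word], shH_one_left, hsnoc]
      exact mul_letter_mem ⟨_, rfl⟩ _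
  rcases v.eq_nil_or_concat' with rfl | ⟨v, z, rfl⟩
  · rw [show embed (word []) = 1 by simp [word], shH_one_right, hsnoc]
    exact mul_letter_mem ⟨_, rfl⟩ _
  rw [← hn] at ih ihS
  clear hn huv
  simp only [List.map_append, List.map_cons, List.map_nil, List.sum_append, List.sum_cons,
    List.sum_nil, add_zero] at ih ihS
  cases y with
  | hb =>
    have h1 := embed_hb
    rw [hb] at h1
    rw [hsnoc u, h1, mul_smul_comm, map_smul, LinearMap.smul_apply, shH_b_left,
      ← mul_smul_comm, ← h1]
    exact mul_letter_mem (ihS _ _ (by simp [len])) _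
  | g k =>
  cases z with
  | hb =>
    have h1 := embed_hb
    rw [hb] at h1
    rw [hsnoc v, h1, mul_smul_comm, map_smul, shH_b_right, ← mul_smul_comm, ← h1]
    exact mul_letter_mem (ihS _ _ (by simp [len])) _
  | g l =>
  have hg : ∀ (u : List Letter) (k : ℕ), embed (word (u ++ [Letter.g k.succPNat]))
      = embed (word u) * (bH * aH ^ k) * aH := by
    intro u k
    have h1 := embed_g k.succPNat
    rw [g] at h1
    rw [hsnoc, h1]
    simp [mul_assoc, pow_succ]
  have hg1 : ∀ x : H, x ∈ LinearMap.range embed.toLinearMap → x * bH * aH ∈ augH := by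
    intro x hx
    have h1 := mul_letter_mem hx (Letter.g 1)
    have h2 := embed_g 1
    rw [g] at h2
    rw [h2] at h1
    simpa [mul_assoc] using h1
  obtain ⟨k, rfl⟩ : ∃ k' : ℕ, k = k'.succPNat := ⟨k.natPred, by simp⟩
  obtain ⟨l, rfl⟩ : ∃ l' : ℕ, l = l'.succPNat := ⟨l.natPred, by simp⟩
  rw [hg u k, hg v l, shH_a_a, ← hg u k, ← hg v l, add_mul, add_mul, smul_mul_assoc]
  simp only [len, Nat.succPNat_coe, Nat.succ_eq_add_one] at ih ihS
  refine add_mem (add_mem ?_ ?_) ?_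
  · cases l with
    | zero =>
      rw [pow_zero, mul_one, shH_b_right]
      exact hg1 _ (ihS _ _ (by simp [len]))
    | succ l =>
      rw [pow_succ, ← mul_assoc bH, ← mul_assoc, ← hg v l]
      exact mul_a_mem (ih _ (by simp [len]) _ _ rfl (by simp))
  · cases k with
    | zero =>
      rw [pow_zero, mul_one, shH_b_left]
      exact hg1 _ (ihS _ _ (by simp [len]))
    | succ k =>
      rw [pow_succ, ← mul_assoc bH, ← mul_assoc, ← hg u k]
      exact mul_a_mem (ih _ (by simp [len]) _ _ rfl (by simp))
  · cases l with
    | zero =>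
      rw [pow_zero, mul_one, shH_b_right]
      cases k with
      | zero =>
        rw [pow_zero, mul_one, shH_b_left, ← smul_mul_assoc, ← smul_mul_assoc, ← mul_smul_comm,
          ← embed_hb]
        exact hg1 _ (augH_le (mul_letter_mem (ihS _ _ (by simp; omega)) _))
      | succ k =>
        rw [pow_succ, ← mul_assoc bH, ← mul_assoc, ← hg u k]
        exact Submodule.smul_mem _ _ (hg1 _ (ihS _ _ (by simp [len]; omega)))
    | succ l =>
      rw [pow_succ, ← mul_assoc bH (aH ^ l), ← mul_assoc _ (bH * aH ^ l), ← hg v l]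
      cases k with
      | zero =>
        rw [pow_zero, mul_one, shH_b_left]
        exact Submodule.smul_mem _ _ (hg1 _ (ihS _ _ (by simp [len]; omega)))
      | succ k =>
        rw [pow_succ, ← mul_assoc bH, ← mul_assoc, ← hg u k]
        exact Submodule.smul_mem _ _ (mul_a_mem (ih _ (by simp [len]; omega) _ _ rfl (by simp)))

/-- `𝒞⟨A⟩` is closed under the shuffle product. -/
theorem shH_mem (x y : CA) : ∃ z : CA, embed z = shH (embed x) (embed y) := by
  have hw : ∀ u v : List Letter,
      shH (embed (word u)) (embed (word v)) ∈ LinearMap.range embed.toLinearMap := by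
    intro u v
    by_cases h0 : u ≠ [] ∨ v ≠ []
    · exact augH_le (shH_word_mem _ u v rfl h0)
    · push Not at h0
      rw [h0.1, h0.2]
      exact ⟨1, by simp [word, shH_one_left]⟩
  have h1 : ∀ x ∈ Submodule.span Coef (Set.range (monBasis Letter)),
      ∀ y ∈ Submodule.span Coef (Set.range (monBasis Letter)),
      shH (embed x) (embed y) ∈ LinearMap.range embed.toLinearMap := by
    intro x hx y hy
    induction hx using Submodule.span_induction with
    | mem x hx =>
      obtain ⟨u, rfl⟩ := hx
      induction hy using Submodule.span_induction with
      | mem y hy =>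
        obtain ⟨v, rfl⟩ := hy
        rw [monBasis_apply, monBasis_apply]
        exact hw _ _
      | zero => simp
      | add x y _ _ hx hy => rw [map_add, map_add]; exact add_mem hx hy
      | smul c x _ hx => rw [map_smul, map_smul]; exact Submodule.smul_mem _ _ hx
    | zero => simp
    | add x y _ _ hx hy =>
      rw [map_add, map_add, LinearMap.add_apply]; exact add_mem hx hy
    | smul c x _ hx =>
      rw [map_smul, map_smul, LinearMap.smul_apply]; exact Submodule.smul_mem _ _ hx
  exact h1 x (by rw [Module.Basis.span_eq]; trivial) y (by rw [Module.Basis.span_eq]; trivial)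

/-- The shuffle product on `𝒞⟨A⟩`: the restriction of the shuffle product of `ℌ`. -/
def sh (x y : CA) : CA := (shH_mem x y).choose

theorem embed_sh (x y : CA) : embed (sh x y) = shH (embed x) (embed y) :=
  (shH_mem x y).choose_spec

/-! ### The harmonic product -/

/-- The product `∘_ħ` of two letters of `A`. -/
def circ : Letter → Letter → CA
  | Letter.hb, Letter.hb => hbar • hb
  | Letter.hb, Letter.g k => hbar • g k
  | Letter.g k, Letter.hb => hbar • g k
  | Letter.g k, Letter.g l => g (k + l)

/-- The harmonic product of two words in the letters of `A`, both written from right to left. -/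
def harRev : List Letter → List Letter → CA
  | [], v => word v.reverse
  | x :: u, [] => word (x :: u).reverse
  | x :: u, y :: v =>
      harRev u (y :: v) * FreeAlgebra.ι Coef x + harRev (x :: u) v * FreeAlgebra.ι Coef y
        + harRev u v * circ x y
  termination_by u v => u.length + v.length

/-- The harmonic product `∗_ħ` on `𝒞⟨A⟩`, as a `𝒞`-bilinear map. It is determined by the rules
`har_one_left`, `har_one_right` and `har_mul_mul`. -/
def har : CA →ₗ[Coef] CA →ₗ[Coef] CA :=
  (monBasis Letter).constr Coef fun u =>
    (monBasis Letter).constr Coef fun v => harRev u.toList.reverse v.toList.reverse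

theorem har_word (u v : List Letter) : har (word u) (word v) = harRev u.reverse v.reverse := by
  have h : ∀ w : List Letter, word w = monBasis Letter (FreeMonoid.ofList w) := fun w =>
    (monBasis_apply (FreeMonoid.ofList w)).symm
  rw [h u, h v, har, Module.Basis.constr_basis, Module.Basis.constr_basis]
  rfl

theorem har_one_left (w : CA) : har 1 w = w := by
  have : har 1 = LinearMap.id := word_ext fun u => by
    rw [show (1 : CA) = word [] from rfl, har_word]; simp [harRev]
  rw [this]; rfl

theorem harRev_nil_right (u : List Letter) : harRev u [] = word u.reverse := by
  cases u <;> rw [harRev]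

theorem har_one_right (w : CA) : har w 1 = w := by
  have : har.flip 1 = LinearMap.id := word_ext fun u => by
    rw [show (1 : CA) = word [] from rfl, LinearMap.flip_apply, har_word]
    simp [harRev_nil_right]
  exact congrArg (fun f => f w) this

theorem word_mul_letter (u : List Letter) (x : Letter) :
    word u * FreeAlgebra.ι Coef x = word (u ++ [x]) := by
  rw [word_append]; simp [word]

theorem har_mul_mul (w w' : CA) (x y : Letter) :
    har (w * FreeAlgebra.ι Coef x) (w' * FreeAlgebra.ι Coef y)
      = har w (w' * FreeAlgebra.ι Coef y) * FreeAlgebra.ι Coef x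
        + har (w * FreeAlgebra.ι Coef x) w' * FreeAlgebra.ι Coef y + har w w' * circ x y :=
  word_ext2
    (f := (har.comp (LinearMap.mulRight Coef (FreeAlgebra.ι Coef x))).compl₂
      (LinearMap.mulRight Coef (FreeAlgebra.ι Coef y)))
    (f' := (har.compl₂ (LinearMap.mulRight Coef (FreeAlgebra.ι Coef y))).compr₂
        (LinearMap.mulRight Coef (FreeAlgebra.ι Coef x))
      + (har.comp (LinearMap.mulRight Coef (FreeAlgebra.ι Coef x))).compr₂
        (LinearMap.mulRight Coef (FreeAlgebra.ι Coef y))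
      + har.compr₂ (LinearMap.mulRight Coef (circ x y))) (fun u v => by
      simp [word_mul_letter, har_word, harRev]) w w'

/-! ### The anti-involutions `ψ` and the maps `w^𝒮` -/

/-- The values of `ψ^∗` on letters: `ψ^∗(ħb) = ħb` and `ψ^∗(b aᵏ) = b (-a)ᵏ`. -/
def psiStarLetter : Letter → CA
  | Letter.hb => hb
  | Letter.g k => (-1 : Coef) ^ (k : ℕ) • g k

/-- The values of `ψ^sh` on letters: `ψ^sh(ħb) = ħb` and `ψ^sh(b aᵏ) = b (-a-ħ)ᵏ`, the latter
expanded in the letters of `A`; see `embed_psiShLetter`. -/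
def psiShLetter : Letter → CA
  | Letter.hb => hb
  | Letter.g k => (-1 : Coef) ^ (k : ℕ) • (hbar ^ ((k : ℕ) - 1) • hb
      + ∑ i ∈ Finset.range k,
          ((k : ℕ).choose (i + 1) : Coef) • hbar ^ ((k : ℕ) - (i + 1)) • g i.succPNat)

theorem embed_psiStarLetter (k : ℕ+) :
    embed (psiStarLetter (Letter.g k)) = bH * (-aH) ^ (k : ℕ) := by
  rw [psiStarLetter, map_smul, embed_g, neg_pow aH, ← mul_smul_comm]
  congr 1
  rw [Algebra.smul_def]; simp

theorem embed_psiShLetter (k : ℕ+) :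
    embed (psiShLetter (Letter.g k)) = bH * (-aH - algebraMap Coef H hbar) ^ (k : ℕ) := by
  have hc : Commute aH (algebraMap Coef H hbar) := (Algebra.commutes _ _).symm
  rw [← neg_add', neg_pow (aH + _), hc.add_pow, Finset.sum_range_succ', psiShLetter, map_smul,
    map_add, map_sum, map_smul, embed_hb, ← mul_assoc,
    show bH * (-1 : H) ^ (k : ℕ) = (-1 : Coef) ^ (k : ℕ) • bH by
      rw [Algebra.smul_def, map_pow, map_neg, map_one]
      exact (((Commute.one_right bH).neg_right).pow_right _), smul_mul_assoc]
  congr 1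
  rw [mul_add, Finset.mul_sum, add_comm]
  congr 1
  · refine Finset.sum_congr rfl fun i _ => ?_
    rw [map_smul, map_smul, embed_g, Nat.succPNat_coe, ← map_pow,
      ← map_natCast (algebraMap Coef H), mul_assoc, ← map_mul, ← mul_assoc,
      ← Algebra.commutes, Algebra.smul_def, Algebra.smul_def, ← mul_assoc, ← map_mul,
      mul_comm (hbar ^ _)]
  · obtain ⟨j, hj⟩ : ∃ j : ℕ, (k : ℕ) = j + 1 := ⟨k.natPred, by simp⟩
    rw [smul_smul, hj, ← pow_succ, Algebra.smul_def, Algebra.commutes]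
    simp

/-- The `𝒞`-algebra anti-endomorphism `ψ^∗` of `𝒞⟨A⟩`. -/
def psiStar (w : CA) : CA :=
  (FreeAlgebra.lift Coef (fun x => MulOpposite.op (psiStarLetter x)) w).unop

/-- The `𝒞`-algebra anti-endomorphism `ψ^sh` of `𝒞⟨A⟩`. -/
def psiSh (w : CA) : CA :=
  (FreeAlgebra.lift Coef (fun x => MulOpposite.op (psiShLetter x)) w).unop

/-- The `𝒞`-linear map `w^{𝒮,∗}_ħ`, given on words by
`u₁ ⋯ uᵣ ↦ ∑_{i=0}^r u₁ ⋯ uᵢ ∗_ħ ψ^∗(uᵢ₊₁ ⋯ uᵣ)`. -/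
def wStar : CA →ₗ[Coef] CA :=
  (monBasis Letter).constr Coef fun u =>
    ∑ i ∈ Finset.range (u.toList.length + 1),
      har (word (u.toList.take i)) (psiStar (word (u.toList.drop i)))

/-- The `𝒞`-linear map `w^{𝒮,sh}_ħ`, given on words by
`u₁ ⋯ uᵣ ↦ ∑_{i=0}^r u₁ ⋯ uᵢ sh_ħ ψ^sh(uᵢ₊₁ ⋯ uᵣ)`. -/
def wSh : CA →ₗ[Coef] CA :=
  (monBasis Letter).constr Coef fun u =>
    ∑ i ∈ Finset.range (u.toList.length + 1),
      sh (word (u.toList.take i)) (psiSh (word (u.toList.drop i)))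

/-! ### The elements `g_𝐤` and `E_𝐤`

An index is a finite, possibly empty, list of positive integers. -/

/-- `g_𝐤 = g_{k₁} ⋯ g_{kᵣ}`. -/
def gIdx (k : List ℕ+) : CA := (k.map g).prod

/-- `eₖ = b (a + ħ) a^{k-1}`, that is, `e₁ = ħb + g₁` and `eₖ = gₖ + ħ gₖ₋₁` for `k ≥ 2`. -/
def e (k : ℕ+) : CA := if k = 1 then hb + g 1 else g k + hbar • g (k - 1)

theorem embed_e (k : ℕ+) :
    embed (e k) = bH * (aH + algebraMap Coef H hbar) * aH ^ ((k : ℕ) - 1) := by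
  rw [e]
  split_ifs with h
  · subst h
    simp only [map_add, embed_hb, embed_g, PNat.one_coe, pow_one, Nat.sub_self, pow_zero, mul_one,
      mul_add, ← Algebra.commutes, Algebra.smul_def]
    rw [add_comm]
  · obtain ⟨j, rfl⟩ : ∃ j : ℕ+, k = j + 1 := ⟨k - 1, (PNat.sub_add_of_lt (by
      exact lt_of_le_of_ne (one_le (a := k)) (Ne.symm h))).symm⟩
    have h1 : j + 1 - 1 = j := by
      apply PNat.coe_injective
      rw [PNat.sub_coe]
      simp
    rw [h1, map_add, map_smul, embed_g, embed_g]
    simp [mul_add, add_mul, mul_assoc, pow_succ', Algebra.smul_def]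
    rw [← mul_assoc, Algebra.commutes, mul_assoc]

/-- The `j`-th power of `u` with respect to the shuffle product. -/
def shPow (u : CA) : ℕ → CA
  | 0 => 1
  | j + 1 => sh u (shPow u j)

/-- `E_{1^m} = 1/(m+1)! ∑_{j=0}^m g₁^{sh j} sh e₁^{sh (m-j)}`. -/
def EOnes (m : ℕ) : CA :=
  ((m + 1).factorial : ℚ)⁻¹ • ∑ j ∈ Finset.range (m + 1), sh (shPow (g 1) j) (shPow (e 1) (m - j))

/-- `EAux s 𝐤 = E_{(1,…,1,𝐤)}` with `s` ones in front of `𝐤`: each maximal block of ones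
contributes a factor `E_{1^s}`, each component `k ≥ 2` a factor `eₖ`. -/
def EAux : ℕ → List ℕ+ → CA
  | s, [] => EOnes s
  | s, k :: l => if k = 1 then EAux (s + 1) l else EOnes s * e k * EAux 0 l

/-- `E_𝐤 = E_{1^{s₀}} e_{t₁+2} E_{1^{s₁}} ⋯ e_{tᵣ+2} E_{1^{sᵣ}}` for
`𝐤 = (1^{s₀}, t₁+2, 1^{s₁}, …, tᵣ+2, 1^{sᵣ})`. -/
def EIdx (k : List ℕ+) : CA := EAux 0 k

/-! ### Submodules of `𝒞⟨A⟩` -/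

/-- `Ĥ⁰ = 𝒞 + ∑_{k ≥ 1} 𝒞⟨A⟩ gₖ`. -/
def hatH0 : Submodule Coef CA :=
  1 ⊔ ⨆ k : ℕ+, LinearMap.range (LinearMap.mulRight Coef (g k))

/-- `𝔫₀`, the span of the elements `(ħb)^{α₁} g_{β₁+1} ⋯ (ħb)^{αᵣ} g_{βᵣ+1}` with
`α_s, β_t ≥ 1` for some `s ≤ t`. -/
def n0 : Submodule Coef CA :=
  Submodule.span Coef {x | ∃ (r : ℕ) (α β : Fin r → ℕ) (s t : Fin r),
    s ≤ t ∧ 1 ≤ α s ∧ 1 ≤ β t ∧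
    x = (List.ofFn fun i => hb ^ α i * g (β i).succPNat).prod}

/-- `𝔫 = 𝔫₀ + ħ Ĥ⁰`. -/
def nn : Submodule Coef CA := n0 ⊔ hatH0.map (LinearMap.lsmul Coef CA hbar)

/-- `ℌ⁰ = 𝒞 + ∑_{k ≥ 2} 𝒞⟨A⟩ gₖ + 𝔫`. -/
def H0 : Submodule Coef CA :=
  1 ⊔ (⨆ k : ℕ+, ⨆ _ : 2 ≤ k, LinearMap.range (LinearMap.mulRight Coef (g k))) ⊔ nn

theorem mul_g_mem_hatH0 (x : CA) (k : ℕ+) : x * g k ∈ hatH0 :=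
  (le_sup_right : _ ≤ hatH0) (Submodule.mem_iSup_of_mem k ⟨x, rfl⟩)

theorem nn_le : nn ≤ hatH0 := by
  refine sup_le ?_ ?_
  · rw [n0, Submodule.span_le]
    rintro _ ⟨r, α, β, s, t, -, -, -, rfl⟩
    cases r with
    | zero => exact s.elim0
    | succ r =>
      rw [List.ofFn_succ', List.concat_eq_append, List.prod_append, List.prod_singleton,
        ← mul_assoc]
      exact mul_g_mem_hatH0 _ _
  · rintro _ ⟨x, hx, rfl⟩
    exact Submodule.smul_mem _ _ hx

theorem H0_le : H0 ≤ hatH0 :=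
  sup_le (sup_le le_sup_left (iSup_le fun k => iSup_le fun _ => le_trans
    (le_iSup (fun k : ℕ+ => LinearMap.range (LinearMap.mulRight Coef (g k))) k) le_sup_right))
    nn_le

/-! ### The evaluation maps -/

/-- The ring homomorphism `𝒞 → ℂ`, `ħ ↦ 1 - q`, through which `𝒞` acts on `ℂ`. -/
def evalHbar (q : ℂ) : Coef →+* ℂ := (Polynomial.aeval (1 - q)).toRingHom

/-- The `q`-integer `[m] = (1 - q^m) / (1 - q)`. -/
def qInt (q : ℂ) (m : ℕ) : ℂ := (1 - q ^ m) / (1 - q)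

/-- `F_q(m; ħb) = 1 - q` and `F_q(m; gₖ) = q^{km} / [m]^k`. -/
def F (q : ℂ) (m : ℕ) : Letter → ℂ
  | Letter.hb => 1 - q
  | Letter.g k => q ^ ((k : ℕ) * m) / qInt q m ^ (k : ℕ)

/-- The sum `∑_{0<m₁<⋯<mᵣ<M} ∏ᵢ F_q(mᵢ; uᵢ)` for a word `u₁ ⋯ uᵣ` written from right to left,
as an iterated sum whose outermost variable is `mᵣ`. -/
def ZRev (q : ℂ) : List Letter → ℕ → ℂ
  | [], _ => 1
  | x :: u, M => ∑ m ∈ Finset.Ioo 0 M, ZRev q u m * F q m x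

/-- The truncated map `Z_{q,M} : 𝒞⟨A⟩ → ℂ`; `𝒞`-linear, where `ħ` acts on `ℂ` as `1 - q`. -/
def ZqM (q : ℂ) (M : ℕ) : CA →ₛₗ[evalHbar q] ℂ where
  toFun w := ((monBasis Letter).repr w).sum fun u c => evalHbar q c * ZRev q u.toList.reverse M
  map_add' x y := by
    rw [map_add, Finsupp.sum_add_index' (by simp) (by intros; rw [map_add, add_mul])]
  map_smul' c x := by
    rw [map_smul, Finsupp.sum_smul_index (by simp), smul_eq_mul, Finsupp.mul_sum]
    simp only [map_mul, mul_assoc]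

theorem ZqM_word (q : ℂ) (M : ℕ) (u : List Letter) :
    ZqM q M (word u) = ZRev q u.reverse M := by
  rw [show word u = monBasis Letter (FreeMonoid.ofList u) from
    (monBasis_apply (FreeMonoid.ofList u)).symm]
  simp only [ZqM, LinearMap.coe_mk, AddHom.coe_mk, Module.Basis.repr_self]
  rw [Finsupp.sum_single_index (by simp), map_one, one_mul]
  rfl

/-- `Z_q(w) = lim_{M → ∞} Z_{q,M}(w)`, used for `w ∈ Ĥ⁰`, where the limit exists
(`exists_tendsto_ZqM`). -/
def Zq (q : ℂ) (w : CA) : ℂ := limUnder atTop fun M => ZqM q M w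

/-- The `q`-analogue of truncated symmetric multiple zeta values of harmonic type,
`Z^{𝒮,∗}_{q,M} = Z_{q,M} ∘ w^{𝒮,∗}_ħ`. -/
def ZSStarM (q : ℂ) (M : ℕ) (w : CA) : ℂ := ZqM q M (wStar w)

/-- The `q`-analogue of truncated symmetric multiple zeta values of shuffle type,
`Z^{𝒮,sh}_{q,M} = Z_{q,M} ∘ w^{𝒮,sh}_ħ`. -/
def ZSShM (q : ℂ) (M : ℕ) (w : CA) : ℂ := ZqM q M (wSh w)

/-- `Z^{𝒮,∗}_q(w) = lim_{M → ∞} Z^{𝒮,∗}_{q,M}(w)`. -/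
def ZSStar (q : ℂ) (w : CA) : ℂ := limUnder atTop fun M => ZSStarM q M w

/-- `Z^{𝒮,sh}_q(w) = lim_{M → ∞} Z^{𝒮,sh}_{q,M}(w)`. -/
def ZSSh (q : ℂ) (w : CA) : ℂ := limUnder atTop fun M => ZSShM q M w

/-! ### Convergence on `Ĥ⁰` -/

theorem norm_F_hb (q : ℂ) (m : ℕ) : ‖F q m Letter.hb‖ ≤ ‖1 - q‖ := le_rfl

theorem norm_F_g {q : ℂ} (hq : ‖q‖ < 1) (k : ℕ+) {m : ℕ} (hm : 0 < m) :
    ‖F q m (Letter.g k)‖ ≤ (‖1 - q‖ / (1 - ‖q‖)) ^ (k : ℕ) * ‖q‖ ^ m := by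
  have h0 : 0 < 1 - ‖q‖ := by linarith
  have h1 : 1 - ‖q‖ ≤ ‖1 - q ^ m‖ := by
    have h2 : ‖q ^ m‖ ≤ ‖q‖ := by
      rw [norm_pow]; exact pow_le_of_le_one (norm_nonneg _) hq.le hm.ne'
    have h3 := norm_sub_norm_le (1 : ℂ) (q ^ m)
    rw [norm_one] at h3
    linarith
  have h2 : F q m (Letter.g k) = ((1 - q) / (1 - q ^ m)) ^ (k : ℕ) * (q ^ m) ^ (k : ℕ) := by
    rw [F, qInt, mul_comm (k : ℕ) m, pow_mul, ← div_pow, ← mul_pow, div_div_eq_mul_div]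
    ring
  rw [h2, norm_mul, norm_pow, norm_div, norm_pow, norm_pow]
  have h3 : (‖q‖ ^ m) ^ (k : ℕ) ≤ ‖q‖ ^ m :=
    pow_le_of_le_one (by positivity) (pow_le_one₀ (norm_nonneg _) hq.le) k.ne_zero
  gcongr

theorem norm_ZRev_le {q : ℂ} (hq : ‖q‖ < 1) (u : List Letter) :
    ∃ C : ℝ, 0 ≤ C ∧ ∀ M : ℕ, ‖ZRev q u M‖ ≤ C * (M : ℝ) ^ u.length := by
  have hF : ∀ x : Letter, ∃ B : ℝ, 0 ≤ B ∧ ∀ m : ℕ, 0 < m → ‖F q m x‖ ≤ B := by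
    intro x
    cases x with
    | hb => exact ⟨_, norm_nonneg _, fun m _ => norm_F_hb q m⟩
    | g k =>
      have h0 : 0 < 1 - ‖q‖ := by linarith
      refine ⟨(‖1 - q‖ / (1 - ‖q‖)) ^ (k : ℕ), by positivity, fun m hm => ?_⟩
      exact (norm_F_g hq k hm).trans (mul_le_of_le_one_right (by positivity)
        (pow_le_one₀ (norm_nonneg _) hq.le))
  induction u with
  | nil => exact ⟨1, zero_le_one, fun M => by simp [ZRev]⟩
  | cons x u ih =>
    obtain ⟨C, hC, h⟩ := ih
    obtain ⟨B, hB, hF⟩ := hF x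
    refine ⟨C * B, by positivity, fun M => ?_⟩
    rw [ZRev]
    calc ‖∑ m ∈ Finset.Ioo 0 M, ZRev q u m * F q m x‖
        ≤ ∑ m ∈ Finset.Ioo 0 M, C * (M : ℝ) ^ u.length * B := by
          refine norm_sum_le_of_le _ fun m hm => ?_
          rw [Finset.mem_Ioo] at hm
          rw [norm_mul]
          have h1 : (m : ℝ) ≤ M := by exact_mod_cast hm.2.le
          refine mul_le_mul ((h m).trans ?_) (hF m hm.1) (norm_nonneg _) (by positivity)
          gcongr
      _ ≤ M * (C * (M : ℝ) ^ u.length * B) := by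
          rw [Finset.sum_const, nsmul_eq_mul, Nat.card_Ioo]
          gcongr
          omega
      _ = C * B * (M : ℝ) ^ (x :: u).length := by
          rw [List.length_cons, pow_succ]; ring

theorem exists_tendsto_ZRev {q : ℂ} (hq : ‖q‖ < 1) (u : List Letter) (k : ℕ+) :
    ∃ z : ℂ, Tendsto (fun M => ZRev q (Letter.g k :: u) M) atTop (𝓝 z) := by
  obtain ⟨C, hC, h⟩ := norm_ZRev_le hq u
  obtain ⟨B, hB0, hB⟩ : ∃ B : ℝ, 0 ≤ B ∧
      ∀ m : ℕ, 0 < m → ‖F q m (Letter.g k)‖ ≤ B * ‖q‖ ^ m := by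
    have h0 : 0 < 1 - ‖q‖ := by linarith
    exact ⟨(‖1 - q‖ / (1 - ‖q‖)) ^ (k : ℕ), by positivity, fun m hm => norm_F_g hq k hm⟩
  let f : ℕ → ℂ := fun m => if 0 < m then ZRev q u m * F q m (Letter.g k) else 0
  have hs : Summable f := by
    have hn : ‖(‖q‖ : ℝ)‖ < 1 := by rwa [norm_norm]
    have h1 : Summable fun m : ℕ => C * B * ((m : ℝ) ^ u.length * ‖q‖ ^ m) :=
      (summable_pow_mul_geometric_of_norm_lt_one (R := ℝ) u.length hn).mul_left (C * B)
    refine Summable.of_norm_bounded h1 fun m => ?_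
    by_cases hm : 0 < m
    · simp only [f, hm, if_true, norm_mul]
      calc ‖ZRev q u m‖ * ‖F q m (Letter.g k)‖
          ≤ (C * (m : ℝ) ^ u.length) * (B * ‖q‖ ^ m) :=
            mul_le_mul (h m) (hB m hm) (norm_nonneg _) (by positivity)
        _ = _ := by ring
    · simp only [f, hm, if_false, norm_zero]
      positivity
  refine ⟨_, hs.hasSum.tendsto_sum_nat.congr fun M => ?_⟩
  rw [ZRev, ← Finset.sum_filter]
  congr 1
  ext m
  simp [and_comm]

/-- `Z_{q,M}(w)` converges as `M → ∞` for `w ∈ Ĥ⁰`. -/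
theorem exists_tendsto_ZqM {q : ℂ} (hq : ‖q‖ < 1) {w : CA} (hw : w ∈ hatH0) :
    ∃ z : ℂ, Tendsto (fun M => ZqM q M w) atTop (𝓝 z) := by
  let conv : Submodule Coef CA :=
    { carrier := {w | ∃ z : ℂ, Tendsto (fun M => ZqM q M w) atTop (𝓝 z)}
      zero_mem' := ⟨0, by simp⟩
      add_mem' := by
        rintro x y ⟨a, ha⟩ ⟨b, hb⟩
        exact ⟨a + b, by simpa only [map_add] using ha.add hb⟩
      smul_mem' := by
        rintro c x ⟨a, ha⟩
        exact ⟨evalHbar q c * a, by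
          simpa only [LinearMap.map_smulₛₗ, smul_eq_mul] using ha.const_mul _⟩ }
  suffices hatH0 ≤ conv from this hw
  refine sup_le ?_ (iSup_le fun k => ?_)
  · rw [Submodule.one_le]
    refine ⟨1, ?_⟩
    have : ∀ M, ZqM q M 1 = 1 := fun M => by
      rw [show (1 : CA) = word [] from rfl, ZqM_word]; simp [ZRev]
    simp [this]
  · rintro _ ⟨x, rfl⟩
    have hx : x ∈ Submodule.span Coef (Set.range (monBasis Letter)) := by
      rw [Module.Basis.span_eq]; trivial
    induction hx using Submodule.span_induction with
    | mem x hx =>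
      obtain ⟨u, rfl⟩ := hx
      obtain ⟨z, hz⟩ := exists_tendsto_ZRev hq u.toList.reverse k
      refine ⟨z, hz.congr fun M => ?_⟩
      rw [LinearMap.mulRight_apply, monBasis_apply, g, word_mul_letter, ZqM_word]
      simp
    | zero => simp
    | add x y _ _ hx hy => rw [map_add]; exact add_mem hx hy
    | smul c x _ hx => rw [map_smul]; exact Submodule.smul_mem _ _ hx

theorem tendsto_Zq {q : ℂ} (hq : ‖q‖ < 1) {w : CA} (hw : w ∈ hatH0) :
    Tendsto (fun M => ZqM q M w) atTop (𝓝 (Zq q w)) :=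
  tendsto_nhds_limUnder (exists_tendsto_ZqM hq hw)

theorem Zq_add {q : ℂ} (hq : ‖q‖ < 1) {x y : CA} (hx : x ∈ hatH0) (hy : y ∈ hatH0) :
    Zq q (x + y) = Zq q x + Zq q y := by
  refine Tendsto.limUnder_eq ?_
  simpa only [map_add] using (tendsto_Zq hq hx).add (tendsto_Zq hq hy)

theorem Zq_smul {q : ℂ} (hq : ‖q‖ < 1) (c : Coef) {x : CA} (hx : x ∈ hatH0) :
    Zq q (c • x) = evalHbar q c * Zq q x := by
  refine Tendsto.limUnder_eq ?_
  simpa only [LinearMap.map_smulₛₗ, smul_eq_mul] using (tendsto_Zq hq hx).const_mul _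

/-! ### The spaces of values -/

/-- The image `Z_q(S)` of a `𝒞`-submodule `S` of `Ĥ⁰`, as a `ℚ`-subspace of `ℂ`. -/
def imZq (q : ℂ) (hq : ‖q‖ < 1) (S : Submodule Coef CA) (hS : S ≤ hatH0) : Submodule ℚ ℂ where
  carrier := Zq q '' S
  zero_mem' := ⟨0, S.zero_mem, by
    have := Zq_smul hq 0 (zero_mem hatH0)
    rwa [zero_smul, map_zero, zero_mul] at this⟩
  add_mem' := by
    rintro _ _ ⟨x, hx, rfl⟩ ⟨y, hy, rfl⟩
    exact ⟨x + y, S.add_mem hx hy, Zq_add hq (hS hx) (hS hy)⟩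
  smul_mem' := by
    rintro c _ ⟨x, hx, rfl⟩
    refine ⟨Polynomial.C c • x, S.smul_mem _ hx, ?_⟩
    rw [Zq_smul hq _ (hS hx), Algebra.smul_def]
    simp [evalHbar]

/-- `𝒵_q = Z_q(ℌ⁰)`. -/
def ZqSpace (q : ℂ) (hq : ‖q‖ < 1) : Submodule ℚ ℂ := imZq q hq H0 H0_le

/-- `𝒩_q = Z_q(𝔫)`. -/
def Nq (q : ℂ) (hq : ‖q‖ < 1) : Submodule ℚ ℂ := imZq q hq nn nn_le

/-- `𝒫_q`, the ideal of `𝒵_q` generated by the values `Z_q(g_{2k})`, `k ≥ 1`: the finite sums of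
products of an element of `𝒵_q` and a generator. -/
def Pq (q : ℂ) (hq : ‖q‖ < 1) : Submodule ℚ ℂ :=
  ZqSpace q hq * Submodule.span ℚ (Set.range fun k : ℕ+ => Zq q (g (2 * k)))

end QSMZV
end

/-!
The truncated sums `Z_{q,M}` are multiplicative for the harmonic product (`ZqM_har`), and the limit
`Z_q` is multiplicative on `Ĥ⁰` for the shuffle product as well (`tendsto_ZqM_sh`). The latter is
seen on generating series: in `ℂ⟦t⟧`, let `b` be multiplication by `t / (1 - t)` and `a` the Jackson
integral `tⁿ ↦ qⁿ / [n] tⁿ`, a Rota–Baxter operator of weight `ħ = 1 - q`. Then the shuffle product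
becomes the product of power series, and `Z_{q,M}` is the sum of the first `M` coefficients.

The space `𝔫` is the intersection of `Ĥ⁰` with a two-sided monomial ideal, generated by `ħ` and by
the words with a letter `ħb` somewhere to the left of a letter `gₖ`, `k ≥ 2` (`mem_nn_iff`). This
ideal is stable under harmonic products, which gives the ring and ideal properties of `𝒵_q`, `𝒩_q`
and `𝒫_q`, and even makes `𝒩_q` an ideal of the larger ring `Z_q(Ĥ⁰)`.

For the comparison, cut a word at every position, with a prefix `p` and a suffix `s` held fixed
(`cut`). Cutting splits along the entries `k ≥ 2` of an index into one contribution for each maximal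
block of ones (`cut_mul_letter_mul`, `cut_mul_e_mul`). Put `f_n = g₁^{sh n} / n!`. The contribution
of a block of `m` ones is `∑ (-1)^l (p g₁^i) ∗ (s g₁^l)` on the harmonic side
(`cut_star_g_one_pow`), and `E_{1^m}` is such that it becomes `∑ (-1)^l (p f_i) sh (s f_l)` on the
shuffle side (`cut_sh_EOnes`), the sums being over `i + l = m`. So both limits exist, and they are
the coefficients of `X^m` in `R_p(X) R_s(-X)` and `F_p(X) F_s(-X)`, where
`R_y(X) = ∑ Z_q(y g₁ⁿ) Xⁿ` and `F_y(X) = ∑ Z_q(y f_n) Xⁿ`. On the harmonic side the words that end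
in `g₁` cancel, so the limit lies in `𝒵_q` (`sum_har_g_one_pow_mem_admH0`).

Modulo `𝔫`, the words `y f_n` are obtained from the words `y g₁ⁿ` by a harmonic product with a
series `γ` that does not depend on `y` (`mul_fS_sub_mem_nn`), so `F_y ≡ R_y Γ` modulo `𝒩_q` with
`Γ = Z_q(γ)`. It remains to see `Γ(X) Γ(-X) ≡ 1` modulo `𝒩_q + 𝒫_q` (`coeff_gam_mul_negX_mem`). For
`y = 1` one has `F₁(X) = exp(X Z_q(g₁))`, so `F₁(X) F₁(-X) = 1`, while by Newton's identity the
logarithmic derivative of `R₁(X) R₁(-X)` involves only the values `Z_q(g_{2k})`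
(`coeff_serStar_mul_negX_mem_Pq`).

Finally, the prefixes and suffixes that occur on the two sides differ by elements of the monomial
ideal (`Comparable`), and an induction over the blocks (`exists_tendsto_cut`) gives the result.
-/

open Finset.HasAntidiagonal

noncomputable section

namespace QSMZV

/-! ### The shuffle product on `𝒞⟨A⟩` -/

theorem shH_assoc_word (n : ℕ) : ∀ u v w : List AB, u.length + v.length + w.length = n →
    shH (shH (word u) (word v)) (word w) = shH (word u) (shH (word v) (word w)) := by
  induction n using Nat.strong_induction_on with
  | _ n ih =>
  intro u v w hn
  have h1 : (word [] : H) = 1 := rfl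
  have key : ∀ u' v' w' : List AB, u'.length + v'.length + w'.length < n →
    shH (shH (word u') (word v')) (word w') = shH (word u') (shH (word v') (word w')) :=
    fun u' v' w' h => ih _ h u' v' w' rfl
  rcases u.eq_nil_or_concat' with rfl | ⟨u, x, rfl⟩
  · rw [h1, shH_one_left, shH_one_left]
  rcases v.eq_nil_or_concat' with rfl | ⟨v, y, rfl⟩
  · rw [h1, shH_one_left, shH_one_right]
  rcases w.eq_nil_or_concat' with rfl | ⟨w, z, rfl⟩
  · rw [h1, shH_one_right, shH_one_right]
  simp only [List.length_append, List.length_cons, List.length_nil] at hn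
  cases x with
  | b =>
    rw [← word_mul_b, shH_b_left, shH_b_left, shH_b_left,
      key _ _ _ (by simp only [List.length_append, List.length_cons, List.length_nil]; omega)]
  | a =>
  cases y with
  | b =>
    rw [← word_mul_b, shH_b_left, shH_b_right, shH_b_left, shH_b_right,
      key _ _ _ (by simp only [List.length_append, List.length_cons, List.length_nil]; omega)]
  | a =>
  cases z with
  | b =>
    rw [← word_mul_b, shH_b_right, shH_b_right, shH_b_right,
      key _ _ _ (by simp only [List.length_append, List.length_cons, List.length_nil]; omega)]
  | a =>
    have k1 := key u (v ++ [AB.a]) (w ++ [AB.a]) (by simp; omega)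
    have k2 := key (u ++ [AB.a]) v (w ++ [AB.a]) (by simp; omega)
    have k3 := key (u ++ [AB.a]) (v ++ [AB.a]) w (by simp; omega)
    have k4 := key u v (w ++ [AB.a]) (by simp; omega)
    have k5 := key u (v ++ [AB.a]) w (by simp; omega)
    have k6 := key (u ++ [AB.a]) v w (by simp; omega)
    have k7 := key u v w (by omega)
    simp only [← word_mul_a, shH_a_a, map_add, LinearMap.add_apply, map_smul,
      LinearMap.smul_apply, smul_add] at k1 k2 k3 k4 k5 k6 k7 ⊢
    rw [k3, ← k1, k2, k4, k5, k6, k7]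
    congr 1
    abel

theorem shH_assoc (x y z : H) : shH (shH x y) z = shH x (shH y z) := by
  have h1 : ∀ u v : List AB, shH (shH (word u) (word v)) = (shH (word u)).comp (shH (word v)) :=
    fun u v => word_ext fun w => shH_assoc_word _ u v w rfl
  have h2 := word_ext2 (f := shH.compr₂ shH)
    (f' := (LinearMap.llcomp Coef H H H).compl₁₂ shH shH) h1 x y
  exact congrArg (fun f => f z) h2

/-- The shuffle product on `𝒞⟨A⟩` as a bilinear map. -/
def shL : CA →ₗ[Coef] CA →ₗ[Coef] CA :=
  LinearMap.mk₂ Coef sh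
    (fun x x' y => embed_injective (by simp [embed_sh]))
    (fun c x y => embed_injective (by simp [embed_sh]))
    (fun x y y' => embed_injective (by simp [embed_sh]))
    (fun c x y => embed_injective (by simp [embed_sh]))

theorem shL_apply (x y : CA) : shL x y = sh x y := rfl

theorem sh_one_left (x : CA) : sh 1 x = x :=
  embed_injective (by rw [embed_sh, map_one, shH_one_left])

theorem sh_one_right (x : CA) : sh x 1 = x :=
  embed_injective (by rw [embed_sh, map_one, shH_one_right])

theorem sh_mul_hb_left (x y : CA) : sh (x * hb) y = sh x y * hb :=
  embed_injective (by
    rw [embed_sh, map_mul embed, map_mul embed, embed_sh, embed_hb, mul_smul_comm,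
      mul_smul_comm, map_smul, LinearMap.smul_apply, shH_b_left])

theorem sh_mul_hb_right (x y : CA) : sh x (y * hb) = sh x y * hb :=
  embed_injective (by
    rw [embed_sh, map_mul embed, map_mul embed, embed_sh, embed_hb, mul_smul_comm,
      mul_smul_comm, map_smul, shH_b_right])

theorem sh_mul_hb_pow_left (x y : CA) (n : ℕ) : sh (x * hb ^ n) y = sh x y * hb ^ n := by
  induction n with
  | zero => simp
  | succ n ih => rw [pow_succ, ← mul_assoc, sh_mul_hb_left, ih, mul_assoc]

theorem sh_mul_hb_pow_right (x y : CA) (n : ℕ) : sh x (y * hb ^ n) = sh x y * hb ^ n := by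
  induction n with
  | zero => simp
  | succ n ih => rw [pow_succ, ← mul_assoc, sh_mul_hb_right, ih, mul_assoc]

theorem sh_hb_left (y : CA) : sh hb y = y * hb := by
  rw [← one_mul hb, sh_mul_hb_left, sh_one_left, one_mul]

theorem sh_assoc (x y z : CA) : sh (sh x y) z = sh x (sh y z) :=
  embed_injective (by simp only [embed_sh, shH_assoc])

/-- Shuffling with `g₁` a word that ends in `g₁`. -/
theorem sh_g_one_mul_g_one (y : CA) :
    sh (g 1) (y * g 1) = sh (g 1) y * g 1 + y * g 1 * g 1 + y * hb * g 1 := by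
  apply embed_injective
  have h1 : embed (g 1) = bH * aH := by simp [embed_g]
  have h2 : shH (bH * aH) (embed y * bH * aH) = (shH (bH * aH) (embed y) * bH
      + embed y * bH * aH * bH + hbar • (embed y * bH * bH)) * aH := by
    have h3 : ∀ w : H, shH bH w = w * bH := fun w => by
      rw [← one_mul bH, shH_b_left, shH_one_left, one_mul]
    rw [shH_a_a, shH_b_right, h3, h3]
  simp only [embed_sh, map_add, map_mul, h1, embed_hb, ← mul_assoc]
  rw [h2]
  simp only [add_mul, mul_assoc, smul_mul_assoc, mul_smul_comm]

/-! ### Generating series of values and the shuffle product -/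

/-- The number `λₙ = (1 - q) qⁿ / (1 - qⁿ) = qⁿ / [n]`; it is `0` for `n = 0`. -/
def lam (q : ℂ) (n : ℕ) : ℂ := (1 - q) * q ^ n / (1 - q ^ n)

/-- The Jackson integral `tⁿ ↦ λₙ tⁿ` on power series in `t`: on series without constant term it
is a Rota–Baxter operator of weight `1 - q`. -/
def jackson (q : ℂ) : PowerSeries ℂ →ₗ[ℂ] PowerSeries ℂ where
  toFun f := PowerSeries.mk fun n => lam q n * PowerSeries.coeff n f
  map_add' f f' := by ext n; simp [mul_add]
  map_smul' c f := by ext n; simp; ring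

/-- The power series `t / (1 - t)`. -/
def geo : PowerSeries ℂ := PowerSeries.mk fun n => if n = 0 then 0 else 1

theorem coeff_jackson (q : ℂ) (f : PowerSeries ℂ) (n : ℕ) :
    PowerSeries.coeff n (jackson q f) = lam q n * PowerSeries.coeff n f := by
  simp [jackson]

theorem coeff_jackson_iterate (q : ℂ) (f : PowerSeries ℂ) (k n : ℕ) :
    PowerSeries.coeff n ((jackson q)^[k] f) = lam q n ^ k * PowerSeries.coeff n f := by
  induction k with
  | zero => simp
  | succ k ih => rw [Function.iterate_succ_apply', coeff_jackson, ih, pow_succ]; ring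

theorem coeff_mul_geo (f : PowerSeries ℂ) (n : ℕ) :
    PowerSeries.coeff n (f * geo) = ∑ m ∈ Finset.range n, PowerSeries.coeff m f := by
  rw [PowerSeries.coeff_mul, Finset.Nat.sum_antidiagonal_eq_sum_range_succ
    (fun i j => PowerSeries.coeff i f * PowerSeries.coeff j geo), Finset.sum_range_succ]
  simp only [geo, PowerSeries.coeff_mk, Nat.sub_self, if_true, mul_zero, add_zero]
  refine Finset.sum_congr rfl fun m hm => ?_
  rw [Finset.mem_range] at hm
  rw [if_neg (by omega), mul_one]

theorem one_sub_pow_ne_zero {q : ℂ} (hq : ‖q‖ < 1) {n : ℕ} (hn : n ≠ 0) : 1 - q ^ n ≠ 0 := by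
  intro h
  have h1 : ‖q ^ n‖ < 1 := by rw [norm_pow]; exact pow_lt_one₀ (norm_nonneg _) hq hn
  rw [← sub_eq_zero.1 h, norm_one] at h1
  exact lt_irrefl _ h1

/-- The identity behind the Rota–Baxter property of the Jackson integral. -/
theorem lam_mul_lam {q : ℂ} (hq : ‖q‖ < 1) {i j : ℕ} (hi : i ≠ 0) (hj : j ≠ 0) :
    lam q i * lam q j = lam q (i + j) * (lam q i + lam q j + (1 - q)) := by
  have h1 := one_sub_pow_ne_zero hq hi
  have h2 := one_sub_pow_ne_zero hq hj
  have h3 := one_sub_pow_ne_zero hq (show i + j ≠ 0 by omega)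
  rw [pow_add] at h3
  rw [lam, lam, lam, pow_add]
  generalize q ^ i = a at *
  generalize q ^ j = b at *
  field_simp
  ring

/-- The Rota–Baxter identity; it has the shape of the shuffle rule `shH_a_a`. -/
theorem jackson_mul_jackson {q : ℂ} (hq : ‖q‖ < 1) {f f' : PowerSeries ℂ}
    (hf : PowerSeries.coeff 0 f = 0) (hf' : PowerSeries.coeff 0 f' = 0) :
    jackson q f * jackson q f'
      = jackson q (jackson q f * f' + f * jackson q f' + (1 - q) • (f * f')) := by
  ext n
  rw [coeff_jackson]
  simp only [map_add, PowerSeries.coeff_smul, PowerSeries.coeff_mul, coeff_jackson, smul_eq_mul,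
    Finset.mul_sum, ← Finset.sum_add_distrib]
  refine Finset.sum_congr rfl fun ⟨i, j⟩ hij => ?_
  rw [Finset.HasAntidiagonal.mem_antidiagonal] at hij
  simp only at hij ⊢
  subst hij
  rcases Nat.eq_zero_or_pos i with rfl | hi
  · rw [hf]; ring
  rcases Nat.eq_zero_or_pos j with rfl | hj
  · rw [hf']; ring
  rw [show lam q i * PowerSeries.coeff i f * (lam q j * PowerSeries.coeff j f')
    = (lam q i * lam q j) * (PowerSeries.coeff i f * PowerSeries.coeff j f') by ring,
    lam_mul_lam hq hi.ne' hj.ne']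
  ring

/-- The generating series of a word in `a`, `b`, written from right to left: `b` multiplies by
`t / (1 - t)` and `a` applies the Jackson integral. -/
def genRev (q : ℂ) : List AB → PowerSeries ℂ
  | [] => 1
  | AB.b :: u => genRev q u * geo
  | AB.a :: u => jackson q (genRev q u)

/-- The linear extension of `genRev` to `ℌ`. For `w` in `𝒞⟨A⟩` the coefficient of `tᵐ` in
`gen q (embed w)` is the part of the infinite sum `Z_q(w)` with largest summation index `m`. -/
def gen (q : ℂ) : H →ₛₗ[evalHbar q] PowerSeries ℂ where
  toFun w := ((monBasis AB).repr w).sum fun u c => evalHbar q c • genRev q u.toList.reverse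
  map_add' x y := by
    rw [map_add, Finsupp.sum_add_index' (by simp) (by intros; rw [map_add, add_smul])]
  map_smul' c x := by
    rw [map_smul, Finsupp.sum_smul_index (by simp), Finsupp.smul_sum]
    simp only [map_mul, mul_smul]

theorem gen_word (q : ℂ) (u : List AB) : gen q (word u) = genRev q u.reverse := by
  rw [show word u = monBasis AB (FreeMonoid.ofList u) from
    (monBasis_apply (FreeMonoid.ofList u)).symm]
  simp only [gen, LinearMap.coe_mk, AddHom.coe_mk, Module.Basis.repr_self]
  rw [Finsupp.sum_single_index (by simp), map_one, one_smul]
  rfl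

/-- Two semilinear maps that agree on words are equal. -/
theorem word_ext_semilinear {X M : Type} {q : ℂ} [AddCommGroup M] [Module ℂ M]
    {f f' : FreeAlgebra Coef X →ₛₗ[evalHbar q] M} (h : ∀ u : List X, f (word u) = f' (word u)) :
    f = f' :=
  (monBasis X).ext fun u => by rw [monBasis_apply]; exact h _

theorem gen_mul_a (q : ℂ) (x : H) : gen q (x * aH) = jackson q (gen q x) := by
  have : (gen q).comp (LinearMap.mulRight Coef aH) = (jackson q).comp (gen q) :=
    word_ext_semilinear fun u => by simp [word_mul_a, gen_word, genRev]
  exact congrArg (fun f => f x) this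

theorem gen_mul_b (q : ℂ) (x : H) : gen q (x * bH) = gen q x * geo := by
  have : (gen q).comp (LinearMap.mulRight Coef bH) = (LinearMap.mulRight ℂ geo).comp (gen q) :=
    word_ext_semilinear fun u => by simp [word_mul_b, gen_word, genRev]
  exact congrArg (fun f => f x) this

theorem coeff_zero_genRev (q : ℂ) {u : List AB} (hu : u ≠ []) :
    PowerSeries.coeff 0 (genRev q u) = 0 := by
  cases u with
  | nil => exact absurd rfl hu
  | cons x u =>
    cases x
    · rw [genRev, coeff_jackson, lam]; simp
    · rw [genRev, coeff_mul_geo]; simp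

theorem evalHbar_hbar (q : ℂ) : evalHbar q hbar = 1 - q := by simp [evalHbar]

/-- The words are reversed and must start with `b`, so that the Rota–Baxter identity applies:
it fails for series with a constant term. -/
theorem gen_shRev {q : ℂ} (hq : ‖q‖ < 1) (u v : List AB) :
    u.getLast? ≠ some AB.a → v.getLast? ≠ some AB.a →
    gen q (shRev u v) = genRev q u * genRev q v := by
  induction u, v using shRev.induct with
  | case1 v => intro _ _; simp [shRev, gen_word, genRev]
  | case2 u v ih =>
    intro hu hv
    have hu' : u.getLast? ≠ some AB.a := by
      cases u with
      | nil => simp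
      | cons x u => simpa [List.getLast?_cons_cons] using hu
    rw [shRev, gen_mul_b, ih hu' hv, genRev]; ring
  | case3 u => intro _ _; rw [shRev, gen_word]; simp [genRev]
  | case4 u v ih =>
    intro hu hv
    have hv' : v.getLast? ≠ some AB.a := by
      cases v with
      | nil => simp
      | cons x u => simpa [List.getLast?_cons_cons] using hv
    rw [shRev, gen_mul_b, ih hu hv']
    simp only [genRev]; ring
  | case5 u v ih1 ih2 ih3 =>
    intro hu hv
    have hu0 : u ≠ [] := by rintro rfl; simp at hu
    have hv0 : v ≠ [] := by rintro rfl; simp at hv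
    have hu' : u.getLast? ≠ some AB.a := by
      cases u with
      | nil => simp
      | cons x u => simpa [List.getLast?_cons_cons] using hu
    have hv' : v.getLast? ≠ some AB.a := by
      cases v with
      | nil => simp
      | cons x u => simpa [List.getLast?_cons_cons] using hv
    rw [shRev, gen_mul_a, map_add (gen q), map_add (gen q), LinearMap.map_smulₛₗ,
      ih1 hu hv', ih2 hu' hv, ih3 hu' hv', evalHbar_hbar]
    simp only [genRev]
    rw [jackson_mul_jackson hq (coeff_zero_genRev q hu0) (coeff_zero_genRev q hv0)]

theorem getLast?_reverse_flatMap (u : List Letter) :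
    (u.flatMap flatLetter).reverse.getLast? ≠ some AB.a := by
  rw [List.getLast?_reverse]
  cases u with
  | nil => simp
  | cons x u => cases x <;> simp [flatLetter]

/-- The generating series turn the shuffle product on `𝒞⟨A⟩` into the product of power series. -/
theorem gen_embed_sh {q : ℂ} (hq : ‖q‖ < 1) (x y : CA) :
    gen q (embed (sh x y)) = gen q (embed x) * gen q (embed y) := by
  have h1 : ∀ u v : List Letter, gen q (embed (sh (word u) (word v)))
      = gen q (embed (word u)) * gen q (embed (word v)) := by
    intro u v
    rw [embed_sh, embed_word, embed_word]
    simp only [map_smul, LinearMap.smul_apply, LinearMap.map_smulₛₗ, shH_word,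
      gen_shRev hq _ _ (getLast?_reverse_flatMap u) (getLast?_reverse_flatMap v), gen_word]
    rw [smul_mul_smul_comm, smul_smul, mul_comm]
  have h2 : ∀ (u : List Letter) (y : CA), gen q (embed (sh (word u) y))
      = gen q (embed (word u)) * gen q (embed y) := fun u y =>
    congrArg (fun f => f y) (word_ext_semilinear
      (f := ((gen q).comp embed.toLinearMap).comp (shL (word u)))
      (f' := (LinearMap.mulLeft ℂ (gen q (embed (word u)))).comp ((gen q).comp embed.toLinearMap))
      (fun v => h1 u v))
  exact congrArg (fun f => f x) (word_ext_semilinear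
      (f := ((gen q).comp embed.toLinearMap).comp (shL.flip y))
      (f' := (LinearMap.mulRight ℂ (gen q (embed y))).comp ((gen q).comp embed.toLinearMap))
      (fun v => h2 v y))

/-- The coefficients of the generating series of a word whose last letter is `x`, and the partial
sums of the coefficients. -/
theorem coeff_gen_word (q : ℂ) (u : List Letter) :
    (∀ (x : Letter) (m : ℕ),
      PowerSeries.coeff m (gen q (embed (word u.reverse * FreeAlgebra.ι Coef x))) =
        if m = 0 then 0 else ZRev q u m * F q m x) ∧
    ∀ M : ℕ, M ≠ 0 → ∑ m ∈ Finset.range M, PowerSeries.coeff m (gen q (embed (word u.reverse)))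
      = ZRev q u M := by
  have hsum : ∀ (f : ℕ → ℂ) (M : ℕ), M ≠ 0 → ∑ m ∈ Finset.range M, (if m = 0 then 0 else f m)
      = ∑ m ∈ Finset.Ioo 0 M, f m := by
    intro f M hM
    rw [Finset.sum_ite, Finset.sum_const_zero, zero_add]
    congr 1
    ext m
    simp only [Finset.mem_filter, Finset.mem_range, Finset.mem_Ioo]
    omega
  have hstep : ∀ u : List Letter, (∀ M : ℕ, M ≠ 0 →
      ∑ m ∈ Finset.range M, PowerSeries.coeff m (gen q (embed (word u.reverse))) = ZRev q u M) →
      ∀ (x : Letter) (m : ℕ),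
        PowerSeries.coeff m (gen q (embed (word u.reverse * FreeAlgebra.ι Coef x)))
        = if m = 0 then 0 else ZRev q u m * F q m x := by
    intro u hu x m
    have hz : PowerSeries.coeff 0 (gen q (embed (word u.reverse)) * geo) = 0 := by
      rw [coeff_mul_geo]; simp
    cases x with
    | hb =>
      rw [map_mul embed, show embed (FreeAlgebra.ι Coef Letter.hb) = hbar • bH from embed_hb,
        mul_smul_comm, LinearMap.map_smulₛₗ, gen_mul_b, evalHbar_hbar, PowerSeries.coeff_smul]
      split_ifs with hm
      · subst hm; rw [hz, smul_zero]
      · rw [coeff_mul_geo, hu m hm, F, smul_eq_mul, mul_comm]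
    | g k =>
      have hpow : ∀ (n : ℕ) (y : H), gen q (y * aH ^ n) = (jackson q)^[n] (gen q y) := by
        intro n
        induction n with
        | zero => simp
        | succ n ih => intro y; rw [pow_succ', ← mul_assoc, ih, gen_mul_a]; rfl
      rw [map_mul embed, show embed (FreeAlgebra.ι Coef (Letter.g k)) = bH * aH ^ (k : ℕ) from
        embed_g k, ← mul_assoc, hpow, gen_mul_b, coeff_jackson_iterate]
      split_ifs with hm
      · subst hm; rw [hz, mul_zero]
      · rw [coeff_mul_geo, hu m hm, F, mul_comm, qInt, mul_comm (k : ℕ) m, pow_mul, ← div_pow,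
          lam, div_div_eq_mul_div, mul_comm (1 - q)]
  have hpart : ∀ u : List Letter, ∀ M : ℕ, M ≠ 0 →
      ∑ m ∈ Finset.range M, PowerSeries.coeff m (gen q (embed (word u.reverse))) = ZRev q u M := by
    intro u
    induction u with
    | nil =>
      intro M hM
      rw [show embed (word ([] : List Letter).reverse) = word [] by simp [word], gen_word]
      simp only [List.reverse_nil, genRev, PowerSeries.coeff_one, ZRev]
      rw [Finset.sum_ite_eq' ]
      simp [Nat.pos_of_ne_zero hM]
    | cons x u ih =>
      intro M hM
      rw [List.reverse_cons, ← word_mul_letter]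
      simp only [hstep u ih]
      rw [hsum _ _ hM, ZRev]
  exact ⟨hstep u (hpart u), hpart u⟩

/-- `Z_{q,M}(w)` is a partial sum of the coefficients of the generating series of `w`. -/
theorem sum_coeff_gen (q : ℂ) (w : CA) {M : ℕ} (hM : M ≠ 0) :
    ∑ m ∈ Finset.range M, PowerSeries.coeff m (gen q (embed w)) = ZqM q M w := by
  have h := word_ext_semilinear
      (f := ((∑ m ∈ Finset.range M, PowerSeries.coeff (R := ℂ) m).comp
        ((gen q).comp embed.toLinearMap)))
      (f' := ZqM q M) (fun u => by
        have := (coeff_gen_word q u.reverse).2 M hM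
        rw [List.reverse_reverse] at this
        rw [ZqM_word, ← this]
        simp)
  have h2 := congrArg (fun f => f w) h
  simpa [LinearMap.sum_apply] using h2

theorem summable_coeff_gen {q : ℂ} (hq : ‖q‖ < 1) {w : CA} (hw : w ∈ hatH0) :
    Summable fun m => ‖PowerSeries.coeff m (gen q (embed w))‖ := by
  let conv : Submodule Coef CA :=
    { carrier := {w | Summable fun m => ‖PowerSeries.coeff m (gen q (embed w))‖}
      zero_mem' := by simp [summable_zero]
      add_mem' := by
        intro x y hx hy
        refine Summable.of_nonneg_of_le (fun _ => norm_nonneg _) (fun m => ?_) (hx.add hy)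
        rw [map_add, map_add, map_add]
        exact norm_add_le _ _
      smul_mem' := by
        intro c x hx
        refine (hx.mul_left ‖evalHbar q c‖).congr fun m => ?_
        rw [map_smul, LinearMap.map_smulₛₗ, PowerSeries.coeff_smul, norm_smul] }
  suffices hatH0 ≤ conv from this hw
  refine sup_le ?_ (iSup_le fun k => ?_)
  · rw [Submodule.one_le]
    refine summable_of_hasFiniteSupport ((Set.finite_singleton 0).subset fun m hm => ?_)
    by_contra h
    refine hm ?_
    rw [show embed (1 : CA) = word [] by simp [word], gen_word]
    simpa [genRev, PowerSeries.coeff_one] using h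
  · rintro _ ⟨x, rfl⟩
    have hx : x ∈ Submodule.span Coef (Set.range (monBasis Letter)) := by
      rw [Module.Basis.span_eq]; trivial
    induction hx using Submodule.span_induction with
    | mem x hx =>
      obtain ⟨u, rfl⟩ := hx
      obtain ⟨C, hC, h⟩ := norm_ZRev_le hq u.toList.reverse
      have h0 : 0 < 1 - ‖q‖ := by linarith
      have hn : ‖(‖q‖ : ℝ)‖ < 1 := by rwa [norm_norm]
      have h1 : Summable fun m : ℕ => C * (‖1 - q‖ / (1 - ‖q‖)) ^ (k : ℕ) *
          ((m : ℝ) ^ u.toList.reverse.length * ‖q‖ ^ m) :=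
        (summable_pow_mul_geometric_of_norm_lt_one (R := ℝ) _ hn).mul_left _
      refine Summable.of_nonneg_of_le (fun _ => norm_nonneg _) (fun m => ?_) h1
      have h2 := (coeff_gen_word q u.toList.reverse).1 (Letter.g k) m
      rw [List.reverse_reverse] at h2
      rw [LinearMap.mulRight_apply, monBasis_apply, g, h2]
      split_ifs with hm
      · rw [norm_zero]; positivity
      · rw [norm_mul]
        calc _ ≤ (C * (m : ℝ) ^ u.toList.reverse.length)
                * ((‖1 - q‖ / (1 - ‖q‖)) ^ (k : ℕ) * ‖q‖ ^ m) :=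
              mul_le_mul (h m) (norm_F_g hq k (Nat.pos_of_ne_zero hm)) (norm_nonneg _)
                (by positivity)
          _ = _ := by ring
    | zero => simp
    | add x y _ _ hx hy => rw [map_add]; exact add_mem hx hy
    | smul c x _ hx => rw [map_smul]; exact Submodule.smul_mem _ _ hx

/-- `Z_q` turns the shuffle product on `Ĥ⁰` into the product of complex numbers. -/
theorem tendsto_ZqM_sh {q : ℂ} (hq : ‖q‖ < 1) {x y : CA} (hx : x ∈ hatH0) (hy : y ∈ hatH0) :
    Tendsto (fun M => ZqM q M (sh x y)) atTop (𝓝 (Zq q x * Zq q y)) := by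
  have hval : ∀ {w : CA}, w ∈ hatH0 →
      HasSum (fun m => PowerSeries.coeff m (gen q (embed w))) (Zq q w) := by
    intro w hw
    have h1 := (summable_coeff_gen hq hw).of_norm.hasSum
    refine (tendsto_nhds_unique (h1.tendsto_sum_nat.congr' ?_) (tendsto_Zq hq hw)) ▸ h1
    filter_upwards [eventually_ne_atTop 0] with M hM using sum_coeff_gen q w hM
  have h2 := (summable_norm_sum_mul_antidiagonal_of_summable_norm (summable_coeff_gen hq hx)
    (summable_coeff_gen hq hy)).of_norm.hasSum
  rw [← tsum_mul_tsum_eq_tsum_sum_antidiagonal_of_summable_norm (summable_coeff_gen hq hx)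
    (summable_coeff_gen hq hy), (hval hx).tsum_eq, (hval hy).tsum_eq] at h2
  refine h2.tendsto_sum_nat.congr' ?_
  filter_upwards [eventually_ne_atTop 0] with M hM
  rw [← sum_coeff_gen q _ hM]
  simp only [gen_embed_sh hq, PowerSeries.coeff_mul]

/-! ### Monomial ideals of `𝒞⟨A⟩` -/

/-- A linear map sends everything into a submodule as soon as it does so with words. -/
theorem map_mem_of_word {X M : Type} [AddCommMonoid M] [Module Coef M] {S : Submodule Coef M}
    (f : FreeAlgebra Coef X →ₗ[Coef] M) (h : ∀ u, f (word u) ∈ S) (x : FreeAlgebra Coef X) :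
    f x ∈ S := by
  have hx : x ∈ Submodule.span Coef (Set.range (monBasis X)) := by
    rw [Module.Basis.span_eq]; trivial
  refine (Submodule.span_le (p := S.comap f)).2 ?_ hx
  rintro _ ⟨u, rfl⟩
  rw [monBasis_apply]
  exact h _

/-- The submodule spanned by the words with the property `P` and by the multiples of `ħ`. -/
def monIdeal (P : List Letter → Prop) : Submodule Coef CA :=
  Submodule.span Coef {x | ∃ u, P u ∧ x = word u} ⊔ LinearMap.range (LinearMap.lsmul Coef CA hbar)

theorem word_mem_monIdeal {P : List Letter → Prop} {u : List Letter} (h : P u) :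
    word u ∈ monIdeal P :=
  (le_sup_left : _ ≤ monIdeal P) (Submodule.subset_span ⟨u, h, rfl⟩)

theorem hbar_smul_mem_monIdeal {P : List Letter → Prop} (x : CA) : hbar • x ∈ monIdeal P :=
  (le_sup_right : _ ≤ monIdeal P) ⟨x, rfl⟩

theorem map_mem_of_mem_monIdeal {P : List Letter → Prop} {S : Submodule Coef CA}
    (f : CA →ₗ[Coef] CA) (h1 : ∀ u, P u → f (word u) ∈ S) (h2 : ∀ x, hbar • f x ∈ S) {x : CA}
    (hx : x ∈ monIdeal P) : f x ∈ S := by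
  refine (sup_le ?_ ?_ : monIdeal P ≤ S.comap f) hx
  · rw [Submodule.span_le]
    rintro _ ⟨u, hu, rfl⟩
    exact h1 u hu
  · rintro _ ⟨y, rfl⟩
    simpa using h2 y

theorem monIdeal_mul_right {P : List Letter → Prop} (hP : ∀ u v, P u → P (u ++ v)) {x : CA}
    (hx : x ∈ monIdeal P) (y : CA) : x * y ∈ monIdeal P :=
  map_mem_of_mem_monIdeal (LinearMap.mulRight Coef y) (fun u hu =>
    map_mem_of_word (LinearMap.mulLeft Coef (word u)) (fun v => by
      rw [LinearMap.mulLeft_apply, ← word_append]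
      exact word_mem_monIdeal (hP u v hu)) y)
    (fun _ => hbar_smul_mem_monIdeal _) hx

theorem monIdeal_mul_left {P : List Letter → Prop} (hP : ∀ u v, P v → P (u ++ v)) (x : CA) {y : CA}
    (hy : y ∈ monIdeal P) : x * y ∈ monIdeal P :=
  map_mem_of_mem_monIdeal (LinearMap.mulLeft Coef x) (fun v hv =>
    map_mem_of_word (LinearMap.mulRight Coef (word v)) (fun u => by
      rw [LinearMap.mulRight_apply, ← word_append]
      exact word_mem_monIdeal (hP u v hv)) x)
    (fun _ => hbar_smul_mem_monIdeal _) hy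

theorem hbar_dvd_repr_of_mem_monIdeal {P : List Letter → Prop} {x : CA} (hx : x ∈ monIdeal P)
    {u : List Letter} (hu : ¬ P u) : hbar ∣ (monBasis Letter).repr x (FreeMonoid.ofList u) := by
  let f : CA →ₗ[Coef] Coef :=
    (Finsupp.lapply (FreeMonoid.ofList u)).comp (monBasis Letter).repr.toLinearMap
  have h : monIdeal P ≤ Submodule.comap f (Ideal.span {hbar}) := by
    refine sup_le ?_ ?_
    · rw [Submodule.span_le]
      rintro _ ⟨v, hv, rfl⟩
      rw [show word v = monBasis Letter (FreeMonoid.ofList v) from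
        (monBasis_apply (FreeMonoid.ofList v)).symm]
      have hne : FreeMonoid.ofList u ≠ FreeMonoid.ofList v := fun h =>
        hu (FreeMonoid.ofList.injective h ▸ hv)
      simp [f, Finsupp.single_eq_of_ne hne]
    · rintro _ ⟨y, rfl⟩
      simp [f, Ideal.mem_span_singleton]
  exact Ideal.mem_span_singleton.1 (h hx)

/-- The property of a word to contain the letter `ħb`. -/
def HasHb (u : List Letter) : Prop := Letter.hb ∈ u

/-- The property of a word to contain the letter `ħb` and, to the right of it, a letter `gₖ` with
`k ≥ 2`. -/
def HasHbG (u : List Letter) : Prop :=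
  ∃ (u₁ u₂ : List Letter) (k : ℕ+), 2 ≤ k ∧ Letter.hb ∈ u₁ ∧ u = u₁ ++ Letter.g k :: u₂

/-- The two-sided ideal `(ħ, ħb)`. -/
abbrev hbIdeal : Submodule Coef CA := monIdeal HasHb

/-- The two-sided ideal generated by `ħ` and the words containing `ħb` to the left of some `gₖ`,
`k ≥ 2`. Its intersection with `Ĥ⁰` is `𝔫`. -/
abbrev hbgIdeal : Submodule Coef CA := monIdeal HasHbG

theorem hbIdeal_mul_right {x : CA} (hx : x ∈ hbIdeal) (y : CA) : x * y ∈ hbIdeal :=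
  monIdeal_mul_right (fun u v (h : _ ∈ u) => (List.mem_append_left v h : _ ∈ u ++ v)) hx y

theorem hbIdeal_mul_left (x : CA) {y : CA} (hy : y ∈ hbIdeal) : x * y ∈ hbIdeal :=
  monIdeal_mul_left (fun u v (h : _ ∈ v) => (List.mem_append_right u h : _ ∈ u ++ v)) x hy

theorem hbgIdeal_mul_right {x : CA} (hx : x ∈ hbgIdeal) (y : CA) : x * y ∈ hbgIdeal :=
  monIdeal_mul_right (by
    rintro u v ⟨u₁, u₂, k, hk, h, rfl⟩
    exact ⟨u₁, u₂ ++ v, k, hk, h, by simp⟩) hx y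

theorem hbgIdeal_mul_left (x : CA) {y : CA} (hy : y ∈ hbgIdeal) : x * y ∈ hbgIdeal :=
  monIdeal_mul_left (by
    rintro u v ⟨u₁, u₂, k, hk, h, rfl⟩
    exact ⟨u ++ u₁, u₂, k, hk, List.mem_append_right u h, by simp⟩) x hy

theorem hbIdeal_mul_g {x : CA} (hx : x ∈ hbIdeal) {k : ℕ+} (hk : 2 ≤ k) :
    x * g k ∈ hbgIdeal :=
  map_mem_of_mem_monIdeal (LinearMap.mulRight Coef (g k)) (fun u hu => by
      rw [LinearMap.mulRight_apply, g, word_mul_letter]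
      exact word_mem_monIdeal ⟨u, [], k, hk, hu, rfl⟩)
    (fun _ => hbar_smul_mem_monIdeal _) hx

theorem hb_mem_hbIdeal : hb ∈ hbIdeal := by
  have : hb = word [Letter.hb] := by simp [word, hb]
  rw [this]
  exact word_mem_monIdeal (by simp [HasHb])

/-! ### `𝔫` as an intersection -/

theorem one_mem_hatH0 : (1 : CA) ∈ hatH0 :=
  (le_sup_left : _ ≤ hatH0) (Submodule.one_le.1 le_rfl)

theorem map_mem_of_mem_hatH0 {M : Type} [AddCommMonoid M] [Module Coef M] {S : Submodule Coef M}
    (f : CA →ₗ[Coef] M) (h1 : f 1 ∈ S) (h2 : ∀ x k, f (x * g k) ∈ S) {x : CA}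
    (hx : x ∈ hatH0) : f x ∈ S := by
  refine (sup_le ?_ (iSup_le fun k => ?_) : hatH0 ≤ S.comap f) hx
  · rw [Submodule.one_le]; exact h1
  · rintro _ ⟨y, rfl⟩
    exact h2 y k

theorem repr_eq_zero_of_mem_hatH0 {x : CA} (hx : x ∈ hatH0) (u : List Letter) :
    (monBasis Letter).repr x (FreeMonoid.ofList (u ++ [Letter.hb])) = 0 := by
  have key : ∀ v : List Letter, v ≠ u ++ [Letter.hb] →
      (monBasis Letter).repr (word v) (FreeMonoid.ofList (u ++ [Letter.hb])) = 0 := by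
    intro v hv
    rw [show word v = monBasis Letter (FreeMonoid.ofList v) from
      (monBasis_apply (FreeMonoid.ofList v)).symm, Module.Basis.repr_self]
    exact Finsupp.single_eq_of_ne fun h => hv (FreeMonoid.ofList.injective h).symm
  let f : CA →ₗ[Coef] Coef :=
    (Finsupp.lapply (FreeMonoid.ofList (u ++ [Letter.hb]))).comp (monBasis Letter).repr.toLinearMap
  have := map_mem_of_mem_hatH0 (S := ⊥) f ((Submodule.mem_bot _).2 (key [] (by simp)))
    (fun y k => map_mem_of_word (f.comp (LinearMap.mulRight Coef (g k))) (fun v => by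
      rw [Submodule.mem_bot, LinearMap.comp_apply, LinearMap.mulRight_apply, g, word_mul_letter]
      exact key _ (by intro h; simpa using congrArg List.getLast? h)) y) hx
  exact (Submodule.mem_bot _).1 this

/-- The element `(ħb)^{α₁} g_{β₁+1} ⋯ (ħb)^{αᵣ} g_{βᵣ+1}`. -/
def blockProd (L : List (ℕ × ℕ)) : CA := (L.map fun p => hb ^ p.1 * g p.2.succPNat).prod

/-- A word that ends in some `gₖ` is a product of blocks `(ħb)^α g_{β+1}`. -/
theorem exists_blockProd (u : List Letter) (k : ℕ+) :
    ∃ L : List (ℕ × ℕ), word (u ++ [Letter.g k]) = blockProd L ∧ L ≠ [] ∧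
      ((∃ j, 2 ≤ j ∧ Letter.g j ∈ u ++ [Letter.g k]) → ∃ t : Fin L.length, 1 ≤ (L.get t).2) ∧
      (HasHbG (u ++ [Letter.g k]) →
        ∃ s t : Fin L.length, s ≤ t ∧ 1 ≤ (L.get s).1 ∧ 1 ≤ (L.get t).2) := by
  have hpos : ∀ j : ℕ+, 2 ≤ j → 1 ≤ j.natPred := by
    intro j hj
    have : (2 : ℕ) ≤ j := hj
    have h2 := PNat.natPred_add_one j
    omega
  induction u with
  | nil =>
    refine ⟨[(0, k.natPred)], by simp [word, blockProd, g], by simp, ?_, ?_⟩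
    · rintro ⟨j, hj, h⟩
      simp only [List.nil_append, List.mem_singleton, Letter.g.injEq] at h
      subst h
      exact ⟨⟨0, by simp⟩, hpos _ hj⟩
    · rintro ⟨u₁, u₂, j, hj, h, e⟩
      cases u₁ with
      | nil => simp at h
      | cons x u₁ => simp at e
  | cons x u ih =>
    obtain ⟨L, hL, hne, h1, h2⟩ := ih
    obtain ⟨⟨α, β⟩, L, rfl⟩ := List.exists_cons_of_ne_nil hne
    cases x with
    | hb =>
      have hg : (∃ j, 2 ≤ j ∧ Letter.g j ∈ u ++ [Letter.g k]) →
          ∃ t : Fin ((α + 1, β) :: L).length, 1 ≤ (((α + 1, β) :: L).get t).2 := by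
        intro h
        obtain ⟨t, ht⟩ := h1 h
        refine ⟨t, ?_⟩
        rcases t with ⟨_ | t, h⟩ <;> exact ht
      refine ⟨(α + 1, β) :: L, ?_, by simp, ?_, ?_⟩
      · rw [List.cons_append, ← List.singleton_append, word_append, hL]
        simp [blockProd, word, hb, pow_succ', mul_assoc]
      · rintro ⟨j, hj, h⟩
        exact hg ⟨j, hj, by simpa using h⟩
      · rintro ⟨u₁, u₂, j, hj, h, e⟩
        cases u₁ with
        | nil => simp at h
        | cons y u₁ =>
          obtain ⟨t, ht⟩ := hg ⟨j, hj, by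
            rw [List.cons_append, List.cons_append, List.cons.injEq] at e
            rw [e.2]; simp⟩
          exact ⟨⟨0, by simp⟩, t, Fin.mk_le_of_le_val (Nat.zero_le _), by simp, ht⟩
    | g j =>
      refine ⟨(0, j.natPred) :: (α, β) :: L, ?_, by simp, ?_, ?_⟩
      · rw [List.cons_append, ← List.singleton_append, word_append, hL]
        simp [blockProd, word, g]
      · rintro ⟨i, hi, h⟩
        rw [List.cons_append, List.mem_cons] at h
        rcases h with h | h
        · rw [Letter.g.injEq] at h
          subst h
          exact ⟨⟨0, by simp⟩, hpos _ hi⟩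
        · obtain ⟨t, ht⟩ := h1 ⟨i, hi, h⟩
          exact ⟨t.succ, ht⟩
      · rintro ⟨u₁, u₂, i, hi, h, e⟩
        cases u₁ with
        | nil => simp at h
        | cons y u₁ =>
          rw [List.cons_append, List.cons_append, List.cons.injEq] at e
          obtain ⟨s, t, hst, hs, ht⟩ := h2 ⟨u₁, u₂, i, hi, by
            rcases List.mem_cons.1 h with h | h
            · rw [← h] at e; exact absurd e.1 (by simp)
            · exact h, e.2⟩
          exact ⟨s.succ, t.succ, Fin.succ_le_succ_iff.2 hst, hs, ht⟩

theorem word_mem_n0 {u : List Letter} {k : ℕ+} (h : HasHbG (u ++ [Letter.g k])) :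
    word (u ++ [Letter.g k]) ∈ n0 := by
  obtain ⟨L, hL, -, -, h2⟩ := exists_blockProd u k
  obtain ⟨s, t, hst, hs, ht⟩ := h2 h
  refine Submodule.subset_span ⟨L.length, fun i => (L.get i).1, fun i => (L.get i).2, s, t, hst,
    hs, ht, ?_⟩
  rw [hL, blockProd]
  congr 1
  conv_lhs => rw [← List.ofFn_get L]
  rw [List.map_ofFn]
  rfl

theorem hbar_smul_mem_nn {x : CA} (hx : x ∈ hatH0) : hbar • x ∈ nn :=
  (le_sup_right : _ ≤ nn) ⟨x, hx, rfl⟩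

theorem prod_mem_hbIdeal {L : List CA} {x : CA} (hx : x ∈ L) (h : x ∈ hbIdeal) :
    L.prod ∈ hbIdeal := by
  induction L with
  | nil => simp at hx
  | cons y L ih =>
    rw [List.prod_cons]
    rcases List.mem_cons.1 hx with rfl | hx
    · exact hbIdeal_mul_right h _
    · exact hbIdeal_mul_left _ (ih hx)

theorem hb_pow_mem_hbIdeal {n : ℕ} (hn : 1 ≤ n) : hb ^ n ∈ hbIdeal := by
  obtain ⟨n, rfl⟩ := Nat.exists_eq_add_of_le' hn
  rw [pow_succ]
  exact hbIdeal_mul_left _ hb_mem_hbIdeal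

theorem n0_le_hbgIdeal : n0 ≤ hbgIdeal := by
  rw [n0, Submodule.span_le]
  rintro _ ⟨r, α, β, s, t, hst, hs, ht, rfl⟩
  set L := List.ofFn fun i => hb ^ α i * g (β i).succPNat with hL
  have hlen : L.length = r := by simp [hL]
  have hget : ∀ (i : Fin r) (h : (i : ℕ) < L.length), L[(i : ℕ)] = hb ^ α i * g (β i).succPNat := by
    intro i h
    simp [hL]
  have htl : (t : ℕ) < L.length := hlen.symm ▸ t.2
  rw [← List.take_append_drop t L, List.drop_eq_getElem_cons htl, List.prod_append,
    List.prod_cons, hget, mul_assoc, ← mul_assoc, ← mul_assoc]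
  refine hbgIdeal_mul_right (hbIdeal_mul_g ?_ ?_) _
  · rcases hst.lt_or_eq with h | rfl
    · refine hbIdeal_mul_right (prod_mem_hbIdeal (x := hb ^ α s * g (β s).succPNat) ?_
        (hbIdeal_mul_right (hb_pow_mem_hbIdeal hs) _)) _
      rw [← hget s (hlen.symm ▸ s.2)]
      exact List.mem_take_iff_getElem.2 ⟨s, by simpa [hlen] using h, rfl⟩
    · exact hbIdeal_mul_left _ (hb_pow_mem_hbIdeal hs)
  · rw [← PNat.coe_le_coe, Nat.succPNat_coe]
    simpa using ht

/-- `𝔫` consists of the elements of `Ĥ⁰` in the ideal `hbgIdeal`. -/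
theorem mem_nn_iff {x : CA} : x ∈ nn ↔ x ∈ hbgIdeal ∧ x ∈ hatH0 := by
  refine ⟨fun hx => ⟨?_, nn_le hx⟩, fun ⟨h1, h2⟩ => ?_⟩
  · refine (sup_le n0_le_hbgIdeal ?_ : nn ≤ hbgIdeal) hx
    rintro _ ⟨y, -, rfl⟩
    exact hbar_smul_mem_monIdeal y
  · rw [← (monBasis Letter).linearCombination_repr x, Finsupp.linearCombination_apply]
    refine Submodule.sum_mem _ fun u _ => ?_
    change _ • monBasis Letter u ∈ nn
    rw [monBasis_apply]
    -- a word outside `hbgIdeal` has a coefficient divisible by `ħ`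
    have hdvd : ∀ y : CA, y ∈ hatH0 → ¬ HasHbG u.toList →
        (monBasis Letter).repr x u • y ∈ nn := by
      intro y hy hu
      obtain ⟨d, hd⟩ := hbar_dvd_repr_of_mem_monIdeal h1 hu
      rw [FreeMonoid.ofList_toList] at hd
      rw [hd, mul_smul]
      exact hbar_smul_mem_nn (Submodule.smul_mem _ _ hy)
    rcases u.toList.eq_nil_or_concat' with hu | ⟨v, y, hu⟩
    · refine hdvd _ ?_ ?_
      · rw [hu]; exact one_mem_hatH0
      · rw [hu]; rintro ⟨u₁, u₂, k, -, -, h⟩; simp at h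
    · cases y with
      | hb =>
        have := repr_eq_zero_of_mem_hatH0 h2 v
        rw [← hu, FreeMonoid.ofList_toList] at this
        rw [this, zero_smul]
        exact zero_mem _
      | g k =>
        by_cases h : HasHbG u.toList
        · rw [hu] at h ⊢
          exact Submodule.smul_mem _ _ ((le_sup_left : _ ≤ nn) (word_mem_n0 h))
        · refine hdvd _ ?_ h
          rw [hu, ← word_mul_letter]
          exact mul_g_mem_hatH0 _ _

/-! ### The harmonic product and the spaces `Ĥ⁰`, `𝔫`, `ℌ⁰` -/

theorem har_mul_g_mul_g (w w' : CA) (k l : ℕ+) : har (w * g k) (w' * g l)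
    = har w (w' * g l) * g k + har (w * g k) w' * g l + har w w' * g (k + l) :=
  har_mul_mul w w' (Letter.g k) (Letter.g l)

theorem har_mem_hatH0 {x y : CA} (hx : x ∈ hatH0) (hy : y ∈ hatH0) : har x y ∈ hatH0 := by
  refine map_mem_of_mem_hatH0 (har.flip y) ?_ (fun x k => ?_) hx
  · rw [LinearMap.flip_apply, har_one_left]; exact hy
  · rw [LinearMap.flip_apply]
    refine map_mem_of_mem_hatH0 (har (x * g k)) ?_ (fun y l => ?_) hy
    · rw [har_one_right]; exact mul_g_mem_hatH0 _ _
    · rw [har_mul_g_mul_g]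
      exact add_mem (add_mem (mul_g_mem_hatH0 _ _) (mul_g_mem_hatH0 _ _)) (mul_g_mem_hatH0 _ _)

theorem mul_circ_hb_mem_monIdeal {P : List Letter → Prop} (x : CA) (y : Letter) :
    x * circ y Letter.hb ∈ monIdeal P := by
  cases y <;>
  · simp only [circ, mul_smul_comm]
    exact hbar_smul_mem_monIdeal _

theorem har_word_mem_hbIdeal (n : ℕ) : ∀ u v : List Letter, u.length + v.length = n → HasHb v →
    har (word u) (word v) ∈ hbIdeal := by
  induction n using Nat.strong_induction_on with
  | _ n ih =>
  intro u v hn hv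
  rcases u.eq_nil_or_concat' with rfl | ⟨u, x, rfl⟩
  · rw [show (word [] : CA) = 1 from rfl, har_one_left]; exact word_mem_monIdeal hv
  rcases v.eq_nil_or_concat' with rfl | ⟨v, y, rfl⟩
  · simp [HasHb] at hv
  simp only [List.length_append, List.length_cons, List.length_nil] at hn
  rw [← word_mul_letter, ← word_mul_letter, har_mul_mul, word_mul_letter, word_mul_letter]
  refine add_mem (add_mem (hbIdeal_mul_right (ih _ ?_ _ _ rfl hv) _) ?_) ?_
  · simp; omega
  · rcases List.mem_append.1 hv with hv | hv
    · exact hbIdeal_mul_right (ih _ (by simp; omega) _ _ rfl hv) _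
    · rw [← List.mem_singleton.1 hv]
      exact hbIdeal_mul_left _ hb_mem_hbIdeal
  · rcases List.mem_append.1 hv with hv | hv
    · exact hbIdeal_mul_right (ih _ (by omega) _ _ rfl hv) _
    · rw [← List.mem_singleton.1 hv]
      exact mul_circ_hb_mem_monIdeal _ _

theorem har_mem_hbIdeal (x : CA) {y : CA} (hy : y ∈ hbIdeal) : har x y ∈ hbIdeal :=
  map_mem_of_word (har.flip y) (fun u => map_mem_of_mem_monIdeal (har (word u))
    (fun v hv => har_word_mem_hbIdeal _ u v rfl hv) (fun _ => hbar_smul_mem_monIdeal _) hy) x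

theorem har_word_mem_hbgIdeal (n : ℕ) : ∀ u v : List Letter, u.length + v.length = n → HasHbG v →
    har (word u) (word v) ∈ hbgIdeal := by
  induction n using Nat.strong_induction_on with
  | _ n ih =>
  intro u v hn hv
  rcases u.eq_nil_or_concat' with rfl | ⟨u, x, rfl⟩
  · rw [show (word [] : CA) = 1 from rfl, har_one_left]; exact word_mem_monIdeal hv
  rcases v.eq_nil_or_concat' with rfl | ⟨v, y, rfl⟩
  · obtain ⟨u₁, u₂, k, -, -, h⟩ := hv; simp at h
  have hv' : HasHbG v ∨ ∃ k : ℕ+, 2 ≤ k ∧ y = Letter.g k ∧ HasHb v := by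
    obtain ⟨u₁, u₂, k, hk, h1, h⟩ := hv
    rcases u₂.eq_nil_or_concat' with rfl | ⟨u₂, z, rfl⟩
    · obtain ⟨h2, h3⟩ := List.append_inj' h (by simp)
      exact Or.inr ⟨k, hk, by simpa using h3, h2 ▸ h1⟩
    · rw [← List.cons_append, ← List.append_assoc] at h
      obtain ⟨h2, h3⟩ := List.append_inj' h (by simp)
      exact Or.inl ⟨u₁, u₂, k, hk, h1, h2⟩
  simp only [List.length_append, List.length_cons, List.length_nil] at hn
  rw [← word_mul_letter, ← word_mul_letter, har_mul_mul, word_mul_letter, word_mul_letter]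
  refine add_mem (add_mem (hbgIdeal_mul_right (ih _ ?_ _ _ rfl hv) _) ?_) ?_
  · simp; omega
  · rcases hv' with hv | ⟨k, hk, rfl, hvb⟩
    · exact hbgIdeal_mul_right (ih _ (by simp; omega) _ _ rfl hv) _
    · exact hbIdeal_mul_g (har_mem_hbIdeal _ (word_mem_monIdeal hvb)) hk
  · rcases hv' with hv | ⟨k, hk, rfl, hvb⟩
    · exact hbgIdeal_mul_right (ih _ (by omega) _ _ rfl hv) _
    · cases x with
      | hb => simp only [circ, mul_smul_comm]; exact hbar_smul_mem_monIdeal _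
      | g l =>
        exact hbIdeal_mul_g (har_mem_hbIdeal _ (word_mem_monIdeal hvb))
          (hk.trans (PNat.lt_add_left k l).le)

theorem har_mem_hbgIdeal (x : CA) {y : CA} (hy : y ∈ hbgIdeal) : har x y ∈ hbgIdeal :=
  map_mem_of_word (har.flip y) (fun u => map_mem_of_mem_monIdeal (har (word u))
    (fun v hv => har_word_mem_hbgIdeal _ u v rfl hv) (fun _ => hbar_smul_mem_monIdeal _) hy) x

/-- `𝔫` is an ideal of `Ĥ⁰` with respect to the harmonic product. -/
theorem har_mem_nn {x y : CA} (hx : x ∈ hatH0) (hy : y ∈ nn) : har x y ∈ nn :=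
  mem_nn_iff.2 ⟨har_mem_hbgIdeal x (mem_nn_iff.1 hy).1, har_mem_hatH0 hx (nn_le hy)⟩

/-- The space `𝒞 + ∑_{k ≥ 2} 𝒞⟨A⟩ gₖ`, the part of `ℌ⁰` spanned by the words that do not end in
`ħb` or `g₁`. -/
def admH0 : Submodule Coef CA :=
  1 ⊔ ⨆ k : ℕ+, ⨆ _ : 2 ≤ k, LinearMap.range (LinearMap.mulRight Coef (g k))

theorem one_mem_admH0 : (1 : CA) ∈ admH0 :=
  (le_sup_left : _ ≤ admH0) (Submodule.one_le.1 le_rfl)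

theorem mul_g_mem_admH0 (x : CA) {k : ℕ+} (hk : 2 ≤ k) : x * g k ∈ admH0 :=
  (le_sup_right : _ ≤ admH0) (Submodule.mem_iSup_of_mem k (Submodule.mem_iSup_of_mem hk ⟨x, rfl⟩))

theorem map_mem_of_mem_admH0 {M : Type} [AddCommMonoid M] [Module Coef M] {S : Submodule Coef M}
    (f : CA →ₗ[Coef] M) (h1 : f 1 ∈ S) (h2 : ∀ x (k : ℕ+), 2 ≤ k → f (x * g k) ∈ S) {x : CA}
    (hx : x ∈ admH0) : f x ∈ S := by
  refine (sup_le ?_ (iSup_le fun k => iSup_le fun hk => ?_) : admH0 ≤ S.comap f) hx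
  · rw [Submodule.one_le]; exact h1
  · rintro _ ⟨y, rfl⟩
    exact h2 y k hk

theorem har_mem_admH0 {x y : CA} (hx : x ∈ admH0) (hy : y ∈ admH0) : har x y ∈ admH0 := by
  refine map_mem_of_mem_admH0 (har.flip y) ?_ (fun x k hk => ?_) hx
  · rw [LinearMap.flip_apply, har_one_left]; exact hy
  · rw [LinearMap.flip_apply]
    refine map_mem_of_mem_admH0 (har (x * g k)) ?_ (fun y l hl => ?_) hy
    · rw [har_one_right]; exact mul_g_mem_admH0 _ hk
    · rw [har_mul_g_mul_g]
      exact add_mem (add_mem (mul_g_mem_admH0 _ hk) (mul_g_mem_admH0 _ hl))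
        (mul_g_mem_admH0 _ (hl.trans (PNat.lt_add_left l k).le))

theorem admH0_le_H0 : admH0 ≤ H0 := le_sup_left

theorem nn_le_H0 : nn ≤ H0 := le_sup_right

/-! ### The maps `Z_q` and the harmonic product -/

theorem ZqM_mul_letter (q : ℂ) (M : ℕ) (w : CA) (x : Letter) :
    ZqM q M (w * FreeAlgebra.ι Coef x) = ∑ m ∈ Finset.Ioo 0 M, ZqM q m w * F q m x := by
  have h := word_ext_semilinear
    (f := (ZqM q M).comp (LinearMap.mulRight Coef (FreeAlgebra.ι Coef x)))
    (f' := ∑ m ∈ Finset.Ioo 0 M, (LinearMap.mulRight ℂ (F q m x)).comp (ZqM q m)) (fun u => by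
      simp [word_mul_letter, ZqM_word, ZRev])
  simpa using congrArg (fun f => f w) h

theorem ZqM_mul_circ (q : ℂ) (M : ℕ) (w : CA) (x y : Letter) :
    ZqM q M (w * circ x y) = ∑ m ∈ Finset.Ioo 0 M, ZqM q m w * (F q m x * F q m y) := by
  cases x <;> cases y <;>
    simp only [circ, hb, g, mul_smul_comm, LinearMap.map_smulₛₗ, ZqM_mul_letter, evalHbar_hbar, F,
      smul_eq_mul, Finset.mul_sum, PNat.add_coe, add_mul, pow_add, div_mul_div_comm]
  all_goals exact Finset.sum_congr rfl fun m _ => by ring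

theorem sum_Ioo_mul_sum_Ioo (a b : ℕ → ℂ) (M : ℕ) :
    (∑ m ∈ Finset.Ioo 0 M, a m) * (∑ m ∈ Finset.Ioo 0 M, b m)
      = ∑ m ∈ Finset.Ioo 0 M, a m * (∑ i ∈ Finset.Ioo 0 m, b i)
        + ∑ m ∈ Finset.Ioo 0 M, (∑ i ∈ Finset.Ioo 0 m, a i) * b m
        + ∑ m ∈ Finset.Ioo 0 M, a m * b m := by
  have hs : ∀ (c : ℕ → ℂ) (M : ℕ), ∑ m ∈ Finset.Ioo 0 (M + 2), c m
      = ∑ m ∈ Finset.Ioo 0 (M + 1), c m + c (M + 1) := by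
    intro c M
    rw [show Finset.Ioo 0 (M + 2) = insert (M + 1) (Finset.Ioo 0 (M + 1)) by
      ext m; simp only [Finset.mem_Ioo, Finset.mem_insert]; omega, Finset.sum_insert (by simp)]
    ring
  rcases M with _ | M
  · simp
  induction M with
  | zero => simp [show Finset.Ioo 0 1 = ∅ from rfl]
  | succ M ih =>
    rw [hs, hs, hs, hs, hs]
    linear_combination ih

/-- The truncated sums `Z_{q,M}` turn the harmonic product into the product of complex numbers. -/
theorem ZqM_har (q : ℂ) (M : ℕ) (x y : CA) : ZqM q M (har x y) = ZqM q M x * ZqM q M y := by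
  have hw : ∀ n : ℕ, ∀ u v : List Letter, u.length + v.length = n → ∀ M : ℕ,
      ZqM q M (har (word u) (word v)) = ZqM q M (word u) * ZqM q M (word v) := by
    intro n
    induction n using Nat.strong_induction_on with
    | _ n ih =>
    intro u v hn M
    have h1 : ZqM q M (word []) = 1 := by rw [ZqM_word]; simp [ZRev]
    rcases u.eq_nil_or_concat' with rfl | ⟨u, x, rfl⟩
    · rw [h1, show (word [] : CA) = 1 from rfl, har_one_left, one_mul]
    rcases v.eq_nil_or_concat' with rfl | ⟨v, y, rfl⟩
    · rw [h1, show (word [] : CA) = 1 from rfl, har_one_right, mul_one]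
    simp only [List.length_append, List.length_cons, List.length_nil] at hn
    rw [← word_mul_letter, ← word_mul_letter, har_mul_mul, map_add, map_add, ZqM_mul_letter,
      ZqM_mul_letter, ZqM_mul_circ, ZqM_mul_letter, ZqM_mul_letter, sum_Ioo_mul_sum_Ioo]
    congr 1
    · congr 1
      · refine Finset.sum_congr rfl fun m _ => ?_
        rw [word_mul_letter, ih _ (by simp; omega) u (v ++ [y]) rfl, ← word_mul_letter,
          ZqM_mul_letter]
        ring
      · refine Finset.sum_congr rfl fun m _ => ?_
        rw [word_mul_letter, ih _ (by simp; omega) (u ++ [x]) v rfl, ← word_mul_letter,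
          ZqM_mul_letter]
        ring
    · refine Finset.sum_congr rfl fun m _ => ?_
      rw [ih _ (by omega) u v rfl]
      ring
  have h2 : ∀ (u : List Letter) (y : CA),
      ZqM q M (har (word u) y) = ZqM q M (word u) * ZqM q M y := fun u y =>
    congrArg (fun f => f y) (word_ext_semilinear (f := (ZqM q M).comp (har (word u)))
      (f' := (LinearMap.mulLeft ℂ (ZqM q M (word u))).comp (ZqM q M))
      (fun v => hw _ u v rfl M))
  exact congrArg (fun f => f x) (word_ext_semilinear (f := (ZqM q M).comp (har.flip y))
      (f' := (LinearMap.mulRight ℂ (ZqM q M y)).comp (ZqM q M)) (fun v => h2 v y))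

theorem Zq_har {q : ℂ} (hq : ‖q‖ < 1) {x y : CA} (hx : x ∈ hatH0) (hy : y ∈ hatH0) :
    Zq q (har x y) = Zq q x * Zq q y := by
  refine Tendsto.limUnder_eq ?_
  simpa only [ZqM_har] using (tendsto_Zq hq hx).mul (tendsto_Zq hq hy)

theorem Zq_one (q : ℂ) : Zq q 1 = 1 := by
  refine Tendsto.limUnder_eq ?_
  have : ∀ M, ZqM q M 1 = 1 := fun M => by
    rw [show (1 : CA) = word [] from rfl, ZqM_word]; simp [ZRev]
  simp [this]

/-! ### The ring `𝒵_q` and the ideal `𝒩_q + 𝒫_q` -/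

/-- `Z_q(Ĥ⁰)`, a ring that contains `𝒵_q`. -/
def hatZ (q : ℂ) (hq : ‖q‖ < 1) : Submodule ℚ ℂ := imZq q hq hatH0 le_rfl

theorem Zq_mem_hatZ {q : ℂ} (hq : ‖q‖ < 1) {x : CA} (hx : x ∈ hatH0) : Zq q x ∈ hatZ q hq :=
  ⟨x, hx, rfl⟩

theorem Zq_mem_ZqSpace {q : ℂ} (hq : ‖q‖ < 1) {x : CA} (hx : x ∈ H0) :
    Zq q x ∈ ZqSpace q hq := ⟨x, hx, rfl⟩

theorem Zq_mem_Nq {q : ℂ} (hq : ‖q‖ < 1) {x : CA} (hx : x ∈ nn) : Zq q x ∈ Nq q hq :=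
  ⟨x, hx, rfl⟩

theorem hatZ_mul_mem {q : ℂ} (hq : ‖q‖ < 1) {x y : ℂ} (hx : x ∈ hatZ q hq)
    (hy : y ∈ hatZ q hq) : x * y ∈ hatZ q hq := by
  obtain ⟨x, hx, rfl⟩ := hx
  obtain ⟨y, hy, rfl⟩ := hy
  exact ⟨har x y, har_mem_hatH0 hx hy, Zq_har hq hx hy⟩

/-- `𝒩_q` is an ideal not only of `𝒵_q` but of `Z_q(Ĥ⁰)`. -/
theorem hatZ_mul_mem_Nq {q : ℂ} (hq : ‖q‖ < 1) {x y : ℂ} (hx : x ∈ hatZ q hq)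
    (hy : y ∈ Nq q hq) : x * y ∈ Nq q hq := by
  obtain ⟨x, hx, rfl⟩ := hx
  obtain ⟨y, hy, rfl⟩ := hy
  exact ⟨har x y, har_mem_nn hx hy, Zq_har hq hx (nn_le hy)⟩

theorem ZqSpace_le_hatZ {q : ℂ} (hq : ‖q‖ < 1) : ZqSpace q hq ≤ hatZ q hq := by
  rintro _ ⟨x, hx, rfl⟩
  exact ⟨x, H0_le hx, rfl⟩

theorem Nq_le_ZqSpace {q : ℂ} (hq : ‖q‖ < 1) : Nq q hq ≤ ZqSpace q hq := by
  rintro _ ⟨x, hx, rfl⟩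
  exact ⟨x, nn_le_H0 hx, rfl⟩

theorem one_mem_ZqSpace {q : ℂ} (hq : ‖q‖ < 1) : 1 ∈ ZqSpace q hq :=
  ⟨1, admH0_le_H0 one_mem_admH0, Zq_one q⟩

theorem ZqSpace_mul_mem {q : ℂ} (hq : ‖q‖ < 1) {x y : ℂ} (hx : x ∈ ZqSpace q hq)
    (hy : y ∈ ZqSpace q hq) : x * y ∈ ZqSpace q hq := by
  -- `ℌ⁰` is the sum of `admH0` and `𝔫`, and products with `𝔫` stay in `𝔫`
  have hdec : ∀ z ∈ ZqSpace q hq, ∃ a ∈ admH0, ∃ n ∈ Nq q hq, z = Zq q a + n := by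
    rintro _ ⟨z, hz, rfl⟩
    obtain ⟨a, ha, n, hn, rfl⟩ := Submodule.mem_sup.1 (hz : z ∈ admH0 ⊔ nn)
    exact ⟨a, ha, _, Zq_mem_Nq hq hn, Zq_add hq (H0_le (admH0_le_H0 ha)) (nn_le hn)⟩
  have hx' := ZqSpace_le_hatZ hq hx
  obtain ⟨a, ha, n, hn, rfl⟩ := hdec x hx
  obtain ⟨b, hb, m, hm, rfl⟩ := hdec y hy
  have ha' := H0_le (admH0_le_H0 ha)
  have hb' := H0_le (admH0_le_H0 hb)
  rw [mul_add, add_mul]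
  refine add_mem (add_mem ?_ ?_) (Nq_le_ZqSpace hq (hatZ_mul_mem_Nq hq hx' hm))
  · rw [← Zq_har hq ha' hb']
    exact Zq_mem_ZqSpace hq (admH0_le_H0 (har_mem_admH0 ha hb))
  · rw [mul_comm]
    exact Nq_le_ZqSpace hq (hatZ_mul_mem_Nq hq (Zq_mem_hatZ hq hb') hn)

theorem mul_Zq_g_mem_Pq {q : ℂ} (hq : ‖q‖ < 1) {x : ℂ} (hx : x ∈ ZqSpace q hq) (k : ℕ+) :
    x * Zq q (g (2 * k)) ∈ Pq q hq :=
  Submodule.mul_mem_mul hx (Submodule.subset_span ⟨k, rfl⟩)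

theorem Pq_le_of {q : ℂ} (hq : ‖q‖ < 1) {S : Submodule ℚ ℂ}
    (h : ∀ x ∈ ZqSpace q hq, ∀ k : ℕ+, x * Zq q (g (2 * k)) ∈ S) : Pq q hq ≤ S := by
  refine Submodule.mul_le.2 fun x hx y hy => ?_
  induction hy using Submodule.span_induction with
  | mem y hy => obtain ⟨k, rfl⟩ := hy; exact h x hx k
  | zero => simp
  | add y z _ _ hy hz => rw [mul_add]; exact add_mem hy hz
  | smul c y _ hy => rw [mul_smul_comm]; exact Submodule.smul_mem _ _ hy

theorem Pq_le_ZqSpace {q : ℂ} (hq : ‖q‖ < 1) : Pq q hq ≤ ZqSpace q hq := by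
  refine Pq_le_of hq fun x hx k => ZqSpace_mul_mem hq hx (Zq_mem_ZqSpace hq (admH0_le_H0 ?_))
  rw [← one_mul (g _)]
  refine mul_g_mem_admH0 _ ?_
  rw [← PNat.coe_le_coe, PNat.mul_coe]
  exact Nat.le_mul_of_pos_right 2 k.pos

theorem NqPq_le_ZqSpace {q : ℂ} (hq : ‖q‖ < 1) : Nq q hq ⊔ Pq q hq ≤ ZqSpace q hq :=
  sup_le (Nq_le_ZqSpace hq) (Pq_le_ZqSpace hq)

theorem ZqSpace_mul_mem_NqPq {q : ℂ} (hq : ‖q‖ < 1) {x y : ℂ} (hx : x ∈ ZqSpace q hq)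
    (hy : y ∈ Nq q hq ⊔ Pq q hq) : x * y ∈ Nq q hq ⊔ Pq q hq := by
  refine (sup_le ?_ ?_ : Nq q hq ⊔ Pq q hq ≤
    (Nq q hq ⊔ Pq q hq).comap (LinearMap.mulLeft ℚ x)) hy
  · exact fun n hn => (le_sup_left : Nq q hq ≤ _) (hatZ_mul_mem_Nq hq (ZqSpace_le_hatZ hq hx) hn)
  · refine Pq_le_of hq fun z hz k => (le_sup_right : Pq q hq ≤ _) ?_
    rw [LinearMap.mulLeft_apply, ← mul_assoc]
    exact mul_Zq_g_mem_Pq hq (ZqSpace_mul_mem hq hx hz) k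

/-! ### Shuffle powers of `g₁` and the elements `E_{1^m}` -/

/-- The divided shuffle power `g₁^{sh j} / j!`. -/
def fS (j : ℕ) : CA := (j.factorial : ℚ)⁻¹ • shPow (g 1) j

theorem fS_zero : fS 0 = 1 := by simp [fS, shPow]

theorem sh_add_left (x x' y : CA) : sh (x + x') y = sh x y + sh x' y := by
  simp only [← shL_apply, map_add, LinearMap.add_apply]

theorem sh_rat_smul_right (c : ℚ) (x y : CA) : sh x (c • y) = c • sh x y :=
  map_rat_smul (shL x) c y

theorem sh_sum_right {ι : Type} (s : Finset ι) (x : CA) (y : ι → CA) :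
    sh x (∑ i ∈ s, y i) = ∑ i ∈ s, sh x (y i) :=
  map_sum (shL x) y s

theorem factorial_inv_succ (n : ℕ) :
    ((n : ℚ) + 1) * ((n + 1).factorial : ℚ)⁻¹ = (n.factorial : ℚ)⁻¹ := by
  rw [Nat.factorial_succ]
  push_cast
  have : (n.factorial : ℚ) ≠ 0 := by positivity
  have : (n : ℚ) + 1 ≠ 0 := by positivity
  field_simp

theorem sh_g_one_fS (j : ℕ) : sh (g 1) (fS j) = ((j : ℚ) + 1) • fS (j + 1) := by
  rw [fS, fS, smul_smul, factorial_inv_succ, sh_rat_smul_right]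
  rfl

/-- The recursion `f_{m+1} = ∑_{i+n=m} fᵢ (ħb)ⁿ g₁ / (n+1)!` of the divided shuffle powers, that
is, `F = 1 + F · (e^{X ħb} - 1) / ħb · g₁` for their generating series. -/
theorem fS_succ (m : ℕ) : fS (m + 1)
    = ∑ p ∈ antidiagonal m, ((p.2 + 1).factorial : ℚ)⁻¹ • (fS p.1 * hb ^ p.2 * g 1) := by
  induction m with
  | zero => simp [fS, shPow, sh_one_right]
  | succ m ih =>
    have hm : ((m : ℚ) + 2) ≠ 0 := by positivity
    refine smul_right_injective CA hm ?_
    have h1 : ((m : ℚ) + 2) • fS (m + 1 + 1) = sh (g 1) (fS (m + 1)) := by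
      rw [sh_g_one_fS]; push_cast; congr 1; ring
    have h2 : sh (g 1) (fS (m + 1)) = ∑ p ∈ antidiagonal m,
        (((p.2 + 1).factorial : ℚ)⁻¹ • (((p.1 : ℚ) + 1) • (fS (p.1 + 1) * hb ^ p.2 * g 1))
        + ((p.2 + 1).factorial : ℚ)⁻¹ • (fS p.1 * hb ^ p.2 * g 1) * g 1
        + ((p.2 + 1).factorial : ℚ)⁻¹ • (fS p.1 * hb ^ (p.2 + 1) * g 1)) := by
      rw [ih, sh_sum_right]
      refine Finset.sum_congr rfl fun p _ => ?_
      rw [sh_rat_smul_right, sh_g_one_mul_g_one, sh_mul_hb_pow_right, sh_g_one_fS]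
      simp only [smul_add, smul_mul_assoc, pow_succ, mul_assoc]
    -- the weight `m + 2 = i + (n + 1)` distributes over the three terms of `h2`
    have h3 : ((m : ℚ) + 2) • ∑ p ∈ antidiagonal (m + 1),
          ((p.2 + 1).factorial : ℚ)⁻¹ • (fS p.1 * hb ^ p.2 * g 1)
        = ∑ p ∈ antidiagonal (m + 1),
          ((p.1 : ℚ) • ((p.2 + 1).factorial : ℚ)⁻¹ • (fS p.1 * hb ^ p.2 * g 1))
        + ∑ p ∈ antidiagonal (m + 1),
          ((p.2.factorial : ℚ)⁻¹ • (fS p.1 * hb ^ p.2 * g 1)) := by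
      rw [Finset.smul_sum, ← Finset.sum_add_distrib]
      refine Finset.sum_congr rfl fun p hp => ?_
      rw [mem_antidiagonal] at hp
      rw [← factorial_inv_succ p.2, mul_smul, ← add_smul]
      congr 1
      have : (p.1 : ℚ) + p.2 = m + 1 := by exact_mod_cast hp
      linear_combination -this
    change ((m : ℚ) + 2) • fS (m + 1 + 1) = ((m : ℚ) + 2) • _
    rw [h1, h2, h3, Finset.sum_add_distrib, Finset.sum_add_distrib, ← Finset.sum_mul, ← ih,
      Finset.Nat.sum_antidiagonal_succ (n := m), Finset.Nat.sum_antidiagonal_succ' (n := m)]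
    simp only [Nat.cast_zero, zero_smul, zero_add, pow_zero, mul_one, Nat.factorial_zero,
      Nat.cast_one, inv_one, one_smul, Nat.cast_add]
    rw [add_assoc]
    congr 1
    · refine Finset.sum_congr rfl fun p _ => ?_
      rw [smul_comm]

/-- The explicit form `E_{1^m} = ∑_{s+n=m} f_s (ħb)ⁿ / (n+1)!`. -/
theorem EOnes_eq (m : ℕ) : EOnes m
    = ∑ p ∈ antidiagonal m, ((p.2 + 1).factorial : ℚ)⁻¹ • (fS p.1 * hb ^ p.2) := by
  -- `T` and `R` are the shuffle multiplications by `g₁` and `ħb = e₁ - g₁`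
  let T : Module.End Coef CA := shL (g 1)
  let R : Module.End Coef CA := LinearMap.mulRight Coef hb
  have hTR : Commute T R := LinearMap.ext fun y => sh_mul_hb_right (g 1) y
  have hT : ∀ j, shPow (g 1) j = (T ^ j) 1 := by
    intro j
    induction j with
    | zero => rfl
    | succ j ih => rw [shPow, ih, pow_succ']; rfl
  have hTR1 : ∀ j, shPow (e 1) j = ((T + R) ^ j) 1 := by
    intro j
    induction j with
    | zero => rfl
    | succ j ih =>
      rw [shPow, ih, pow_succ', e, if_pos rfl, add_comm, sh_add_left, sh_hb_left]; rfl
  have hsh : ∀ j y, sh (shPow (g 1) j) y = (T ^ j) y := by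
    intro j
    induction j with
    | zero => intro y; exact sh_one_left y
    | succ j ih => intro y; rw [shPow, sh_assoc, ih, pow_succ']; rfl
  have hR : ∀ n y, (R ^ n) y = y * hb ^ n := by
    intro n
    induction n with
    | zero => simp
    | succ n ih => intro y; rw [pow_succ', Module.End.mul_apply, ih, pow_succ, ← mul_assoc]; rfl
  let S : Module.End Coef CA := ∑ j ∈ Finset.range (m + 1), T ^ j * (T + R) ^ (m - j)
  have hE : EOnes m = ((m + 1).factorial : ℚ)⁻¹ • S 1 := by
    rw [EOnes, LinearMap.sum_apply]
    congr 1
    refine Finset.sum_congr rfl fun j _ => ?_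
    rw [hsh, hTR1, Module.End.mul_apply]
  have hSR : S (R 1) = ((T + R) ^ (m + 1)) 1 - (T ^ (m + 1)) 1 := by
    have h := Commute.geom_sum₂_mul (R := Module.End Coef CA) ((Commute.refl T).add_right hTR)
      (m + 1)
    rw [show T - (T + R) = -R by abel] at h
    have h1 : S (-(R 1)) = (T ^ (m + 1)) 1 - ((T + R) ^ (m + 1)) 1 := LinearMap.congr_fun h 1
    rw [← neg_sub, ← h1, map_neg, neg_neg]
  have hRS : Commute R S := by
    refine Commute.sum_right _ _ _ fun j _ => ?_
    exact (hTR.symm.pow_right j).mul_right ((hTR.symm.add_right (Commute.refl R)).pow_right _)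
  have hcancel : Function.Injective fun y : CA => y * hb :=
    mul_left_injective₀ (FreeAlgebra.ι_ne_zero _)
  refine hcancel ?_
  have h1 : S 1 * hb = ((T + R) ^ (m + 1)) 1 - (T ^ (m + 1)) 1 := by
    rw [← hSR]
    exact LinearMap.congr_fun hRS.eq 1
  change EOnes m * hb = _ * hb
  rw [hE, smul_mul_assoc, h1, hTR.add_pow', LinearMap.sum_apply,
    Finset.Nat.sum_antidiagonal_succ' (n := m), Finset.sum_mul]
  simp only [Nat.choose_self, pow_zero, mul_one, one_smul, add_sub_cancel_left]
  rw [Finset.smul_sum]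
  refine Finset.sum_congr rfl fun p hp => ?_
  rw [mem_antidiagonal] at hp
  have h2 : (T ^ p.1 * R ^ (p.2 + 1)) 1 = shPow (g 1) p.1 * hb ^ (p.2 + 1) := by
    rw [(hTR.pow_pow _ _).eq, Module.End.mul_apply, hR, hT]
  rw [LinearMap.smul_apply, h2, fS, ← hp, add_assoc, ← Nat.cast_smul_eq_nsmul ℚ, smul_smul,
    Nat.cast_add_choose, smul_mul_assoc, smul_mul_assoc, smul_mul_assoc, smul_smul, mul_assoc,
    ← pow_succ]
  congr 1
  have h3 : ((p.1 + (p.2 + 1)).factorial : ℚ) ≠ 0 := by positivity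
  field_simp

theorem fS_succ_eq (m : ℕ) : fS (m + 1) = EOnes m * g 1 := by
  rw [fS_succ, EOnes_eq, Finset.sum_mul]
  exact Finset.sum_congr rfl fun p _ => by rw [smul_mul_assoc]

theorem EOnes_eq_add (m : ℕ) : EOnes (m + 1) = ((m + 2).factorial : ℚ)⁻¹ • hb ^ (m + 1)
    + ∑ p ∈ antidiagonal m, ((p.2 + 1).factorial : ℚ)⁻¹ • (EOnes p.1 * g 1 * hb ^ p.2) := by
  rw [EOnes_eq, Finset.Nat.sum_antidiagonal_succ]
  simp [fS_zero, fS_succ_eq]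

/-- The series `∑ Xⁿ (ħb)ⁿ / (n+1)!`. -/
def phiSer : PowerSeries CA := PowerSeries.mk fun n => ((n + 1).factorial : ℚ)⁻¹ • hb ^ n

/-- The mirror image of the recursion `fS_succ`. -/
theorem fS_succ' (m : ℕ) : fS (m + 1)
    = ∑ p ∈ antidiagonal m, ((p.1 + 1).factorial : ℚ)⁻¹ • (hb ^ p.1 * g 1 * fS p.2) := by
  let F : PowerSeries CA := PowerSeries.mk fS
  let B : PowerSeries CA := phiSer * PowerSeries.C (g 1)
  have hF : F = 1 + F * B * PowerSeries.X := by
    ext n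
    rcases n with _ | n
    · simp [F, fS_zero]
    · rw [map_add, PowerSeries.coeff_succ_mul_X, PowerSeries.coeff_mul, PowerSeries.coeff_one,
        if_neg (by omega), zero_add, PowerSeries.coeff_mk, fS_succ]
      refine Finset.sum_congr rfl fun p _ => ?_
      simp [F, B, phiSer, mul_assoc]
  have h1 : F * (1 - B * PowerSeries.X) = 1 := by
    rw [mul_sub, mul_one, ← mul_assoc]
    nth_rewrite 1 [hF]
    abel
  -- a left inverse of a series with constant term `1` is also a right inverse
  have h2 : (1 - B * PowerSeries.X) * F = 1 := by
    have h3 := PowerSeries.mul_invOfUnit (1 - B * PowerSeries.X) 1 (by simp)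
    rw [left_inv_eq_right_inv h1 h3]
    exact h3
  have h4 : F = 1 + B * F * PowerSeries.X := by
    rw [sub_mul, one_mul, mul_assoc, ← PowerSeries.X_mul.symm, ← mul_assoc, sub_eq_iff_eq_add] at h2
    exact h2
  have h5 := congrArg (PowerSeries.coeff (m + 1)) h4
  rw [map_add, PowerSeries.coeff_succ_mul_X, PowerSeries.coeff_mul, PowerSeries.coeff_one,
    if_neg (by omega), zero_add, PowerSeries.coeff_mk] at h5
  rw [h5]
  refine Finset.sum_congr rfl fun p _ => ?_
  simp [F, B, phiSer]

theorem sum_antidiagonal_inv_factorial (n : ℕ) : ∑ p ∈ antidiagonal n,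
    (p.1.factorial : ℚ)⁻¹ * ((-1) ^ p.2 * ((p.2 + 1).factorial : ℚ)⁻¹)
      = ((n + 1).factorial : ℚ)⁻¹ := by
  have h := (Commute.all (1 : ℚ) (-1)).add_pow' (n + 1)
  rw [Finset.Nat.sum_antidiagonal_succ'] at h
  simp only [add_neg_cancel, mul_zero, Nat.choose_self, one_pow, pow_zero, mul_one, one_smul,
    one_mul, pow_succ, nsmul_eq_mul] at h
  have h2 : ((n + 1).factorial : ℚ) ≠ 0 := by positivity
  refine mul_left_cancel₀ h2 ?_
  rw [mul_inv_cancel₀ h2, Finset.mul_sum]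
  have h3 : ∀ p ∈ antidiagonal n, ((n + 1).factorial : ℚ) *
      ((p.1.factorial : ℚ)⁻¹ * ((-1) ^ p.2 * ((p.2 + 1).factorial : ℚ)⁻¹))
      = -(((n + 1).choose p.1 : ℚ) * ((-1) ^ p.2 * -1)) := by
    intro p hp
    rw [mem_antidiagonal] at hp
    rw [← hp, add_assoc, Nat.cast_add_choose]
    field_simp
  rw [Finset.sum_congr rfl h3, Finset.sum_neg_distrib]
  linarith

/-- The recursion `(-1)^l f_l = (ħb)^l / l! - ∑_{n+b=l-1} (ħb)ⁿ (g₁ + ħb) (-1)^b f_b / (n+1)!`: the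
automorphism `ħb ↦ ħb`, `g₁ ↦ -(g₁ + ħb)` maps `F(X)` to `F(-X) e^{-X ħb}`. -/
theorem neg_one_pow_smul_fS (m : ℕ) : (-1 : ℚ) ^ (m + 1) • fS (m + 1)
    = ((m + 1).factorial : ℚ)⁻¹ • hb ^ (m + 1) - ∑ p ∈ antidiagonal m,
      ((p.1 + 1).factorial : ℚ)⁻¹ • (hb ^ p.1 * (g 1 + hb) * ((-1 : ℚ) ^ p.2 • fS p.2)) := by
  let F : PowerSeries CA := PowerSeries.mk fun n => (-1 : ℚ) ^ n • fS n
  let phi' : PowerSeries CA :=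
    PowerSeries.mk fun n => ((-1) ^ n * ((n + 1).factorial : ℚ)⁻¹) • hb ^ n
  let E : PowerSeries CA := PowerSeries.mk fun n => (n.factorial : ℚ)⁻¹ • hb ^ n
  have hF : F = 1 - phi' * PowerSeries.C (g 1) * F * PowerSeries.X := by
    ext n
    rcases n with _ | n
    · simp [F, fS_zero]
    · rw [map_sub, PowerSeries.coeff_succ_mul_X, PowerSeries.coeff_mul, PowerSeries.coeff_one,
        if_neg (by omega), zero_sub, PowerSeries.coeff_mk, fS_succ', Finset.smul_sum,
        ← Finset.sum_neg_distrib]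
      refine Finset.sum_congr rfl fun p hp => ?_
      rw [mem_antidiagonal] at hp
      rw [← hp]
      simp only [F, phi', PowerSeries.coeff_mul_C, PowerSeries.coeff_mk, smul_mul_assoc,
        mul_smul_comm, smul_smul, ← neg_smul]
      congr 1
      ring
  have hE : E = 1 + phiSer * PowerSeries.C hb * PowerSeries.X := by
    ext n
    rcases n with _ | n
    · simp [E]
    · rw [map_add, PowerSeries.coeff_succ_mul_X, PowerSeries.coeff_one, if_neg (by omega), zero_add]
      simp [E, phiSer, pow_succ]
  have hEphi : E * phi' = phiSer := by
    ext n
    rw [PowerSeries.coeff_mul, phiSer, PowerSeries.coeff_mk, ← sum_antidiagonal_inv_factorial,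
      Finset.sum_smul]
    refine Finset.sum_congr rfl fun p hp => ?_
    rw [mem_antidiagonal] at hp
    simp only [E, phi', PowerSeries.coeff_mk, smul_mul_assoc, mul_smul_comm, smul_smul, ← pow_add,
      hp, mul_comm]
  have hmain : F = E - phiSer * PowerSeries.C (g 1 + hb) * F * PowerSeries.X := by
    have h1 : phiSer * PowerSeries.C hb * F * PowerSeries.X = (E - 1) * F := by
      rw [hE, add_sub_cancel_left, mul_assoc _ F, mul_assoc _ PowerSeries.X, PowerSeries.X_mul]
    have h2 : phiSer * PowerSeries.C (g 1) * F * PowerSeries.X = E * (1 - F) := by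
      rw [← hEphi]
      nth_rewrite 2 [hF]
      rw [sub_sub_cancel]
      simp only [mul_assoc]
    rw [map_add, mul_add, add_mul, add_mul, h1, h2]
    simp only [sub_mul, mul_sub, one_mul, mul_one]
    abel
  have h5 := congrArg (PowerSeries.coeff (m + 1)) hmain
  rw [map_sub, PowerSeries.coeff_succ_mul_X, PowerSeries.coeff_mul, PowerSeries.coeff_mk,
    PowerSeries.coeff_mk] at h5
  rw [h5]
  congr 1
  refine Finset.sum_congr rfl fun p _ => ?_
  simp only [F, phiSer, PowerSeries.coeff_mul_C, PowerSeries.coeff_mk, smul_mul_assoc]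

/-! ### Deconcatenation and the maps `w^𝒮` -/

open TensorProduct

/- Rewriting with the general lemmas does not find the ring structure of `𝒞⟨A⟩` behind negation, so
the following three are restated. -/

theorem CA_mul_neg (x y : CA) : x * -y = -(x * y) := mul_neg x y

theorem CA_neg_mul (x y : CA) : -x * y = -(x * y) := neg_mul x y

theorem CA_smul_sub (c : Coef) (x y : CA) : c • (x - y) = c • x - c • y := smul_sub c x y

/-- The algebra anti-endomorphism of `𝒞⟨A⟩` with given values on letters, as a linear map. -/
def antiLift (f : Letter → CA) : CA →ₗ[Coef] CA :=
  (MulOpposite.opLinearEquiv Coef).symm.toLinearMap.comp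
    (FreeAlgebra.lift Coef fun x => MulOpposite.op (f x)).toLinearMap

theorem antiLift_mul (f : Letter → CA) (x y : CA) :
    antiLift f (x * y) = antiLift f y * antiLift f x := by
  simp [antiLift]

theorem antiLift_one (f : Letter → CA) : antiLift f 1 = 1 := by
  simp [antiLift]

theorem antiLift_letter (f : Letter → CA) (x : Letter) :
    antiLift f (FreeAlgebra.ι Coef x) = f x := by
  simp [antiLift]

theorem antiLift_pow (f : Letter → CA) (x : CA) (n : ℕ) :
    antiLift f (x ^ n) = antiLift f x ^ n := by
  induction n with
  | zero => simp [antiLift_one]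
  | succ n ih => rw [pow_succ, antiLift_mul, ih, pow_succ']

/-- The deconcatenation coproduct `u₁ ⋯ uᵣ ↦ ∑ᵢ u₁ ⋯ uᵢ ⊗ uᵢ₊₁ ⋯ uᵣ`. -/
def decon : CA →ₗ[Coef] CA ⊗[Coef] CA :=
  (monBasis Letter).constr Coef fun u =>
    ∑ i ∈ Finset.range (u.toList.length + 1), word (u.toList.take i) ⊗ₜ word (u.toList.drop i)

theorem decon_word (u : List Letter) : decon (word u)
    = ∑ i ∈ Finset.range (u.length + 1), word (u.take i) ⊗ₜ word (u.drop i) := by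
  rw [show word u = monBasis Letter (FreeMonoid.ofList u) from
    (monBasis_apply (FreeMonoid.ofList u)).symm, decon, Module.Basis.constr_basis]
  rfl

theorem decon_word_mul_word (u v : List Letter) (x : Letter) :
    decon (word u * FreeAlgebra.ι Coef x * word v)
      = decon (word u) * (1 ⊗ₜ (FreeAlgebra.ι Coef x * word v))
        + ((word u * FreeAlgebra.ι Coef x) ⊗ₜ 1) * decon (word v) := by
  have h1 : ∀ v : List Letter, FreeAlgebra.ι Coef x * word v = word (x :: v) := fun v => by
    simp [word]
  simp only [mul_assoc, h1]
  rw [← word_append, decon_word, decon_word, decon_word, Finset.sum_mul, Finset.mul_sum,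
    word_mul_letter, show (u ++ x :: v).length + 1 = (u.length + 1) + (v.length + 1) by
      simp only [List.length_append, List.length_cons]; omega, Finset.sum_range_add]
  congr 1
  · refine Finset.sum_congr rfl fun i hi => ?_
    have hi' : i ≤ u.length := Nat.lt_succ_iff.1 (Finset.mem_range.1 hi)
    rw [Algebra.TensorProduct.tmul_mul_tmul, mul_one, ← word_append,
      List.take_append_of_le_length hi', List.drop_append_of_le_length hi']
  · refine Finset.sum_congr rfl fun i hi => ?_
    rw [Algebra.TensorProduct.tmul_mul_tmul, one_mul, ← word_append, List.append_assoc,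
      List.singleton_append, add_assoc, List.take_length_add_append, List.drop_length_add_append,
      add_comm 1 i, List.take_succ_cons, List.drop_succ_cons]

theorem decon_mul_letter_mul (w v : CA) (x : Letter) :
    decon (w * FreeAlgebra.ι Coef x * v)
      = decon w * (1 ⊗ₜ (FreeAlgebra.ι Coef x * v))
        + ((w * FreeAlgebra.ι Coef x) ⊗ₜ 1) * decon v := by
  have h := word_ext2
    (f := ((LinearMap.mul Coef CA).comp (LinearMap.mulRight Coef (FreeAlgebra.ι Coef x))).compr₂
      decon)
    (f' := (LinearMap.mul Coef (CA ⊗[Coef] CA)).compl₁₂ decon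
        ((TensorProduct.mk Coef CA CA 1).comp (LinearMap.mulLeft Coef (FreeAlgebra.ι Coef x)))
      + (LinearMap.mul Coef (CA ⊗[Coef] CA)).compl₁₂
        (((TensorProduct.mk Coef CA CA).flip 1).comp
          (LinearMap.mulRight Coef (FreeAlgebra.ι Coef x))) decon)
    (fun u v => by simpa using decon_word_mul_word u v x) w v
  simpa using h

/-- For a bilinear product `op` and an anti-endomorphism `ψ` given on letters by `f`, the linear map
`u₁ ⋯ uᵣ ↦ ∑ᵢ p u₁ ⋯ uᵢ · s ψ(uᵢ₊₁ ⋯ uᵣ)` with a prefix `p` and a suffix `s`. -/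
def cut (op : CA →ₗ[Coef] CA →ₗ[Coef] CA) (f : Letter → CA) (p s : CA) : CA →ₗ[Coef] CA :=
  (TensorProduct.lift (op.compl₁₂ (LinearMap.mulLeft Coef p)
    ((LinearMap.mulLeft Coef s).comp (antiLift f)))).comp decon

theorem cut_mul_letter_mul (op : CA →ₗ[Coef] CA →ₗ[Coef] CA) (f : Letter → CA) (p s w v : CA)
    (x : Letter) : cut op f p s (w * FreeAlgebra.ι Coef x * v)
      = cut op f p (s * antiLift f v * f x) w + cut op f (p * w * FreeAlgebra.ι Coef x) s v := by
  have h1 : ∀ (t : CA ⊗[Coef] CA) (y : CA), TensorProduct.lift (op.compl₁₂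
      (LinearMap.mulLeft Coef p) ((LinearMap.mulLeft Coef s).comp (antiLift f))) (t * (1 ⊗ₜ y))
      = TensorProduct.lift (op.compl₁₂ (LinearMap.mulLeft Coef p)
        ((LinearMap.mulLeft Coef (s * antiLift f y)).comp (antiLift f))) t := by
    intro t y
    induction t using TensorProduct.induction_on with
    | zero => simp
    | tmul a b => simp [antiLift_mul]
    | add a b ha hb => rw [add_mul, map_add, ha, hb, map_add]
  have h2 : ∀ (t : CA ⊗[Coef] CA) (y : CA), TensorProduct.lift (op.compl₁₂
      (LinearMap.mulLeft Coef p) ((LinearMap.mulLeft Coef s).comp (antiLift f))) ((y ⊗ₜ 1) * t)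
      = TensorProduct.lift (op.compl₁₂ (LinearMap.mulLeft Coef (p * y))
        ((LinearMap.mulLeft Coef s).comp (antiLift f))) t := by
    intro t y
    induction t using TensorProduct.induction_on with
    | zero => simp
    | tmul a b => simp
    | add a b ha hb => rw [mul_add, map_add, ha, hb, map_add]
  rw [cut, LinearMap.comp_apply, decon_mul_letter_mul, map_add, h1, h2, antiLift_mul,
    antiLift_letter, mul_assoc p, mul_assoc s]
  rfl

theorem cut_letter_pow (op : CA →ₗ[Coef] CA →ₗ[Coef] CA) (f : Letter → CA) (p s : CA)
    (x : Letter) (n : ℕ) : cut op f p s (FreeAlgebra.ι Coef x ^ n) = ∑ i ∈ antidiagonal n,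
      op (p * FreeAlgebra.ι Coef x ^ i.1) (s * f x ^ i.2) := by
  have h : ∀ n, FreeAlgebra.ι Coef x ^ n = word (List.replicate n x) := fun n => by simp [word]
  rw [Finset.Nat.sum_antidiagonal_eq_sum_range_succ
    (fun i j => op (p * FreeAlgebra.ι Coef x ^ i) (s * f x ^ j)), h, cut, LinearMap.comp_apply,
    decon_word, map_sum, List.length_replicate]
  refine Finset.sum_congr rfl fun i hi => ?_
  have hi' : i ≤ n := Nat.lt_succ_iff.1 (Finset.mem_range.1 hi)
  rw [List.take_replicate, List.drop_replicate, min_eq_left hi', ← h, ← h]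
  simp [antiLift_pow, antiLift_letter]

theorem cut_one (op : CA →ₗ[Coef] CA →ₗ[Coef] CA) (f : Letter → CA) (p s : CA) :
    cut op f p s 1 = op p s := by
  have := cut_letter_pow op f p s Letter.hb 0
  simpa using this

theorem wStar_eq_cut (w : CA) : wStar w = cut har psiStarLetter 1 1 w := by
  have : wStar = cut har psiStarLetter 1 1 := (monBasis Letter).ext fun u => by
    rw [wStar, Module.Basis.constr_basis, monBasis_apply, cut, LinearMap.comp_apply, decon_word,
      map_sum]
    refine Finset.sum_congr rfl fun i _ => ?_
    simp [psiStar, antiLift]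
  rw [this]

theorem wSh_eq_cut (w : CA) : wSh w = cut shL psiShLetter 1 1 w := by
  have : wSh = cut shL psiShLetter 1 1 := (monBasis Letter).ext fun u => by
    rw [wSh, Module.Basis.constr_basis, monBasis_apply, cut, LinearMap.comp_apply, decon_word,
      map_sum]
    refine Finset.sum_congr rfl fun i _ => ?_
    simp [psiSh, antiLift, shL_apply]
  rw [this]

theorem psiShLetter_g_one : psiShLetter (Letter.g 1) = -(g 1 + hb) := by
  have h : Nat.succPNat 0 = 1 := rfl
  simp [psiShLetter, add_comm, h]

theorem EOnes_zero : EOnes 0 = 1 := by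
  rw [EOnes_eq]; simp [fS_zero]

theorem cut_rat_smul (op : CA →ₗ[Coef] CA →ₗ[Coef] CA) (f : Letter → CA) (p s : CA)
    (c : ℚ) (x : CA) : cut op f p s (c • x) = c • cut op f p s x :=
  map_rat_smul (cut op f p s) c x

theorem cut_sh_hb_pow (p s : CA) (n : ℕ) :
    cut shL psiShLetter p s (hb ^ n) = ((n : ℚ) + 1) • (sh p s * hb ^ n) := by
  rw [hb, cut_letter_pow]
  have : ∀ i ∈ antidiagonal n, shL (p * FreeAlgebra.ι Coef Letter.hb ^ i.1)
      (s * psiShLetter Letter.hb ^ i.2) = sh p s * hb ^ n := by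
    intro i hi
    rw [mem_antidiagonal] at hi
    change sh (p * hb ^ i.1) (s * hb ^ i.2) = _
    rw [sh_mul_hb_pow_left, sh_mul_hb_pow_right, mul_assoc, ← pow_add, add_comm, hi]
  rw [Finset.sum_congr rfl this, Finset.sum_const, Finset.Nat.card_antidiagonal,
    ← Nat.cast_smul_eq_nsmul ℚ]
  push_cast
  rfl

theorem sum_antidiagonal_antidiagonal {M : Type} [AddCommMonoid M] (m : ℕ) (F : ℕ → ℕ → ℕ → M) :
    ∑ i ∈ antidiagonal m, ∑ j ∈ antidiagonal i.1, F j.1 j.2 i.2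
      = ∑ i ∈ antidiagonal m, ∑ j ∈ antidiagonal i.2, F i.1 j.2 j.1 := by
  rw [Finset.sum_sigma', Finset.sum_sigma']
  refine Finset.sum_nbij' (fun x => ⟨(x.2.1, x.2.2 + x.1.2), (x.1.2, x.2.2)⟩)
    (fun x => ⟨(x.1.1 + x.2.2, x.2.1), (x.1.1, x.2.2)⟩) ?_ ?_ ?_ ?_ ?_
  all_goals
    rintro ⟨⟨i, n⟩, ⟨a, b⟩⟩ h
    simp only [Finset.mem_sigma, mem_antidiagonal] at h
    obtain ⟨h1, h2⟩ := h
    subst h1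
    subst h2
    simp [mem_antidiagonal, add_comm, add_left_comm]

/-- The deconcatenations of `E_{1^m}`: the letters `ħb` at the place of the cut cancel against the
recursion `neg_one_pow_smul_fS`, and only shuffle powers of `g₁` remain on both sides. -/
theorem cut_sh_EOnes (p : CA) (m : ℕ) : ∀ s : CA, cut shL psiShLetter p s (EOnes m)
    = ∑ i ∈ antidiagonal m, sh (p * fS i.1) (s * ((-1 : ℚ) ^ i.2 • fS i.2)) := by
  induction m using Nat.strong_induction_on with
  | _ m ih =>
  intro s
  rcases m with _ | m
  · simp [EOnes_zero, cut_one, fS_zero, shL_apply]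
  have h1 : ∀ i ∈ antidiagonal m, cut shL psiShLetter p s (EOnes i.1 * g 1 * hb ^ i.2)
      = ∑ j ∈ antidiagonal i.1, sh (p * fS j.1)
          (s * (-(hb ^ i.2 * (g 1 + hb) * ((-1 : ℚ) ^ j.2 • fS j.2))))
        + ((i.2 : ℚ) + 1) • (sh (p * fS (i.1 + 1)) s * hb ^ i.2) := by
    intro i hi
    rw [mem_antidiagonal] at hi
    rw [g, cut_mul_letter_mul, antiLift_pow, hb, antiLift_letter, ih _ (by omega),
      psiShLetter_g_one]
    congr 1
    · refine Finset.sum_congr rfl fun j _ => ?_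
      change sh (p * fS j.1) (s * hb ^ i.2 * -(g 1 + hb) * _) = _
      congr 1
      rw [mul_assoc s, CA_mul_neg, mul_assoc s, CA_neg_mul]; rfl
    · have := cut_sh_hb_pow (p * fS (i.1 + 1)) s i.2
      rw [fS_succ_eq, ← mul_assoc] at this
      rw [fS_succ_eq, ← mul_assoc]
      exact this
  have h2 : ∀ l, (-1 : ℚ) ^ l • fS l = (l.factorial : ℚ)⁻¹ • hb ^ l
      + (if l = 0 then 0 else ∑ p ∈ antidiagonal (l - 1),
      ((p.1 + 1).factorial : ℚ)⁻¹ • (-(hb ^ p.1 * (g 1 + hb) * ((-1 : ℚ) ^ p.2 • fS p.2)))) := by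
    intro l
    rcases l with _ | l
    · simp [fS_zero]
    · rw [neg_one_pow_smul_fS, if_neg (by omega), sub_eq_add_neg, ← Finset.sum_neg_distrib]
      simp only [smul_neg]
      rfl
  have h3 : ∑ i ∈ antidiagonal (m + 1), sh (p * fS i.1) (s * ((i.2.factorial : ℚ)⁻¹ • hb ^ i.2))
      = ((m + 2).factorial : ℚ)⁻¹ • ((((m + 1 : ℕ) : ℚ) + 1) • (sh p s * hb ^ (m + 1)))
        + ∑ i ∈ antidiagonal m, ((i.2 + 1).factorial : ℚ)⁻¹ •
          ((i.2 : ℚ) + 1) • (sh (p * fS (i.1 + 1)) s * hb ^ i.2) := by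
    rw [Finset.Nat.sum_antidiagonal_succ]
    simp only [mul_smul_comm, sh_rat_smul_right, sh_mul_hb_pow_right, fS_zero, mul_one, smul_smul,
      mul_comm _ ((_ : ℚ) + 1), factorial_inv_succ]
  have h4 : ∑ i ∈ antidiagonal (m + 1), sh (p * fS i.1) (s * (if i.2 = 0 then 0 else
      ∑ p ∈ antidiagonal (i.2 - 1), ((p.1 + 1).factorial : ℚ)⁻¹ •
        (-(hb ^ p.1 * (g 1 + hb) * ((-1 : ℚ) ^ p.2 • fS p.2)))))
      = ∑ i ∈ antidiagonal m, ((i.2 + 1).factorial : ℚ)⁻¹ • ∑ j ∈ antidiagonal i.1,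
        sh (p * fS j.1) (s * (-(hb ^ i.2 * (g 1 + hb) * ((-1 : ℚ) ^ j.2 • fS j.2)))) := by
    simp only [Finset.smul_sum]
    rw [sum_antidiagonal_antidiagonal m fun a b n => ((n + 1).factorial : ℚ)⁻¹ •
      sh (p * fS a) (s * (-(hb ^ n * (g 1 + hb) * ((-1 : ℚ) ^ b • fS b)))),
      Finset.Nat.sum_antidiagonal_succ', if_pos rfl, mul_zero, ← shL_apply, map_zero, zero_add]
    refine Finset.sum_congr rfl fun i _ => ?_
    rw [if_neg (Nat.succ_ne_zero _), Finset.mul_sum, sh_sum_right]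
    refine Finset.sum_congr rfl fun j _ => ?_
    rw [mul_smul_comm, sh_rat_smul_right]
  rw [EOnes_eq_add, map_add, cut_rat_smul, cut_sh_hb_pow, map_sum]
  simp only [cut_rat_smul]
  rw [Finset.sum_congr rfl fun i hi => by rw [h1 i hi]]
  simp only [smul_add]
  rw [Finset.sum_add_distrib]
  conv_rhs => enter [2, i]; rw [h2 i.2, mul_add, ← shL_apply, map_add, shL_apply, shL_apply]
  rw [Finset.sum_add_distrib, h3, h4]
  abel

/-! ### Alternating harmonic products of powers of `g₁` -/

theorem har_mul_g_one_sub_mem_left (w : CA) {y : CA} (hy : y ∈ admH0) :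
    har (w * g 1) y - har w y * g 1 ∈ admH0 := by
  refine map_mem_of_mem_admH0
    (har (w * g 1) - (LinearMap.mulRight Coef (g 1)).comp (har w)) ?_ (fun y k hk => ?_) hy
  · simp [har_one_right]
  · simp only [LinearMap.sub_apply, LinearMap.comp_apply, LinearMap.mulRight_apply]
    rw [har_mul_g_mul_g, add_assoc, add_sub_cancel_left]
    exact add_mem (mul_g_mem_admH0 _ hk) (mul_g_mem_admH0 _ (hk.trans (PNat.lt_add_left k 1).le))

theorem har_mul_g_one_sub_mem_right (w : CA) {y : CA} (hy : y ∈ admH0) :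
    har y (w * g 1) - har y w * g 1 ∈ admH0 := by
  refine map_mem_of_mem_admH0
    (har.flip (w * g 1) - (LinearMap.mulRight Coef (g 1)).comp (har.flip w)) ?_
    (fun y k hk => ?_) hy
  · simp [har_one_left]
  · simp only [LinearMap.sub_apply, LinearMap.comp_apply, LinearMap.mulRight_apply,
      LinearMap.flip_apply]
    rw [har_mul_g_mul_g, add_right_comm, add_sub_cancel_right]
    exact add_mem (mul_g_mem_admH0 _ hk) (mul_g_mem_admH0 _ (hk.trans (PNat.lt_add_right k 1).le))

/-- The alternating sums of harmonic products with powers of `g₁` contain no words that end in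
`g₁`, although their summands do. -/
theorem sum_har_g_one_pow_mem_admH0 {y y' : CA} (hy : y ∈ admH0) (hy' : y' ∈ admH0) (m : ℕ) :
    ∑ i ∈ antidiagonal m, (-1 : ℚ) ^ i.2 • har (y * g 1 ^ i.1) (y' * g 1 ^ i.2) ∈ admH0 := by
  let A : ℕ → ℕ → CA := fun i l => har (y * g 1 ^ i) (y' * g 1 ^ l)
  let B : ℕ → ℕ → CA := fun i l =>
    (if i = 0 then 0 else A (i - 1) l) + (if l = 0 then 0 else A i (l - 1))
  have hsmul : ∀ (c : ℚ) {x : CA}, x ∈ admH0 → c • x ∈ admH0 := by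
    intro c x hx
    rw [← algebraMap_smul Coef c x]
    exact Submodule.smul_mem _ _ hx
  have hAB : ∀ i l, A i l - B i l * g 1 ∈ admH0 := by
    intro i l
    rcases i with _ | i <;> rcases l with _ | l
    · simpa [A, B] using har_mem_admH0 hy hy'
    · simpa [A, B, pow_succ, ← mul_assoc] using har_mul_g_one_sub_mem_right (y' * g 1 ^ l) hy
    · simpa [A, B, pow_succ, ← mul_assoc] using har_mul_g_one_sub_mem_left (y * g 1 ^ i) hy'
    · have h : A (i + 1) (l + 1) - B (i + 1) (l + 1) * g 1 = A i l * g (1 + 1) := by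
        simp only [A, B, pow_succ, ← mul_assoc, Nat.succ_ne_zero, if_false, Nat.add_sub_cancel]
        rw [har_mul_g_mul_g, add_mul, add_sub_cancel_left]
      rw [h]
      exact mul_g_mem_admH0 _ le_rfl
  have hB : ∑ i ∈ antidiagonal m, (-1 : ℚ) ^ i.2 • B i.1 i.2 = 0 := by
    simp only [B, smul_add]
    rw [Finset.sum_add_distrib]
    rcases m with _ | m
    · simp
    · rw [Finset.Nat.sum_antidiagonal_succ, Finset.Nat.sum_antidiagonal_succ']
      simp [pow_succ]
  have hsum : ∑ i ∈ antidiagonal m, (-1 : ℚ) ^ i.2 • A i.1 i.2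
      = ∑ i ∈ antidiagonal m, (-1 : ℚ) ^ i.2 • (A i.1 i.2 - B i.1 i.2 * g 1)
        + (∑ i ∈ antidiagonal m, (-1 : ℚ) ^ i.2 • B i.1 i.2) * g 1 := by
    rw [Finset.sum_mul, ← Finset.sum_add_distrib]
    refine Finset.sum_congr rfl fun i _ => ?_
    rw [smul_mul_assoc, ← smul_add, sub_add_cancel]
  change ∑ i ∈ antidiagonal m, (-1 : ℚ) ^ i.2 • A i.1 i.2 ∈ admH0
  rw [hsum, hB, zero_mul, add_zero]
  exact Submodule.sum_mem _ fun i _ => hsmul _ (hAB _ _)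

theorem cut_star_g_one_pow (p s : CA) (m : ℕ) : cut har psiStarLetter p s (g 1 ^ m)
    = ∑ i ∈ antidiagonal m, (-1 : ℚ) ^ i.2 • har (p * g 1 ^ i.1) (s * g 1 ^ i.2) := by
  rw [g, cut_letter_pow]
  refine Finset.sum_congr rfl fun i _ => ?_
  have h1 : psiStarLetter (Letter.g 1) = (-1 : ℚ) • FreeAlgebra.ι Coef (Letter.g 1) := by
    rw [← algebraMap_smul Coef (-1 : ℚ), map_neg, map_one, psiStarLetter, PNat.one_coe, pow_one]
    rfl
  rw [h1, smul_pow, mul_smul_comm]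
  exact map_rat_smul (har _) _ _

/-! ### Comparison of the two kinds of powers of `g₁` -/

/-- The part of the harmonic product of `y g₁^a` and `ħb v` in which `ħb` is to the right of `y` and
does not meet another letter. -/
def hbShift (y : CA) (a : ℕ) (v : CA) : CA :=
  ∑ i ∈ antidiagonal a, y * g 1 ^ i.1 * hb * har (g 1 ^ i.2) v

theorem hbShift_zero (y v : CA) : hbShift y 0 v = y * hb * v := by
  simp [hbShift, har_one_left]

theorem hbShift_one (y : CA) (a : ℕ) :
    hbShift y (a + 1) 1 = hbShift y a 1 * g 1 + y * g 1 ^ (a + 1) * hb := by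
  rw [hbShift, Finset.Nat.sum_antidiagonal_succ', hbShift, Finset.sum_mul, add_comm]
  simp [har_one_right, pow_succ, mul_assoc]

theorem hbShift_mul_letter (y : CA) (a : ℕ) (v : CA) (z : Letter) :
    hbShift y (a + 1) (v * FreeAlgebra.ι Coef z)
      = hbShift y a (v * FreeAlgebra.ι Coef z) * g 1 + hbShift y (a + 1) v * FreeAlgebra.ι Coef z
        + hbShift y a v * circ (Letter.g 1) z := by
  simp only [hbShift]
  rw [Finset.Nat.sum_antidiagonal_succ', Finset.Nat.sum_antidiagonal_succ' (n := a)]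
  simp only [pow_zero, har_one_left, Finset.sum_mul, add_mul, pow_succ _ (_ : ℕ)]
  have h : ∀ i : ℕ × ℕ, y * g 1 ^ i.1 * hb * har (g 1 ^ i.2 * g 1) (v * FreeAlgebra.ι Coef z)
      = y * g 1 ^ i.1 * hb * har (g 1 ^ i.2) (v * FreeAlgebra.ι Coef z) * g 1
        + y * g 1 ^ i.1 * hb * har (g 1 ^ i.2 * g 1) v * FreeAlgebra.ι Coef z
        + y * g 1 ^ i.1 * hb * har (g 1 ^ i.2) v * circ (Letter.g 1) z := by
    intro i
    rw [show g 1 = FreeAlgebra.ι Coef (Letter.g 1) from rfl, har_mul_mul]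
    simp only [mul_add, mul_assoc]
  simp only [h, Finset.sum_add_distrib]
  simp only [mul_assoc]
  abel

theorem har_mul_g_hb (w v : CA) (k : ℕ+) : har (w * g k) (v * hb)
    = har w (v * hb) * g k + har (w * g k) v * hb + har w v * circ (Letter.g k) Letter.hb :=
  har_mul_mul w v (Letter.g k) Letter.hb

theorem har_mul_g_letter (w v : CA) (k : ℕ+) (z : Letter) :
    har (w * g k) (v * FreeAlgebra.ι Coef z) = har w (v * FreeAlgebra.ι Coef z) * g k
      + har (w * g k) v * FreeAlgebra.ι Coef z + har w v * circ (Letter.g k) z :=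
  har_mul_mul w v (Letter.g k) z

theorem hbIdeal_mul_circ {x : CA} (hx : x ∈ hbIdeal) {k : ℕ+} (hk : 2 ≤ k) (z : Letter) :
    x * circ (Letter.g k) z ∈ hbgIdeal := by
  cases z with
  | hb => exact mul_circ_hb_mem_monIdeal _ _
  | g l => exact hbIdeal_mul_g hx (hk.trans (PNat.lt_add_right k l).le)

theorem hb_mul_mem_hbIdeal (v : CA) : hb * v ∈ hbIdeal := hbIdeal_mul_right hb_mem_hbIdeal v

/-- Modulo the ideal in which `𝔫` is cut out, a letter `ħb` cannot move to the left of `y`, and its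
products with other letters vanish. -/
theorem har_hb_mul_sub_mem {y : CA} (hy : y ∈ admH0) (v : CA) (a : ℕ) :
    har (y * g 1 ^ a) (hb * v) - hbShift y a v ∈ hbgIdeal := by
  have hw : ∀ (v : List Letter) (a : ℕ) (y : CA), y ∈ admH0 →
      har (y * g 1 ^ a) (hb * word v) - hbShift y a (word v) ∈ hbgIdeal := by
    intro v
    induction v using List.reverseRecOn with
    | nil =>
      intro a
      rw [show (word [] : CA) = 1 from rfl, mul_one]
      induction a with
      | zero =>
        intro y hy
        simp only [pow_zero, mul_one, hbShift_zero]
        refine map_mem_of_mem_admH0 (har.flip hb - LinearMap.mulRight Coef hb) ?_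
          (fun y k hk => ?_) hy
        · simp [har_one_left]
        · have h := har_mul_g_hb y 1 k
          rw [one_mul, har_one_right, har_one_right] at h
          rw [LinearMap.sub_apply, LinearMap.flip_apply, LinearMap.mulRight_apply, h,
            add_right_comm, add_sub_cancel_right]
          exact add_mem (hbIdeal_mul_g (har_mem_hbIdeal _ hb_mem_hbIdeal) hk)
            (mul_circ_hb_mem_monIdeal _ _)
      | succ a ih =>
        intro y hy
        have h := har_mul_g_hb (y * g 1 ^ a) 1 1
        rw [one_mul, har_one_right, har_one_right] at h
        have h2 : har (y * g 1 ^ (a + 1)) hb - hbShift y (a + 1) 1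
            = (har (y * g 1 ^ a) hb - hbShift y a 1) * g 1
              + y * g 1 ^ a * circ (Letter.g 1) Letter.hb := by
          rw [hbShift_one, pow_succ, ← mul_assoc, h, sub_mul]
          abel
        rw [h2]
        exact add_mem (hbgIdeal_mul_right (ih y hy) _) (mul_circ_hb_mem_monIdeal _ _)
    | append_singleton v z ihv =>
      intro a
      rw [← word_mul_letter]
      induction a with
      | zero =>
        intro y hy
        simp only [pow_zero, mul_one, hbShift_zero, ← mul_assoc]
        suffices h : (har.flip (hb * word v * FreeAlgebra.ι Coef z)
            - LinearMap.mulRight Coef (hb * word v * FreeAlgebra.ι Coef z)) y ∈ hbgIdeal by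
          simpa [mul_assoc] using h
        refine map_mem_of_mem_admH0 _ ?_ (fun y k hk => ?_) hy
        · simp [har_one_left]
        · have h := ihv 0 (y * g k) (mul_g_mem_admH0 _ hk)
          rw [hbShift_zero, pow_zero, mul_one] at h
          have h2 : (har.flip (hb * word v * FreeAlgebra.ι Coef z)
              - LinearMap.mulRight Coef (hb * word v * FreeAlgebra.ι Coef z)) (y * g k)
              = har y (hb * word v * FreeAlgebra.ι Coef z) * g k
                + (har (y * g k) (hb * word v) - y * g k * hb * word v) * FreeAlgebra.ι Coef z
                + har y (hb * word v) * circ (Letter.g k) z := by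
            rw [LinearMap.sub_apply, LinearMap.flip_apply, LinearMap.mulRight_apply,
              har_mul_g_letter, sub_mul]
            simp only [mul_assoc]
            abel
          rw [h2]
          refine add_mem (add_mem (hbIdeal_mul_g (har_mem_hbIdeal _ ?_) hk)
            (hbgIdeal_mul_right h _)) (hbIdeal_mul_circ (har_mem_hbIdeal _ ?_) hk z)
          · rw [mul_assoc]; exact hb_mul_mem_hbIdeal _
          · exact hb_mul_mem_hbIdeal _
      | succ a ih =>
        intro y hy
        have h2 : har (y * g 1 ^ (a + 1)) (hb * (word v * FreeAlgebra.ι Coef z))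
              - hbShift y (a + 1) (word v * FreeAlgebra.ι Coef z)
            = (har (y * g 1 ^ a) (hb * (word v * FreeAlgebra.ι Coef z))
                - hbShift y a (word v * FreeAlgebra.ι Coef z)) * g 1
              + (har (y * g 1 ^ (a + 1)) (hb * word v) - hbShift y (a + 1) (word v))
                * FreeAlgebra.ι Coef z
              + (har (y * g 1 ^ a) (hb * word v) - hbShift y a (word v))
                * circ (Letter.g 1) z := by
          rw [hbShift_mul_letter, pow_succ, ← mul_assoc, ← mul_assoc, har_mul_g_letter, sub_mul,
            sub_mul, sub_mul]
          abel
        rw [h2]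
        exact add_mem (add_mem (hbgIdeal_mul_right (ih y hy) _)
          (hbgIdeal_mul_right (ihv (a + 1) y hy) _)) (hbgIdeal_mul_right (ihv a y hy) _)
  let f : CA →ₗ[Coef] CA := ∑ i ∈ antidiagonal a,
    (LinearMap.mulLeft Coef (y * g 1 ^ i.1 * hb)).comp (har (g 1 ^ i.2))
  have hf : ∀ v, f v = hbShift y a v := fun v => by simp [f, hbShift, mul_assoc]
  have := map_mem_of_word ((har (y * g 1 ^ a)).comp (LinearMap.mulLeft Coef hb) - f)
    (fun u => by
      rw [LinearMap.sub_apply, hf]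
      exact hw u a y hy) v
  rwa [LinearMap.sub_apply, hf] at this

/-- The solution `v` of the equations `∑_{d+b=n} g₁^d ∗ v_b = w_n`. -/
def harSolve (w : ℕ → CA) : ℕ → CA
  | n => w n - ∑ b : Fin n, har (g 1 ^ (n - (b : ℕ))) (harSolve w b)
  termination_by n => n
  decreasing_by exact b.2

theorem sum_har_harSolve (w : ℕ → CA) (n : ℕ) :
    ∑ i ∈ antidiagonal n, har (g 1 ^ i.1) (harSolve w i.2) = w n := by
  rw [← Finset.Nat.sum_antidiagonal_swap, Finset.Nat.sum_antidiagonal_eq_sum_range_succ_mk,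
    Finset.sum_range_succ]
  simp only [Prod.fst_swap, Prod.snd_swap, Nat.sub_self, pow_zero, har_one_left]
  rw [harSolve, Finset.sum_range]
  abel

theorem hatH0_mul_g_mul (x : CA) (k : ℕ+) {z : CA} (hz : z ∈ hatH0) : x * g k * z ∈ hatH0 := by
  refine map_mem_of_mem_hatH0 (LinearMap.mulLeft Coef (x * g k)) ?_ (fun y l => ?_) hz
  · rw [LinearMap.mulLeft_apply, mul_one]; exact mul_g_mem_hatH0 _ _
  · rw [LinearMap.mulLeft_apply, ← mul_assoc]; exact mul_g_mem_hatH0 _ _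

theorem admH0_mul_mem_hatH0 {y z : CA} (hy : y ∈ admH0) (hz : z ∈ hatH0) : y * z ∈ hatH0 := by
  refine map_mem_of_mem_admH0 (LinearMap.mulRight Coef z) ?_ (fun y k _ => ?_) hy
  · rw [LinearMap.mulRight_apply, one_mul]; exact hz
  · exact hatH0_mul_g_mul _ _ hz

theorem rat_smul_mem {S : Submodule Coef CA} (c : ℚ) {x : CA} (hx : x ∈ S) : c • x ∈ S := by
  rw [← algebraMap_smul Coef c x]
  exact Submodule.smul_mem _ _ hx

theorem g_one_pow_mem_hatH0 (n : ℕ) : g 1 ^ n ∈ hatH0 := by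
  rcases n with _ | n
  · rw [pow_zero]; exact one_mem_hatH0
  · rw [pow_succ]; exact mul_g_mem_hatH0 _ _

theorem fS_mem_hatH0 (n : ℕ) : fS n ∈ hatH0 := by
  rcases n with _ | n
  · rw [fS_zero]; exact one_mem_hatH0
  · rw [fS_succ_eq]; exact mul_g_mem_hatH0 _ _

/-- The part of `f_n` that starts with `ħb`, without that letter:
`f_{m+1} = g₁ f_m + ħb w_{m+1}`. -/
def fTail : ℕ → CA
  | 0 => 0
  | 1 => 0
  | m + 2 => ∑ p ∈ antidiagonal m,
      ((p.1 + 2).factorial : ℚ)⁻¹ • (hb ^ p.1 * g 1 * fS p.2)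

/-- The span of the words that end in some `gₖ`. -/
def hatAug : Submodule Coef CA := ⨆ k : ℕ+, LinearMap.range (LinearMap.mulRight Coef (g k))

theorem mul_g_mem_hatAug (x : CA) (k : ℕ+) : x * g k ∈ hatAug :=
  Submodule.mem_iSup_of_mem k ⟨x, rfl⟩

theorem map_mem_of_mem_hatAug {S : Submodule Coef CA} (f : CA →ₗ[Coef] CA)
    (h : ∀ x k, f (x * g k) ∈ S) {x : CA} (hx : x ∈ hatAug) : f x ∈ S := by
  refine (iSup_le fun k => ?_ : hatAug ≤ S.comap f) hx
  rintro _ ⟨y, rfl⟩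
  exact h y k

theorem har_g_one_pow_mem_hatAug (n : ℕ) {x : CA} (hx : x ∈ hatAug) :
    har (g 1 ^ n) x ∈ hatAug := by
  rcases n with _ | n
  · rwa [pow_zero, har_one_left]
  · refine map_mem_of_mem_hatAug (har (g 1 ^ (n + 1))) (fun y k => ?_) hx
    rw [pow_succ, har_mul_g_mul_g]
    exact add_mem (add_mem (mul_g_mem_hatAug _ _) (mul_g_mem_hatAug _ _)) (mul_g_mem_hatAug _ _)

theorem fTail_mem_hatAug (n : ℕ) : fTail n ∈ hatAug := by
  rcases n with _ | _ | n
  · exact zero_mem _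
  · exact zero_mem _
  · refine Submodule.sum_mem _ fun p _ => rat_smul_mem _ ?_
    refine map_mem_of_mem_hatH0 (LinearMap.mulLeft Coef (hb ^ p.1 * g 1)) ?_ (fun y l => ?_)
      (fS_mem_hatH0 p.2)
    · rw [LinearMap.mulLeft_apply, mul_one]; exact mul_g_mem_hatAug _ _
    · rw [LinearMap.mulLeft_apply, ← mul_assoc]; exact mul_g_mem_hatAug _ _

theorem fS_succ_eq_fTail (m : ℕ) : fS (m + 1) = g 1 * fS m + hb * fTail (m + 1) := by
  rw [fS_succ']
  rcases m with _ | m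
  · simp [fTail]
  · rw [Finset.Nat.sum_antidiagonal_succ, fTail, Finset.mul_sum]
    simp [pow_succ', mul_assoc]

theorem fS_eq_sum_fTail (m : ℕ) : fS m
    = g 1 ^ m + ∑ i ∈ antidiagonal m, g 1 ^ i.1 * hb * fTail i.2 := by
  induction m with
  | zero => simp [fS_zero, fTail]
  | succ m ih =>
    rw [fS_succ_eq_fTail, Finset.Nat.sum_antidiagonal_succ, ih, mul_add, Finset.mul_sum]
    simp only [pow_succ', pow_zero, one_mul, mul_assoc]
    abel

/-- The coefficients of the series `γ = 1 + ħb v` that compares the shuffle powers of `g₁` with the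
powers of `g₁`: modulo `𝔫`, `y F = (y / (1 - X g₁)) ∗ γ` for all `y` in `admH0`. -/
def gam (b : ℕ) : CA := (if b = 0 then 1 else 0) + hb * harSolve fTail b

theorem harSolve_mem_hatAug {w : ℕ → CA} (hw : ∀ n, w n ∈ hatAug) (n : ℕ) :
    harSolve w n ∈ hatAug := by
  induction n using Nat.strong_induction_on with
  | _ n ih =>
  rw [harSolve]
  exact sub_mem (hw n) (Submodule.sum_mem _ fun b _ => har_g_one_pow_mem_hatAug _ (ih b b.2))

theorem gam_mem_hatH0 (b : ℕ) : gam b ∈ hatH0 := by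
  refine add_mem ?_ (map_mem_of_mem_hatAug (LinearMap.mulLeft Coef hb) (fun x k => ?_)
    (harSolve_mem_hatAug fTail_mem_hatAug b))
  · split_ifs
    · exact one_mem_hatH0
    · exact zero_mem _
  · rw [LinearMap.mulLeft_apply, ← mul_assoc]; exact mul_g_mem_hatH0 _ _

theorem gam_zero : gam 0 = 1 := by
  rw [gam, if_pos rfl, harSolve]
  simp [fTail]

theorem mul_fS_sub_mem_nn {y : CA} (hy : y ∈ admH0) (m : ℕ) :
    y * fS m - ∑ i ∈ antidiagonal m, har (y * g 1 ^ i.1) (gam i.2) ∈ nn := by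
  rw [mem_nn_iff]
  constructor
  · have h1 : y * fS m = y * g 1 ^ m
        + ∑ i ∈ antidiagonal m, hbShift y i.1 (harSolve fTail i.2) := by
      simp only [hbShift]
      rw [sum_antidiagonal_antidiagonal m fun a b n =>
        y * g 1 ^ a * hb * har (g 1 ^ b) (harSolve fTail n), fS_eq_sum_fTail, mul_add,
        Finset.mul_sum]
      congr 1
      refine Finset.sum_congr rfl fun i _ => ?_
      rw [← Finset.mul_sum, ← sum_har_harSolve fTail i.2, ← Finset.Nat.sum_antidiagonal_swap]
      simp [mul_assoc]
    have h2 : ∑ i ∈ antidiagonal m, har (y * g 1 ^ i.1) (gam i.2) = y * g 1 ^ m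
        + ∑ i ∈ antidiagonal m, har (y * g 1 ^ i.1) (hb * harSolve fTail i.2) := by
      simp only [gam, map_add]
      rw [Finset.sum_add_distrib]
      congr 1
      rw [Finset.sum_eq_single (m, 0)]
      · simp [har_one_right]
      · rintro ⟨i, j⟩ hij hne
        rw [mem_antidiagonal] at hij
        rw [if_neg, map_zero]
        rintro rfl
        simp at hij
        exact hne (by rw [hij])
      · intro h; exact absurd (mem_antidiagonal.2 (by simp)) h
    rw [h1, h2, add_sub_add_left_eq_sub, ← Finset.sum_sub_distrib]
    refine Submodule.sum_mem _ fun i _ => ?_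
    rw [← neg_sub]
    exact neg_mem (har_hb_mul_sub_mem hy _ _)
  · exact sub_mem (admH0_mul_mem_hatH0 hy (fS_mem_hatH0 m)) (Submodule.sum_mem _ fun i _ =>
      har_mem_hatH0 (admH0_mul_mem_hatH0 hy (g_one_pow_mem_hatH0 _)) (gam_mem_hatH0 _))

/-! ### Generating series of values -/

theorem Zq_rat_smul {q : ℂ} (hq : ‖q‖ < 1) (c : ℚ) {x : CA} (hx : x ∈ hatH0) :
    Zq q (c • x) = c * Zq q x := by
  rw [← algebraMap_smul Coef c x, Zq_smul hq _ hx]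
  simp [evalHbar]

theorem Zq_sum {q : ℂ} (hq : ‖q‖ < 1) {ι : Type} (s : Finset ι) (x : ι → CA)
    (hx : ∀ i ∈ s, x i ∈ hatH0) : Zq q (∑ i ∈ s, x i) = ∑ i ∈ s, Zq q (x i) := by
  refine Tendsto.limUnder_eq ?_
  simpa only [map_sum] using tendsto_finsetSum s fun i hi => tendsto_Zq hq (hx i hi)

theorem Zq_sub {q : ℂ} (hq : ‖q‖ < 1) {x y : CA} (hx : x ∈ hatH0) (hy : y ∈ hatH0) :
    Zq q (x - y) = Zq q x - Zq q y := by
  refine Tendsto.limUnder_eq ?_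
  simpa only [map_sub] using (tendsto_Zq hq hx).sub (tendsto_Zq hq hy)

theorem Zq_sh {q : ℂ} (hq : ‖q‖ < 1) {x y : CA} (hx : x ∈ hatH0) (hy : y ∈ hatH0) :
    Zq q (sh x y) = Zq q x * Zq q y :=
  (tendsto_ZqM_sh hq hx hy).limUnder_eq

/-- The power series all of whose coefficients lie in `S`. -/
def serIn (S : Submodule ℚ ℂ) : Set (PowerSeries ℂ) := {f | ∀ n, PowerSeries.coeff n f ∈ S}

theorem serIn_mul {S T U : Submodule ℚ ℂ} (h : ∀ x ∈ S, ∀ y ∈ T, x * y ∈ U)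
    {f f' : PowerSeries ℂ} (hf : f ∈ serIn S) (hf' : f' ∈ serIn T) : f * f' ∈ serIn U := by
  intro n
  rw [PowerSeries.coeff_mul]
  exact Submodule.sum_mem _ fun p _ => h _ (hf _) _ (hf' _)

theorem serIn_add {S : Submodule ℚ ℂ} {f f' : PowerSeries ℂ} (hf : f ∈ serIn S)
    (hf' : f' ∈ serIn S) : f + f' ∈ serIn S := fun n => by
  rw [map_add]; exact add_mem (hf n) (hf' n)

theorem serIn_mono {S T : Submodule ℚ ℂ} (h : S ≤ T) {f : PowerSeries ℂ} (hf : f ∈ serIn S) :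
    f ∈ serIn T := fun n => h (hf n)

/-- The substitution `X ↦ -X`. -/
abbrev negX : PowerSeries ℂ →+* PowerSeries ℂ := PowerSeries.rescale (-1)

theorem neg_one_pow_mul_mem {S : Submodule ℚ ℂ} {x : ℂ} (hx : x ∈ S) (n : ℕ) :
    (-1) ^ n * x ∈ S := by
  rcases neg_one_pow_eq_or ℂ n with h | h <;> rw [h]
  · rwa [one_mul]
  · rw [neg_one_mul]; exact neg_mem hx

theorem serIn_negX {S : Submodule ℚ ℂ} {f : PowerSeries ℂ} (hf : f ∈ serIn S) :
    negX f ∈ serIn S := fun n => by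
  rw [PowerSeries.coeff_rescale]; exact neg_one_pow_mul_mem (hf n) n

open PowerSeries in
theorem derivative_negX (f : PowerSeries ℂ) : d⁄dX ℂ (negX f) = -negX (d⁄dX ℂ f) := by
  ext n
  rw [map_neg, coeff_derivative, coeff_rescale, coeff_rescale, coeff_derivative]
  ring

/-- The generating series of the values of a sequence in `Ĥ⁰`. -/
def serZ (q : ℂ) (u : ℕ → CA) : PowerSeries ℂ := PowerSeries.mk fun n => Zq q (u n)

theorem coeff_serZ (q : ℂ) (u : ℕ → CA) (n : ℕ) :
    PowerSeries.coeff n (serZ q u) = Zq q (u n) := PowerSeries.coeff_mk _ _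

theorem serZ_mem {q : ℂ} (hq : ‖q‖ < 1) {u : ℕ → CA} (hu : ∀ n, u n ∈ hatH0) :
    serZ q u ∈ serIn (hatZ q hq) := fun n => by
  rw [coeff_serZ]; exact Zq_mem_hatZ hq (hu n)

/-- The series `R_y = ∑ Z_q(y g₁ⁿ) Xⁿ`. -/
def serStar (q : ℂ) (y : CA) : PowerSeries ℂ := serZ q fun n => y * g 1 ^ n

/-- The series `F_y = ∑ Z_q(y f_n) Xⁿ`. -/
def serSh (q : ℂ) (y : CA) : PowerSeries ℂ := serZ q fun n => y * fS n

theorem serStar_mem {q : ℂ} (hq : ‖q‖ < 1) {y : CA} (hy : y ∈ admH0) :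
    serStar q y ∈ serIn (hatZ q hq) :=
  serZ_mem hq fun n => admH0_mul_mem_hatH0 hy (g_one_pow_mem_hatH0 n)

theorem serSh_mem {q : ℂ} (hq : ‖q‖ < 1) {y : CA} (hy : y ∈ admH0) :
    serSh q y ∈ serIn (hatZ q hq) :=
  serZ_mem hq fun n => admH0_mul_mem_hatH0 hy (fS_mem_hatH0 n)

/-- `F_y ≡ R_y Γ` modulo `𝒩_q`. -/
theorem serSh_sub_mem {q : ℂ} (hq : ‖q‖ < 1) {y : CA} (hy : y ∈ admH0) :
    serSh q y - serStar q y * serZ q gam ∈ serIn (Nq q hq) := by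
  intro m
  have hmem : ∀ i ∈ antidiagonal m, har (y * g 1 ^ i.1) (gam i.2) ∈ hatH0 := fun i _ =>
    har_mem_hatH0 (admH0_mul_mem_hatH0 hy (g_one_pow_mem_hatH0 _)) (gam_mem_hatH0 _)
  have h := Zq_mem_Nq hq (mul_fS_sub_mem_nn hy m)
  rw [Zq_sub hq (admH0_mul_mem_hatH0 hy (fS_mem_hatH0 m)) (Submodule.sum_mem _ hmem),
    Zq_sum hq _ _ hmem] at h
  rw [map_sub, PowerSeries.coeff_mul, serSh, coeff_serZ]
  convert h using 3 with i hi
  rw [serStar, coeff_serZ, coeff_serZ, Zq_har hq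
    (admH0_mul_mem_hatH0 hy (g_one_pow_mem_hatH0 _)) (gam_mem_hatH0 _)]

/-- The product `R_y(X) R_{y'}(-X)` has coefficients in `𝒵_q`, although `R_y` need not. -/
theorem serStar_mul_negX_mem {q : ℂ} (hq : ‖q‖ < 1) {y y' : CA} (hy : y ∈ admH0)
    (hy' : y' ∈ admH0) : serStar q y * negX (serStar q y') ∈ serIn (ZqSpace q hq) := by
  intro m
  have hmem : ∀ i ∈ antidiagonal m, har (y * g 1 ^ i.1) (y' * g 1 ^ i.2) ∈ hatH0 := fun i _ =>
    har_mem_hatH0 (admH0_mul_mem_hatH0 hy (g_one_pow_mem_hatH0 _))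
      (admH0_mul_mem_hatH0 hy' (g_one_pow_mem_hatH0 _))
  have h := Zq_mem_ZqSpace hq (admH0_le_H0 (sum_har_g_one_pow_mem_admH0 hy hy' m))
  rw [Zq_sum hq _ _ fun i hi => rat_smul_mem _ (hmem i hi)] at h
  rw [PowerSeries.coeff_mul]
  convert h using 2 with i hi
  rw [Zq_rat_smul hq _ (hmem i hi), Zq_har hq (admH0_mul_mem_hatH0 hy (g_one_pow_mem_hatH0 _))
    (admH0_mul_mem_hatH0 hy' (g_one_pow_mem_hatH0 _)), PowerSeries.coeff_rescale, serStar, serStar,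
    coeff_serZ, coeff_serZ]
  push_cast
  ring

/-- The sum of the words with one letter `gₖ` and `m` letters `g₁`. -/
def gInsert (k : ℕ+) (m : ℕ) : CA := ∑ i ∈ antidiagonal m, g 1 ^ i.1 * g k * g 1 ^ i.2

theorem gInsert_succ (k : ℕ+) (m : ℕ) :
    gInsert k (m + 1) = gInsert k m * g 1 + g 1 ^ (m + 1) * g k := by
  rw [gInsert, Finset.Nat.sum_antidiagonal_succ', gInsert, Finset.sum_mul, add_comm]
  simp [pow_succ, mul_assoc]

theorem gInsert_mem_hatH0 (k : ℕ+) (m : ℕ) : gInsert k m ∈ hatH0 :=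
  Submodule.sum_mem _ fun _ _ => hatH0_mul_g_mul _ _ (g_one_pow_mem_hatH0 _)

theorem har_g_g_one_pow (k : ℕ+) (m : ℕ) :
    har (g k) (g 1 ^ (m + 1)) = gInsert k (m + 1) + gInsert (k + 1) m := by
  induction m with
  | zero =>
    have h := har_mul_g_mul_g 1 1 k 1
    simp only [one_mul, har_one_left, har_one_right] at h
    rw [pow_one, h, gInsert_succ]
    simp [gInsert, add_comm]
  | succ m ih =>
    have h := har_mul_g_mul_g 1 (g 1 ^ (m + 1)) k 1
    rw [one_mul, har_one_left, har_one_left, ih] at h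
    rw [pow_succ _ (m + 1), h, gInsert_succ k (m + 1), gInsert_succ (k + 1) m, pow_succ _ (m + 1),
      add_mul]
    abel

/-- Iterates `har_g_g_one_pow`, which trades an inserted `gₖ` for an inserted `gₖ₊₁`. -/
theorem Zq_gInsert {q : ℂ} (hq : ‖q‖ < 1) (m : ℕ) : ∀ k : ℕ, Zq q (gInsert k.succPNat m)
    = ∑ i ∈ antidiagonal m, (-1) ^ i.1 * Zq q (g (k + i.1).succPNat) * Zq q (g 1 ^ i.2) := by
  have hg : ∀ k, g k ∈ hatH0 := fun k => by simpa using mul_g_mem_hatH0 1 k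
  induction m with
  | zero => intro k; simp [gInsert, Zq_one]
  | succ m ih =>
    intro k
    have h : Zq q (g k.succPNat) * Zq q (g 1 ^ (m + 1))
        = Zq q (gInsert k.succPNat (m + 1)) + Zq q (gInsert (k + 1).succPNat m) := by
      rw [← Zq_har hq (hg _) (g_one_pow_mem_hatH0 _), har_g_g_one_pow,
        Zq_add hq (gInsert_mem_hatH0 _ _) (gInsert_mem_hatH0 _ _)]
      rfl
    rw [ih] at h
    rw [Finset.Nat.sum_antidiagonal_succ, eq_sub_of_add_eq h.symm, sub_eq_add_neg,
      ← Finset.sum_neg_distrib]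
    congr 1
    · simp
    · refine Finset.sum_congr rfl fun i _ => ?_
      rw [pow_succ, show k + (i.1 + 1) = k + 1 + i.1 by ring]
      ring

/-- Newton's identity `R' = R · ∑ (-1)ʲ Z_q(g_{j+1}) Xʲ` for the series `R = ∑ Z_q(g₁ⁿ) Xⁿ`. -/
theorem derivative_serStar_one {q : ℂ} (hq : ‖q‖ < 1) :
    PowerSeries.derivative ℂ (serStar q 1)
      = serStar q 1 * PowerSeries.mk fun j => (-1) ^ j * Zq q (g j.succPNat) := by
  ext m
  have h := Zq_gInsert hq m 0
  have h1 : gInsert (Nat.succPNat 0) m = ((m : ℚ) + 1) • g 1 ^ (m + 1) := by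
    rw [gInsert, Finset.sum_congr rfl (g := fun _ => g 1 ^ (m + 1)), Finset.sum_const,
      Finset.Nat.card_antidiagonal, ← Nat.cast_smul_eq_nsmul ℚ]
    · push_cast; rfl
    · intro i hi
      rw [mem_antidiagonal] at hi
      change g 1 ^ i.1 * g 1 * g 1 ^ i.2 = _
      rw [← pow_succ, ← pow_add, ← hi]
      congr 1
      omega
  rw [h1, Zq_rat_smul hq _ (g_one_pow_mem_hatH0 _)] at h
  rw [PowerSeries.coeff_derivative, mul_comm (serStar q 1), PowerSeries.coeff_mul, serStar,
    coeff_serZ, one_mul, mul_comm]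
  push_cast at h
  rw [h]
  refine Finset.sum_congr rfl fun i _ => ?_
  rw [PowerSeries.coeff_mk, coeff_serZ, zero_add, one_mul]

theorem constantCoeff_serStar_one (q : ℂ) : PowerSeries.constantCoeff (serStar q 1) = 1 := by
  rw [← PowerSeries.coeff_zero_eq_constantCoeff_apply, serStar, coeff_serZ]
  simp [Zq_one]

theorem coeff_zero_serStar_mul_negX (q : ℂ) :
    PowerSeries.coeff 0 (serStar q 1 * negX (serStar q 1)) = 1 := by
  rw [PowerSeries.coeff_zero_eq_constantCoeff_apply, map_mul, constantCoeff_serStar_one, one_mul,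
    ← PowerSeries.coeff_zero_eq_constantCoeff_apply, PowerSeries.coeff_rescale,
    PowerSeries.coeff_zero_eq_constantCoeff_apply, constantCoeff_serStar_one]
  simp

/-- The coefficients of `R(X) R(-X)`, other than the constant one, lie in `𝒫_q`, because the
logarithmic derivative of this series involves only the values `Z_q(g_{2k})`. -/
theorem coeff_serStar_mul_negX_mem_Pq {q : ℂ} (hq : ‖q‖ < 1) (n : ℕ) :
    PowerSeries.coeff (n + 1) (serStar q 1 * negX (serStar q 1)) ∈ Pq q hq := by
  let p : PowerSeries ℂ := PowerSeries.mk fun j => (-1) ^ j * Zq q (g j.succPNat)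
  have hU : PowerSeries.derivative ℂ (serStar q 1 * negX (serStar q 1))
      = serStar q 1 * negX (serStar q 1) * (p - negX p) := by
    rw [Derivation.leibniz, derivative_negX, derivative_serStar_one hq, smul_eq_mul, smul_eq_mul,
      map_mul]
    ring
  have h := congrArg (PowerSeries.coeff n) hU
  rw [PowerSeries.coeff_derivative, PowerSeries.coeff_mul n (_ * _)] at h
  have hn : ((n : ℚ) + 1) ≠ 0 := by positivity
  rw [← Submodule.smul_mem_iff _ hn, Rat.smul_def]
  push_cast
  rw [mul_comm, h]
  refine Submodule.sum_mem _ fun i _ => ?_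
  have hmem := serStar_mul_negX_mem hq one_mem_admH0 one_mem_admH0 i.1
  rw [map_sub, PowerSeries.coeff_rescale, PowerSeries.coeff_mk]
  rcases Nat.even_or_odd i.2 with he | ⟨k, hk⟩
  · rw [he.neg_one_pow, one_mul, one_mul, sub_self, mul_zero]
    exact zero_mem _
  · have h2 : i.2.succPNat = 2 * k.succPNat := by
      apply PNat.coe_injective
      rw [PNat.mul_coe, Nat.succPNat_coe, Nat.succPNat_coe, hk]
      change 2 * k + 1 + 1 = 2 * (k + 1)
      ring
    have h3 := Submodule.smul_mem _ (-2 : ℚ) (mul_Zq_g_mem_Pq hq hmem k.succPNat)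
    rw [Odd.neg_one_pow ⟨k, hk⟩, h2]
    convert h3 using 1
    rw [Rat.smul_def]
    push_cast
    ring

open PowerSeries in
/-- The series `F = ∑ Z_q(f_n) Xⁿ = exp(X Z_q(g₁))` satisfies `F(X) F(-X) = 1`. -/
theorem serSh_one_mul_negX {q : ℂ} (hq : ‖q‖ < 1) : serSh q 1 * negX (serSh q 1) = 1 := by
  have hg : g 1 ∈ hatH0 := by simpa using mul_g_mem_hatH0 1 1
  have h1 : d⁄dX ℂ (serSh q 1) = C (Zq q (g 1)) * serSh q 1 := by
    ext n
    have h := Zq_sh hq hg (fS_mem_hatH0 n)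
    rw [sh_g_one_fS, Zq_rat_smul hq _ (fS_mem_hatH0 _)] at h
    push_cast at h
    rw [coeff_derivative, coeff_C_mul, serSh, coeff_serZ, coeff_serZ, one_mul, one_mul, ← h]
    ring
  have h0 : constantCoeff (serSh q 1) = 1 := by
    rw [← coeff_zero_eq_constantCoeff_apply, serSh, coeff_serZ]
    simp [Zq_one, fS_zero]
  have hC : negX (C (Zq q (g 1))) = C (Zq q (g 1)) := by
    ext n
    rw [coeff_rescale, coeff_C]
    split_ifs with h
    · simp [h]
    · simp
  refine derivative.ext ?_ ?_
  · rw [Derivation.leibniz, derivative_negX, h1, map_mul, hC]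
    simp only [smul_eq_mul, derivative_one]
    ring
  · rw [map_mul, h0, one_mul, map_one, ← coeff_zero_eq_constantCoeff_apply, coeff_rescale,
      coeff_zero_eq_constantCoeff_apply, h0]
    simp

/-- The series `γ(X) γ(-X)` is congruent to its constant term `1` modulo `𝒩_q + 𝒫_q`. -/
theorem coeff_gam_mul_negX_mem {q : ℂ} (hq : ‖q‖ < 1) (n : ℕ) :
    PowerSeries.coeff n (serZ q gam * negX (serZ q gam) - 1) ∈ Nq q hq ⊔ Pq q hq := by
  set R := serStar q 1
  set G := serZ q gam
  set V := G * negX G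
  set U := R * negX R
  have hN : ∀ x ∈ hatZ q hq, ∀ y ∈ Nq q hq, x * y ∈ Nq q hq := fun x hx y hy =>
    hatZ_mul_mem_Nq hq hx hy
  have hZ : ∀ x ∈ hatZ q hq, ∀ y ∈ hatZ q hq, x * y ∈ hatZ q hq := fun x hx y hy =>
    hatZ_mul_mem hq hx hy
  have hG : G ∈ serIn (hatZ q hq) := serZ_mem hq gam_mem_hatH0
  have hR : R ∈ serIn (hatZ q hq) := serStar_mem hq one_mem_admH0
  have hUV : 1 - U * V ∈ serIn (Nq q hq) := by
    have h1 := serSh_sub_mem hq one_mem_admH0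
    have h2 : 1 - U * V = negX (serSh q 1) * (serSh q 1 - R * G)
        + (R * G) * negX (serSh q 1 - R * G) := by
      rw [← serSh_one_mul_negX hq, map_sub, map_mul]
      ring
    rw [h2]
    exact serIn_add (serIn_mul hN (serIn_negX (serSh_mem hq one_mem_admH0)) h1)
      (serIn_mul hN (serIn_mul hZ hR hG) (serIn_negX h1))
  have hV0 : PowerSeries.coeff 0 V = 1 := by
    rw [PowerSeries.coeff_mul, Finset.Nat.antidiagonal_zero, Finset.sum_singleton,
      PowerSeries.coeff_rescale, coeff_serZ, gam_zero, Zq_one]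
    simp
  have hU0 : PowerSeries.coeff 0 U = 1 := coeff_zero_serStar_mul_negX q
  induction n using Nat.strong_induction_on with
  | _ n ih =>
  rcases n with _ | n
  · rw [map_sub, hV0]
    simp
  · have h1 := hUV (n + 1)
    rw [map_sub, PowerSeries.coeff_one, if_neg (by omega), PowerSeries.coeff_mul,
      Finset.Nat.sum_antidiagonal_succ, hU0, one_mul, zero_sub] at h1
    have h2 : PowerSeries.coeff (n + 1) (V - 1)
        = -(-(PowerSeries.coeff (n + 1) V + ∑ i ∈ antidiagonal n,
            PowerSeries.coeff (i.1 + 1) U * PowerSeries.coeff i.2 V))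
          - ∑ i ∈ antidiagonal n, PowerSeries.coeff (i.1 + 1) U * PowerSeries.coeff i.2 V := by
      rw [map_sub, PowerSeries.coeff_one, if_neg (by omega)]
      ring
    rw [h2]
    refine sub_mem (neg_mem ((le_sup_left : Nq q hq ≤ _) h1)) (Submodule.sum_mem _ fun i hi => ?_)
    rw [mem_antidiagonal] at hi
    have hP := coeff_serStar_mul_negX_mem_Pq hq i.1
    have hV : PowerSeries.coeff i.2 V ∈ ZqSpace q hq := by
      have h3 := NqPq_le_ZqSpace hq (ih i.2 (by omega))
      rw [map_sub, PowerSeries.coeff_one] at h3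
      split_ifs at h3
      · simpa using add_mem h3 (one_mem_ZqSpace hq)
      · simpa using h3
    rw [mul_comm]
    exact ZqSpace_mul_mem_NqPq hq hV ((le_sup_right : Pq q hq ≤ _) hP)

/-- The products of the two kinds of generating series agree modulo `𝒩_q + 𝒫_q`. -/
theorem serSh_mul_negX_sub_mem {q : ℂ} (hq : ‖q‖ < 1) {y y' : CA} (hy : y ∈ admH0)
    (hy' : y' ∈ admH0) : serSh q y * negX (serSh q y') - serStar q y * negX (serStar q y')
      ∈ serIn (Nq q hq ⊔ Pq q hq) := by
  have hN : ∀ x ∈ hatZ q hq, ∀ y ∈ Nq q hq, x * y ∈ Nq q hq := fun x hx y hy =>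
    hatZ_mul_mem_Nq hq hx hy
  have hZ : ∀ x ∈ hatZ q hq, ∀ y ∈ hatZ q hq, x * y ∈ hatZ q hq := fun x hx y hy =>
    hatZ_mul_mem hq hx hy
  have hG : serZ q gam ∈ serIn (hatZ q hq) := serZ_mem hq gam_mem_hatH0
  have h1 := serSh_sub_mem hq hy
  have h2 := serSh_sub_mem hq hy'
  have h : serSh q y * negX (serSh q y') - serStar q y * negX (serStar q y')
      = (negX (serSh q y') * (serSh q y - serStar q y * serZ q gam)
        + serStar q y * serZ q gam * negX (serSh q y' - serStar q y' * serZ q gam))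
        + serStar q y * negX (serStar q y') * (serZ q gam * negX (serZ q gam) - 1) := by
    rw [map_sub, map_mul]
    ring
  rw [h]
  refine serIn_add (serIn_mono le_sup_left (serIn_add
    (serIn_mul hN (serIn_negX (serSh_mem hq hy')) h1)
    (serIn_mul hN (serIn_mul hZ (serStar_mem hq hy) hG) (serIn_negX h2)))) ?_
  exact serIn_mul (fun x hx y hy => ZqSpace_mul_mem_NqPq hq hx hy)
    (serStar_mul_negX_mem hq hy hy') (coeff_gam_mul_negX_mem hq)

/-! ### Congruences between the two kinds of words -/

theorem hatH0_mul_mem {x y : CA} (hx : x ∈ hatH0) (hy : y ∈ hatH0) : x * y ∈ hatH0 := by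
  refine map_mem_of_mem_hatH0 (LinearMap.mulLeft Coef x) ?_ (fun z k => ?_) hy
  · rwa [LinearMap.mulLeft_apply, mul_one]
  · rw [LinearMap.mulLeft_apply, ← mul_assoc]; exact mul_g_mem_hatH0 _ _

theorem admH0_le_hatH0 : admH0 ≤ hatH0 := admH0_le_H0.trans H0_le

theorem mul_sub_mul_mem_hbIdeal {x x' y y' : CA} (hx : x - x' ∈ hbIdeal) (hy : y - y' ∈ hbIdeal) :
    x * y - x' * y' ∈ hbIdeal := by
  rw [show x * y - x' * y' = (x - x') * y + x' * (y - y') by rw [sub_mul, mul_sub]; abel]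
  exact add_mem (hbIdeal_mul_right hx _) (hbIdeal_mul_left _ hy)

theorem fS_sub_mem_hbIdeal (m : ℕ) : fS m - g 1 ^ m ∈ hbIdeal := by
  rw [fS_eq_sum_fTail, add_sub_cancel_left]
  exact Submodule.sum_mem _ fun i _ =>
    hbIdeal_mul_right (hbIdeal_mul_left _ hb_mem_hbIdeal) _

theorem EOnes_sub_mem_hbIdeal (m : ℕ) : EOnes m - g 1 ^ m ∈ hbIdeal := by
  rcases m with _ | m
  · rw [EOnes_zero, pow_zero, sub_self]; exact zero_mem _
  rw [EOnes_eq, Finset.Nat.sum_antidiagonal_succ', pow_zero, mul_one, zero_add,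
    Nat.factorial_one, Nat.cast_one, inv_one, one_smul, add_sub_right_comm]
  exact add_mem (fS_sub_mem_hbIdeal _) (Submodule.sum_mem _ fun p _ => rat_smul_mem _
    (hbIdeal_mul_left _ (hb_pow_mem_hbIdeal (Nat.le_add_left 1 _))))

theorem e_of_two_le {k : ℕ+} (hk : 2 ≤ k) : e k = g k + hbar • g (k - 1) :=
  if_neg (ne_of_gt (lt_of_lt_of_le (by decide) hk))

/-- Modulo `ħ` and `ħb`, the element `E_𝐤` is `g_𝐤`. -/
theorem EAux_sub_mem_hbIdeal (l : List ℕ+) : ∀ m, EAux m l - g 1 ^ m * gIdx l ∈ hbIdeal := by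
  induction l with
  | nil => intro m; simpa [EAux, gIdx] using EOnes_sub_mem_hbIdeal m
  | cons k l ih =>
    intro m
    rw [EAux]
    split_ifs with hk
    · simpa [gIdx, hk, pow_succ, mul_assoc] using ih (m + 1)
    · have hk2 : 2 ≤ k := PNat.add_one_le_iff.2 (lt_of_le_of_ne (one_le (a := k)) (Ne.symm hk))
      have h := ih 0
      rw [pow_zero, one_mul] at h
      have he : e k - g k ∈ hbIdeal := by
        rw [e_of_two_le hk2, add_sub_cancel_left]; exact hbar_smul_mem_monIdeal _
      simpa [gIdx, mul_assoc] using
        mul_sub_mul_mem_hbIdeal (mul_sub_mul_mem_hbIdeal (EOnes_sub_mem_hbIdeal m) he) h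

theorem word_cons {X : Type} (x : X) (u : List X) :
    word (x :: u) = FreeAlgebra.ι Coef x * word u := by
  simp [word]

/-- The part of `(-1)^k ψ^sh(gₖ)` other than the multiple of `ħb`. -/
def psiShTail (k : ℕ+) : CA :=
  ∑ i ∈ Finset.range k, ((k : ℕ).choose (i + 1) : Coef) • hbar ^ ((k : ℕ) - (i + 1)) • g i.succPNat

theorem psiShLetter_g (k : ℕ+) : psiShLetter (Letter.g k)
    = (-1 : Coef) ^ (k : ℕ) • (hbar ^ ((k : ℕ) - 1) • hb + psiShTail k) := rfl

theorem psiShTail_sub_mem {P : List Letter → Prop} (k : ℕ+) : psiShTail k - g k ∈ monIdeal P := by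
  obtain ⟨j, rfl⟩ : ∃ j : ℕ, k = j.succPNat := ⟨k.natPred, by simp⟩
  rw [psiShTail, Nat.succPNat_coe, Finset.sum_range_succ, Nat.choose_self, Nat.sub_self, pow_zero,
    one_smul, Nat.cast_one, one_smul, add_sub_cancel_right]
  refine Submodule.sum_mem _ fun i hi => Submodule.smul_mem _ _ ?_
  obtain ⟨d, hd⟩ : ∃ d, j.succ - (i + 1) = d + 1 :=
    ⟨j - i - 1, by have := Finset.mem_range.1 hi; omega⟩
  rw [hd, pow_succ', mul_smul]
  exact hbar_smul_mem_monIdeal _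

theorem psiShLetter_sub_mem_hbIdeal (x : Letter) : psiShLetter x - psiStarLetter x ∈ hbIdeal := by
  cases x with
  | hb => rw [psiShLetter, psiStarLetter, sub_self]; exact zero_mem _
  | g k =>
    rw [psiShLetter_g, psiStarLetter, ← CA_smul_sub, add_sub_assoc]
    exact Submodule.smul_mem _ _ (add_mem (Submodule.smul_mem _ _ hb_mem_hbIdeal)
      (psiShTail_sub_mem k))

theorem antiLift_sub_mem_hbIdeal (w : CA) :
    antiLift psiShLetter w - antiLift psiStarLetter w ∈ hbIdeal := by
  refine map_mem_of_word (antiLift psiShLetter - antiLift psiStarLetter) (fun u => ?_) w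
  rw [LinearMap.sub_apply]
  induction u with
  | nil =>
    rw [show (word [] : CA) = 1 from rfl, antiLift_one, antiLift_one, sub_self]; exact zero_mem _
  | cons x u ih =>
    rw [word_cons, antiLift_mul, antiLift_mul, antiLift_letter, antiLift_letter]
    exact mul_sub_mul_mem_hbIdeal ih (psiShLetter_sub_mem_hbIdeal x)

theorem antiLift_psiStar_mem_hbIdeal {w : CA} (hw : w ∈ hbIdeal) :
    antiLift psiStarLetter w ∈ hbIdeal := by
  refine map_mem_of_mem_monIdeal (antiLift psiStarLetter) (fun u hu => ?_)
    (fun x => hbar_smul_mem_monIdeal _) hw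
  obtain ⟨u₁, u₂, rfl⟩ := List.append_of_mem hu
  rw [word_append, word_cons, antiLift_mul, antiLift_mul, antiLift_letter]
  exact hbIdeal_mul_right (hbIdeal_mul_left _ hb_mem_hbIdeal) _

/-- In `ψ^sh(eₖ)`, `k ≥ 2`, the two multiples of `ħb` cancel. -/
theorem psiSh_e_eq (k : ℕ+) :
    psiShLetter (Letter.g (k + 1)) + hbar • psiShLetter (Letter.g k)
      = (-1 : Coef) ^ ((k : ℕ) + 1) • (psiShTail (k + 1) - hbar • psiShTail k) := by
  obtain ⟨j, hj⟩ : ∃ j : ℕ, (k : ℕ) = j + 1 := ⟨k.natPred, by simp⟩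
  rw [psiShLetter_g, psiShLetter_g, PNat.add_coe, PNat.one_coe, hj]
  simp only [Nat.add_sub_cancel]
  rw [CA_smul_sub]
  refine eq_sub_of_add_eq ?_
  simp only [smul_add, smul_smul]
  set T := psiShTail (k + 1)
  set T' := psiShTail k
  have h1 : (-1 : Coef) ^ (j + 1 + 1) * hbar ^ (j + 1) + hbar * ((-1) ^ (j + 1) * hbar ^ j)
      = 0 := by
    ring
  have h2 : hbar * (-1) ^ (j + 1) + (-1 : Coef) ^ (j + 1 + 1) * hbar = 0 := by ring
  have h3 : ∀ a b c d f : Coef, a + c = 0 → d + f = 0 →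
      a • hb + b • T + (c • hb + d • T') + f • T' = b • T := by
    intro a b c d f hac hdf
    have : a • hb + b • T + (c • hb + d • T') + f • T' = (a + c) • hb + (d + f) • T' + b • T := by
      rw [add_smul, add_smul]; abel
    rw [this, hac, hdf, zero_smul, zero_smul, zero_add, zero_add]
  exact h3 _ _ _ _ _ h1 h2

/-- The relation between a prefix or suffix `x` on the shuffle side and the corresponding `y` on the
harmonic side. It implies `x z - y z ∈ 𝔫` for all `z ∈ Ĥ⁰`. -/
structure Comparable (x y : CA) : Prop where
  left_mem : x ∈ hatH0
  right_mem : y ∈ admH0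
  diff_mem : x - y ∈ hbgIdeal

theorem comparable_one : Comparable 1 1 :=
  ⟨one_mem_hatH0, one_mem_admH0, by rw [sub_self]; exact zero_mem _⟩

theorem Comparable.mul_sub_mem_nn {x y z : CA} (h : Comparable x y) (hz : z ∈ hatH0) :
    x * z - y * z ∈ nn := by
  rw [← sub_mul, mem_nn_iff]
  exact ⟨hbgIdeal_mul_right h.diff_mem _,
    hatH0_mul_mem (sub_mem h.left_mem (admH0_le_hatH0 h.right_mem)) hz⟩

theorem Comparable.mul_e {x y : CA} (h : Comparable x y) (m : ℕ) {k : ℕ+} (hk : 2 ≤ k) :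
    Comparable (x * EOnes m * e k) (y * g 1 ^ m * g k) := by
  refine ⟨?_, mul_g_mem_admH0 _ hk, ?_⟩
  · rw [e_of_two_le hk, mul_add, mul_smul_comm]
    exact add_mem (mul_g_mem_hatH0 _ _) (Submodule.smul_mem _ _ (mul_g_mem_hatH0 _ _))
  · have h1 : x * EOnes m * e k - y * g 1 ^ m * g k = (x - y) * (EOnes m * g k)
        + y * ((EOnes m - g 1 ^ m) * g k) + hbar • (x * EOnes m * g (k - 1)) := by
      rw [e_of_two_le hk, mul_add, mul_smul_comm]
      simp only [sub_mul, mul_sub, mul_assoc]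
      abel
    rw [h1]
    exact add_mem (add_mem (hbgIdeal_mul_right h.diff_mem _)
      (hbgIdeal_mul_left _ (hbIdeal_mul_g (EOnes_sub_mem_hbIdeal m) hk)))
      (hbar_smul_mem_monIdeal _)

/-- The suffixes produced by the anti-involutions `ψ^sh` and `ψ^∗` are comparable. -/
theorem comparable_psi (l : List ℕ+) {k : ℕ+} (hk : 2 ≤ k) : Comparable
    (antiLift psiShLetter (EAux 0 l)
      * (psiShLetter (Letter.g k) + hbar • psiShLetter (Letter.g (k - 1))))
    (antiLift psiStarLetter (gIdx l) * psiStarLetter (Letter.g k)) := by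
  obtain ⟨j, rfl⟩ : ∃ j : ℕ+, k = j + 1 :=
    ⟨k - 1, (PNat.sub_add_of_lt (lt_of_lt_of_le (by decide) hk)).symm⟩
  rw [show j + 1 - 1 = j from PNat.add_sub, psiSh_e_eq, psiStarLetter, mul_smul_comm,
    mul_smul_comm, PNat.add_coe, PNat.one_coe]
  have hl : antiLift psiShLetter (EAux 0 l) - antiLift psiStarLetter (gIdx l) ∈ hbIdeal := by
    have h := EAux_sub_mem_hbIdeal l 0
    rw [pow_zero, one_mul] at h
    have h2 := add_mem (antiLift_sub_mem_hbIdeal (EAux 0 l)) (antiLift_psiStar_mem_hbIdeal h)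
    rwa [map_sub, sub_add_sub_cancel] at h2
  set U := antiLift psiShLetter (EAux 0 l)
  set V := antiLift psiStarLetter (gIdx l)
  have hg : ∀ (x : CA) (i : ℕ+), x * psiShTail i ∈ hatH0 := fun x i => by
    rw [psiShTail, Finset.mul_sum]
    refine Submodule.sum_mem _ fun n _ => ?_
    rw [mul_smul_comm, mul_smul_comm]
    exact Submodule.smul_mem _ _ (Submodule.smul_mem _ _ (mul_g_mem_hatH0 _ _))
  refine ⟨Submodule.smul_mem _ _ ?_, Submodule.smul_mem _ _ (mul_g_mem_admH0 _ hk), ?_⟩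
  · rw [mul_sub, mul_smul_comm]
    exact sub_mem (hg _ _) (Submodule.smul_mem _ _ (hg _ _))
  · rw [← CA_smul_sub]
    refine Submodule.smul_mem _ _ ?_
    have h1 : U * (psiShTail (j + 1) - hbar • psiShTail j) - V * g (j + 1)
        = (U * (psiShTail (j + 1) - g (j + 1)) + (U - V) * g (j + 1))
          - hbar • (U * psiShTail j) := by
      rw [mul_sub, mul_sub, sub_mul, mul_smul_comm]
      abel
    rw [h1]
    exact sub_mem (add_mem (hbgIdeal_mul_left _ (psiShTail_sub_mem _)) (hbIdeal_mul_g hl hk))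
      (hbar_smul_mem_monIdeal _)

/-! ### Cutting words at a combination of letters -/

theorem cut_word (op : CA →ₗ[Coef] CA →ₗ[Coef] CA) (f : Letter → CA) (p s : CA)
    (u : List Letter) : cut op f p s (word u) = ∑ i ∈ Finset.range (u.length + 1),
      op (p * word (u.take i)) (s * antiLift f (word (u.drop i))) := by
  simp [cut, decon_word]

theorem cut_prefix_add_smul (op : CA →ₗ[Coef] CA →ₗ[Coef] CA) (f : Letter → CA) (p p' s : CA)
    (c : Coef) (w : CA) :
    cut op f (p + c • p') s w = cut op f p s w + c • cut op f p' s w := by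
  have : cut op f (p + c • p') s = cut op f p s + c • cut op f p' s := word_ext fun u => by
    rw [LinearMap.add_apply, LinearMap.smul_apply, cut_word, cut_word, cut_word,
      Finset.smul_sum, ← Finset.sum_add_distrib]
    refine Finset.sum_congr rfl fun i _ => ?_
    rw [add_mul, smul_mul_assoc, map_add, map_smul, LinearMap.add_apply, LinearMap.smul_apply]
  rw [this]; rfl

theorem cut_suffix_add_smul (op : CA →ₗ[Coef] CA →ₗ[Coef] CA) (f : Letter → CA) (p s s' : CA)
    (c : Coef) (w : CA) :
    cut op f p (s + c • s') w = cut op f p s w + c • cut op f p s' w := by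
  have : cut op f p (s + c • s') = cut op f p s + c • cut op f p s' := word_ext fun u => by
    rw [LinearMap.add_apply, LinearMap.smul_apply, cut_word, cut_word, cut_word,
      Finset.smul_sum, ← Finset.sum_add_distrib]
    refine Finset.sum_congr rfl fun i _ => ?_
    rw [add_mul, smul_mul_assoc, map_add, map_smul]
  rw [this]; rfl

theorem cut_mul_e_mul (op : CA →ₗ[Coef] CA →ₗ[Coef] CA) (f : Letter → CA) (p s w v : CA) {k : ℕ+}
    (hk : 2 ≤ k) : cut op f p s (w * e k * v)
      = cut op f p (s * (antiLift f v * (f (Letter.g k) + hbar • f (Letter.g (k - 1))))) w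
        + cut op f (p * w * e k) s v := by
  have h := fun j => cut_mul_letter_mul op f p s w v (Letter.g j)
  rw [e_of_two_le hk, mul_add, mul_smul_comm, add_mul, smul_mul_assoc, map_add, map_smul, g, g,
    h, h, mul_add, mul_add, mul_add, mul_smul_comm, mul_smul_comm, mul_smul_comm,
    cut_prefix_add_smul, cut_suffix_add_smul, smul_add, ← mul_assoc, ← mul_assoc]
  abel

/-! ### Values of the symmetrizations -/

theorem ZqM_rat_smul (q : ℂ) (M : ℕ) (c : ℚ) (x : CA) : ZqM q M (c • x) = c * ZqM q M x := by
  rw [← algebraMap_smul Coef c x, LinearMap.map_smulₛₗ, smul_eq_mul]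
  simp [evalHbar]

theorem tendsto_cut_star {q : ℂ} (hq : ‖q‖ < 1) {y y' : CA} (hy : y ∈ admH0) (hy' : y' ∈ admH0)
    (m : ℕ) : Tendsto (fun M => ZqM q M (cut har psiStarLetter y y' (g 1 ^ m))) atTop
      (𝓝 (PowerSeries.coeff m (serStar q y * negX (serStar q y')))) := by
  rw [PowerSeries.coeff_mul]
  simp only [cut_star_g_one_pow, map_sum, ZqM_rat_smul, PowerSeries.coeff_rescale, serStar,
    coeff_serZ]
  refine tendsto_finsetSum _ fun i _ => ?_
  have h1 := admH0_mul_mem_hatH0 hy (g_one_pow_mem_hatH0 i.1)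
  have h2 := admH0_mul_mem_hatH0 hy' (g_one_pow_mem_hatH0 i.2)
  have h := (tendsto_Zq hq (har_mem_hatH0 h1 h2)).const_mul (((-1 : ℚ) ^ i.2 : ℚ) : ℂ)
  rw [Zq_har hq h1 h2] at h
  convert h using 2
  push_cast
  ring

theorem serSh_sub_mem_Nq {q : ℂ} (hq : ‖q‖ < 1) {x y : CA} (h : Comparable x y) :
    serSh q x - serSh q y ∈ serIn (Nq q hq) := fun n => by
  have hf := fS_mem_hatH0 n
  rw [map_sub, serSh, serSh, coeff_serZ, coeff_serZ, ← Zq_sub hq (hatH0_mul_mem h.left_mem hf)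
    (admH0_mul_mem_hatH0 h.right_mem hf)]
  exact Zq_mem_Nq hq (h.mul_sub_mem_nn hf)

theorem tendsto_cut_sh {q : ℂ} (hq : ‖q‖ < 1) {x x' : CA} (hx : x ∈ hatH0) (hx' : x' ∈ hatH0)
    (m : ℕ) : Tendsto (fun M => ZqM q M (cut shL psiShLetter x x' (EOnes m))) atTop
      (𝓝 (PowerSeries.coeff m (serSh q x * negX (serSh q x')))) := by
  rw [PowerSeries.coeff_mul]
  simp only [cut_sh_EOnes, map_sum, mul_smul_comm, sh_rat_smul_right, ZqM_rat_smul,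
    PowerSeries.coeff_rescale, serSh, coeff_serZ]
  refine tendsto_finsetSum _ fun i _ => ?_
  have h := (tendsto_ZqM_sh hq (hatH0_mul_mem hx (fS_mem_hatH0 i.1))
    (hatH0_mul_mem hx' (fS_mem_hatH0 i.2))).const_mul (((-1 : ℚ) ^ i.2 : ℚ) : ℂ)
  convert h using 2
  push_cast
  ring

/-- The contributions of one block of ones agree modulo `𝒩_q + 𝒫_q`. -/
theorem coeff_block_sub_mem {q : ℂ} (hq : ‖q‖ < 1) {x y x' y' : CA} (h : Comparable x y)
    (h' : Comparable x' y') : serStar q y * negX (serStar q y') - serSh q x * negX (serSh q x')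
      ∈ serIn (Nq q hq ⊔ Pq q hq) := by
  have hN : ∀ x ∈ hatZ q hq, ∀ y ∈ Nq q hq, x * y ∈ Nq q hq := fun x hx y hy =>
    hatZ_mul_mem_Nq hq hx hy
  have hx' : serSh q x' ∈ serIn (hatZ q hq) :=
    serZ_mem hq fun n => hatH0_mul_mem h'.left_mem (fS_mem_hatH0 n)
  have h1 := serIn_mul hN (serIn_negX hx') (serSh_sub_mem_Nq hq h)
  have h2 := serIn_mul hN (serSh_mem hq h.right_mem) (serIn_negX (serSh_sub_mem_Nq hq h'))
  have h3 := serSh_mul_negX_sub_mem hq h.right_mem h'.right_mem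
  intro n
  have h4 := neg_mem (serIn_add (serIn_mono le_sup_left (serIn_add h1 h2)) h3 n)
  rw [← map_neg] at h4
  convert h4 using 2
  rw [map_sub]
  ring

/-- The two limits exist and agree, for words with a prefix. The induction splits off one maximal
block of ones at a time. -/
theorem exists_tendsto_cut {q : ℂ} (hq : ‖q‖ < 1) (l : List ℕ+) : ∀ (m : ℕ) (x y : CA),
    Comparable x y → ∃ a b : ℂ,
      Tendsto (fun M => ZqM q M (cut har psiStarLetter y 1 (g 1 ^ m * gIdx l))) atTop (𝓝 a) ∧
      Tendsto (fun M => ZqM q M (cut shL psiShLetter x 1 (EAux m l))) atTop (𝓝 b) ∧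
      a ∈ ZqSpace q hq ∧ a - b ∈ Nq q hq ⊔ Pq q hq := by
  induction l with
  | nil =>
    intro m x y h
    refine ⟨_, _, ?_, tendsto_cut_sh hq h.left_mem one_mem_hatH0 m,
      serStar_mul_negX_mem hq h.right_mem one_mem_admH0 m, ?_⟩
    · simpa [gIdx] using tendsto_cut_star hq h.right_mem one_mem_admH0 m
    · rw [← map_sub]; exact coeff_block_sub_mem hq h comparable_one m
  | cons k l ih =>
    intro m x y h
    rw [EAux]
    split_ifs with hk
    · have := ih (m + 1) x y h
      rwa [pow_succ, mul_assoc, show g 1 * gIdx l = gIdx (k :: l) by simp [gIdx, hk]] at this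
    · have hk2 : 2 ≤ k := PNat.add_one_le_iff.2 (lt_of_le_of_ne (one_le (a := k)) (Ne.symm hk))
      obtain ⟨a, b, ha, hb, haZ, hab⟩ := ih 0 _ _ (h.mul_e m hk2)
      have hs := comparable_psi l hk2
      have hstar : g 1 ^ m * gIdx (k :: l)
          = g 1 ^ m * FreeAlgebra.ι Coef (Letter.g k) * gIdx l := by
        simp [gIdx, g, mul_assoc]
      rw [pow_zero, one_mul] at ha
      refine ⟨_, _,
        ((tendsto_cut_star hq h.right_mem hs.right_mem m).add ha).congr fun M => ?_,
        ((tendsto_cut_sh hq h.left_mem hs.left_mem m).add hb).congr fun M => ?_,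
        add_mem (serStar_mul_negX_mem hq h.right_mem hs.right_mem m) haZ, ?_⟩
      · rw [hstar, cut_mul_letter_mul, map_add, one_mul]
        rfl
      · rw [cut_mul_e_mul _ _ _ _ _ _ hk2, map_add, one_mul]
      · rw [add_sub_add_comm, ← map_sub]
        exact add_mem (coeff_block_sub_mem hq h hs m) hab

end QSMZV
end

theorem mainTheorem2 (q : ℂ) (hq0 : 0 < ‖q‖) (hq1 : ‖q‖ < 1) :
    -- `𝒵_q` is a unital subring of `ℂ`, and `𝒩_q + 𝒫_q` is an ideal of it
    (1 ∈ QSMZV.ZqSpace q hq1 ∧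
      (∀ x ∈ QSMZV.ZqSpace q hq1, ∀ y ∈ QSMZV.ZqSpace q hq1, x * y ∈ QSMZV.ZqSpace q hq1) ∧
      QSMZV.Nq q hq1 ⊔ QSMZV.Pq q hq1 ≤ QSMZV.ZqSpace q hq1 ∧
      (∀ x ∈ QSMZV.ZqSpace q hq1, ∀ y ∈ QSMZV.Nq q hq1 ⊔ QSMZV.Pq q hq1,
        x * y ∈ QSMZV.Nq q hq1 ⊔ QSMZV.Pq q hq1)) ∧
    ∀ k : List ℕ+,
      -- both values are limits that exist and lie in `𝒵_q`
      Filter.Tendsto (fun M => QSMZV.ZSStarM q M (QSMZV.gIdx k)) Filter.atTop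
        (nhds (QSMZV.ZSStar q (QSMZV.gIdx k))) ∧
      Filter.Tendsto (fun M => QSMZV.ZSShM q M (QSMZV.EIdx k)) Filter.atTop
        (nhds (QSMZV.ZSSh q (QSMZV.EIdx k))) ∧
      QSMZV.ZSStar q (QSMZV.gIdx k) ∈ QSMZV.ZqSpace q hq1 ∧
      QSMZV.ZSSh q (QSMZV.EIdx k) ∈ QSMZV.ZqSpace q hq1 ∧
      -- they agree modulo `𝒩_q + 𝒫_q`
      QSMZV.ZSStar q (QSMZV.gIdx k) - QSMZV.ZSSh q (QSMZV.EIdx k)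
        ∈ QSMZV.Nq q hq1 ⊔ QSMZV.Pq q hq1 := by
  refine ⟨⟨QSMZV.one_mem_ZqSpace hq1, fun x hx y hy => QSMZV.ZqSpace_mul_mem hq1 hx hy,
    QSMZV.NqPq_le_ZqSpace hq1, fun x hx y hy => QSMZV.ZqSpace_mul_mem_NqPq hq1 hx hy⟩,
    fun k => ?_⟩
  obtain ⟨a, b, ha, hb, haZ, hab⟩ := QSMZV.exists_tendsto_cut hq1 k 0 1 1 QSMZV.comparable_one
  have ha' : Filter.Tendsto (fun M => QSMZV.ZSStarM q M (QSMZV.gIdx k)) Filter.atTop (nhds a) := by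
    simpa only [QSMZV.ZSStarM, QSMZV.wStar_eq_cut, pow_zero, one_mul] using ha
  have hb' : Filter.Tendsto (fun M => QSMZV.ZSShM q M (QSMZV.EIdx k)) Filter.atTop (nhds b) := by
    simpa only [QSMZV.ZSShM, QSMZV.wSh_eq_cut, QSMZV.EIdx] using hb
  rw [show QSMZV.ZSStar q (QSMZV.gIdx k) = a from ha'.limUnder_eq,
    show QSMZV.ZSSh q (QSMZV.EIdx k) = b from hb'.limUnder_eq]
  refine ⟨ha', hb', haZ, ?_, hab⟩
  have h := sub_mem haZ (QSMZV.NqPq_le_ZqSpace hq1 hab)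
  rwa [sub_sub_cancel] at h
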